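/- **Setting.** A constraint map-germ is a pair of $C^\infty$ map-germs $g=(g_1,\dots,g_q):(\mathbb R^n,0)\to\mathbb R^q$, $h=(h_1,\dots,h_r):(\mathbb R^n,0)\to(\mathbb R^r,0)$ with $g_i(0)\le 0$ for all $i$. Put $I=\{i: g_i(0)=0\}$, $M(g,h)=\{x: g_i(x)\le0,\ h_j(x)=0 \text{ for all } i,j\}$, $$C^+=\{d: \exists\, x_m\in M(g,h),\ x_m\to0,\ t_m>0,\ t_mx_m\to d\},\qquad L^+=\{d: dg_{i,0}(d)\le0\ (i\in I),\ dh_0(d)=0\},$$ and $X^\circ=\{v: v\cdot d\le0\ \forall d\in X\}$. LICQ: the differentials at $0$ of $g_i$ $(i\in I)$ and of all $h_j$ are linearly independent. MFCQ: the $dh_{j,0}$ are linearly independent and some $d$ satisfies $dg_{i,0}(d)<0$ $(i\in I)$ and $dh_0(d)=0$. ACQ: $C^+=L^+$. GCQ: $(C^+)^\circ=(L^+)^\circ$. $(g,h)$ and $(g',h')$ (with the same $n,q,r$) are $\mathcal K[G]$-equivalent if, near $0$, $g(x)=C(x)g'(\varphi(x))+B(x)h'(\varphi(x))$ and $h(x)=A(x)h'(\varphi(x))$,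 where $\varphi$ is a diffeomorphism-germ of $(\mathbb R^n,0)$, $A,B,C$ are smooth matrix-valued germs, $A(x)$ is invertible, and $C(x)$ is a diagonal matrix with positive diagonal times a permutation matrix. A class is a $\mathcal K[G]$-equivalence class; a class satisfies a condition if every germ in it does, and violates it if no germ in it does. All $\epsilon_j,\epsilon'_j,\epsilon_{ij},\delta_j$ are in $\{1,-1\}$, and $\alpha,\alpha_{ij}=\alpha_{ji}\in\mathbb R$. Condition $(\ast)$: $4\delta_1\delta_2-\alpha^2\ne0$. Condition $(\ast\ast)$: $4\delta_i\delta_j-\alpha_{ij}^2\neq0$ for $i\ne j$ in $\{1,2,3\}$ and $4\delta_1\delta_2\delta_3+\alpha_{12}\alpha_{13}\alpha_{23}-\delta_3\alpha_{12}^2-\delta_2\alpha_{13}^2-\delta_1\alpha_{23}^2\ne0$. In every normal form $n$ is large enough that the sum $\sum_j\epsilon_jx_j^2$ is nonempty (in type E2 below, $n\ge3$ suffices). **Theorem (Generic CQ classification).** **(I) LICQ.** A constraint map-germ $(g,h)$ satisfies LICQ if and only if, with $s=|I|$, one has $s+r\le n$ and $(g_I,h)$ is $\mathcal K[G]$-equivalent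 to the regular germ $\big((x_1,\dots,x_s),(x_{s+1},\dots,x_{s+r})\big)$. In particular every class listed in (III)–(V) violates LICQ. **(II) MFCQ.** If the $dh_{j,0}$ are linearly dependent, then MFCQ fails. In particular all classes in (III) and (V) violate MFCQ. A class in (IV) satisfies MFCQ if $l_1>0$ and violates it if $l_1=0$. **(III) One equality, no inequality constraint.** All the following classes violate ACQ. They satisfy GCQ under the stated condition, and violate GCQ otherwise. - E(1,k), $2\le k\le5$: $h=x_1^k+\sum_{j=2}^n\epsilon_jx_j^2$. GCQ: ($k=2$ and some $\epsilon_j=-1$, $2\le j\le n$) or ($k\ge3$ and $\{\epsilon_2,\dots,\epsilon_n\}=\{1,-1\}$). - E2: $h=x_1^3+\epsilon_2x_1x_2^2+x_3^2+\sum_{j=4}^n\epsilon_jx_j^2$. GCQ: some $\epsilon_j=-1$, $4\le j\le n$. **(IV) Inequality constraints only.** $g=\big(x_1,\dots,x_{q-1},\ \sum_{j=1}^{l_1}x_j-\sum_{j=l_1+1}^{l}x_j+\tilde g\big)$ with $l\ge 0$ and $0\le l_1\le\lceil l/2\rceil$, and $\tilde g$, $l$ as below. If $l_1>0$, ACQ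 and GCQ hold. If $l_1=0$, each of ACQ and GCQ holds under the stated condition and fails otherwise. - (1,k), $2\le k\le5$, $l=q-1$: $\tilde g=\epsilon_qx_q^k+\sum_{j\ge q+1}\epsilon_jx_j^2$. ACQ: $\epsilon_q=\dots=\epsilon_n=-1$, or ($k\ge3$ and $\epsilon_{q+1}=\dots=\epsilon_n=-1$). GCQ: ($k=2$ and $(\epsilon_q,\dots,\epsilon_n)\ne(1,\dots,1)$) or $(\epsilon_{q+1},\dots,\epsilon_n)\neq(1,\dots,1)$. - (2), $l=q-1$: $\tilde g=x_q^3+\epsilon_{q+1}x_qx_{q+1}^2+\sum_{j\ge q+2}\epsilon_jx_j^2$. ACQ: $\epsilon_{q+2}=\dots=\epsilon_n=-1$. GCQ: $(\epsilon_{q+2},\dots,\epsilon_n)\ne(1,\dots,1)$. - (3,k), $2\le k\le4$, $l=q-2$: $\tilde g=\epsilon_{q-1}x_{q-1}^k+\sum_{j\ge q}\epsilon_jx_j^2$. ACQ: $\epsilon_{q-1}=\dots=\epsilon_n=-1$, or ($k\ge3$ and $\epsilon_q=\dots=\epsilon_n=-1$). GCQ: $(\epsilon_q,\dots,\epsilon_n)\ne(1,\dots,1)$.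 - (4,k), $k=3,4$, $l=q-2$: $\tilde g=\epsilon_qx_q^k+x_{q-1}x_q+\sum_{j\ge q+1}\epsilon_jx_j^2$. ACQ: never. GCQ: $(\epsilon_{q+1},\dots,\epsilon_n)\ne(1,\dots,1)$ or $\epsilon_q=(-1)^{k+1}$. - (5), $l=q-2$: $\tilde g=\epsilon_{q-1}x_{q-1}^2+x_q^3+\sum_{j\ge q+1}\epsilon_jx_j^2$. ACQ: $\epsilon_{q-1}=\epsilon_{q+1}=\dots=\epsilon_n=-1$. GCQ: $(\epsilon_{q+1},\dots,\epsilon_n)\ne(1,\dots,1)$. - (6), $l=q-3$, $(\ast)$: $\tilde g=\delta_1x_{q-1}^2+\delta_2x_{q-2}^2+\alpha x_{q-2}x_{q-1}+\sum_{j\ge q}\epsilon_jx_j^2$. ACQ: $\delta_1=\delta_2=-1$, $\alpha<2$, $\epsilon_q=\dots=\epsilon_n=-1$. GCQ: $(\epsilon_q,\dots,\epsilon_n)\ne(1,\dots,1)$. - (7), $l=q-3$: $\tilde g=\epsilon_{q-2}(x_{q-2}+\epsilon'_{q-1}x_{q-1})^2+\epsilon_{q-1}x_{q-1}^3+\sum_{j\ge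 q}\epsilon_jx_j^2$. ACQ: $\epsilon_{q-2}=\epsilon_q=\dots=\epsilon_n=-1$. GCQ: $(\epsilon_q,\dots,\epsilon_n)\ne(1,\dots,1)$. - (8), $l=q-3$: $\tilde g=\epsilon_{q-2}x_{q-2}^3+\epsilon_{q-1}x_{q-1}^2+\epsilon'_{q-1}x_{q-2}x_{q-1}+\sum_{j\ge q}\epsilon_jx_j^2$. ACQ: $\epsilon_{q-1}=\epsilon'_{q-1}=\epsilon_q=\dots=\epsilon_n=-1$. GCQ: $(\epsilon_q,\dots,\epsilon_n)\ne(1,\dots,1)$. - (9), $l=q-3$: $\tilde g=x_q^3+\epsilon_{01}x_{q-1}x_q+\epsilon_{02}x_{q-2}x_q+\epsilon_{12}x_{q-2}x_{q-1}+\sum_{j\ge q+1}\epsilon_jx_j^2$. ACQ: never. GCQ: $(\epsilon_{q+1},\dots,\epsilon_n)\ne(1,\dots,1)$ or $\epsilon_{01}=1$ or $\epsilon_{02}=1$. - (10), $l=q-4$, $(\ast\ast)$: $\tilde g=\sum_{j=1}^3\delta_jx_{q-4+j}^2+\sum_{1\le i<j\le3}\alpha_{ij}x_{q-4+i}x_{q-4+j}+\epsilon_0x_{q-3}x_{q-2}x_{q-1}+\sum_{j\ge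 q}\epsilon_jx_j^2$. ACQ: $\delta_1=\delta_2=\delta_3=-1$, $\epsilon_q=\dots=\epsilon_n=-1$, and for some distinct $i,j,k\in\{1,2,3\}$ either ($\alpha_{ij}\le0$, $\alpha_{ik}\le0$, $\alpha_{jk}<2$) or ($0<\alpha_{ij}<2$, $0<\alpha_{ik}<2$, $\alpha_{jk}+\frac{\alpha_{ij}\alpha_{ik}}2<2\sqrt{(1-\alpha_{ij}^2/4)(1-\alpha_{ik}^2/4)}$). GCQ: $(\epsilon_q,\dots,\epsilon_n)\ne(1,\dots,1)$. **(V) One equality and $q\ge1$ inequality constraints.** $g=(x_1,\dots,x_q)$ and $h$ as below. All these classes violate ACQ. They satisfy GCQ under the stated condition, and violate GCQ otherwise. - (1,k), $q=1$, $2\le k\le4$: $h=x_1^k+\sum_{j\ge2}\epsilon_jx_j^2$. GCQ: $\{\epsilon_2,\dots,\epsilon_n\}=\{1,-1\}$. - (2), $q=1$: $h=x_2^3+x_1^2+\sum_{j\ge3}\epsilon_jx_j^2$. GCQ: $\{\epsilon_3,\dots,\epsilon_n\}=\{1,-1\}$. - (3,k), $q=1$, $k=3,4$: $h=x_2^k+\epsilon_1x_1x_2+\sum_{j\ge3}\epsilon_jx_j^2$.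 GCQ: ($k$ even and some $\epsilon_j=-1$, $3\le j\le n$) or ($k$ odd and ($\epsilon_1=1$ or $\{\epsilon_3,\dots,\epsilon_n\}=\{1,-1\}$)). - (4), $q=2$, $(\ast)$: $h=\delta_1x_1^2+\delta_2x_2^2+\alpha x_1x_2+\sum_{j\ge3}\epsilon_jx_j^2$. GCQ: $\{\epsilon_3,\dots,\epsilon_n\}=\{1,-1\}$. - (5), $q=2$: $h=x_1^3+\epsilon_1x_2^2+\epsilon_2x_1x_2+\sum_{j\ge3}\epsilon_jx_j^2$. GCQ: $\{\epsilon_3,\dots,\epsilon_n\}=\{1,-1\}$. - (6), $q=2$: $h=(x_1+\epsilon_1x_2)^2+\epsilon_2x_2^3+\sum_{j\ge3}\epsilon_jx_j^2$. GCQ: $\{\epsilon_3,\dots,\epsilon_n\}=\{1,-1\}$. - (7), $q=2$: $h=x_3^3+\epsilon_1x_2x_3+\epsilon_2x_3x_1+\epsilon_3x_1x_2+\sum_{j\ge4}\epsilon_jx_j^2$. GCQ: $\{\epsilon_4,\dots,\epsilon_n\}=\{1,-1\}$ or $\epsilon_1=1$ or $\epsilon_2=1$. - (8), $q=3$, $(\ast\ast)$: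 $h=\sum_{j=1}^3\delta_jx_j^2+\sum_{1\le i<j\le3}\alpha_{ij}x_ix_j+\epsilon_1x_1x_2x_3+\sum_{j\ge4}\epsilon_jx_j^2$. GCQ: $\{\epsilon_4,\dots,\epsilon_n\}=\{1,-1\}$. -/

import Mathlib

open Filter Topology
open scoped ContDiff Matrix

noncomputable section

namespace CQ

/-! ### Constraint map-germs at the origin of `ℝⁿ`

A map-germ at `0` is given by a representative defined on all of `ℝⁿ`; every notion below
depends only on the values of the representative near `0`. -/

/-- The space `ℝⁿ`. -/
abbrev Vec (n : ℕ) : Type := Fin n → ℝ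

/-- The map `f` is `C^∞` on a neighbourhood of the origin. -/
def SmoothGerm {n : ℕ} {F : Type} [NormedAddCommGroup F] [NormedSpace ℝ F]
    (f : Vec n → F) : Prop :=
  ∀ᶠ x in 𝓝 (0 : Vec n), ContDiffAt ℝ ∞ f x

/-- The feasible set `M(g,h)`. -/
def feasibleSet {n q r : ℕ} (g : Vec n → Fin q → ℝ) (h : Vec n → Fin r → ℝ) : Set (Vec n) :=
  {x | (∀ i, g x i ≤ 0) ∧ ∀ j, h x j = 0}

/-- Indices of the inequality constraints that are active at the origin. -/
abbrev Active {n q : ℕ} (g : Vec n → Fin q → ℝ) : Type := {i : Fin q // g 0 i = 0}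

/-- The differential at the origin of the `i`-th component of `f`. -/
def diff {n m : ℕ} (f : Vec n → Fin m → ℝ) (i : Fin m) : Vec n →L[ℝ] ℝ :=
  fderiv ℝ (fun x => f x i) 0

/-! ### The four constraint qualifications -/

/-- LICQ: the Jacobi matrix of `(g_I, h)` at the origin has linearly independent rows. -/
def LICQ {n q r : ℕ} (g : Vec n → Fin q → ℝ) (h : Vec n → Fin r → ℝ) : Prop :=
  LinearIndependent ℝ (Sum.elim (fun i : Active g => diff g i.1) (fun j : Fin r => diff h j))

/-- MFCQ. -/
def MFCQ {n q r : ℕ} (g : Vec n → Fin q → ℝ) (h : Vec n → Fin r → ℝ) : Prop :=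
  LinearIndependent ℝ (diff h) ∧
    ∃ d : Vec n, (∀ i : Active g, diff g i.1 d < 0) ∧ ∀ j, diff h j d = 0

/-- The tangent cone `C⁺(g,h)`. -/
def tangentCone {n q r : ℕ} (g : Vec n → Fin q → ℝ) (h : Vec n → Fin r → ℝ) : Set (Vec n) :=
  {d | ∃ (x : ℕ → Vec n) (t : ℕ → ℝ), (∀ m, x m ∈ feasibleSet g h) ∧
    Tendsto x atTop (𝓝 0) ∧ (∀ m, 0 < t m) ∧ Tendsto (fun m => t m • x m) atTop (𝓝 d)}

/-- The linearized cone `L⁺(g,h)`. -/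
def linearizedCone {n q r : ℕ} (g : Vec n → Fin q → ℝ) (h : Vec n → Fin r → ℝ) : Set (Vec n) :=
  {d | (∀ i : Active g, diff g i.1 d ≤ 0) ∧ ∀ j, diff h j d = 0}

/-- The polar of a subset of `ℝⁿ`. -/
def polar {n : ℕ} (X : Set (Vec n)) : Set (Vec n) :=
  {v | ∀ d ∈ X, v ⬝ᵥ d ≤ 0}

/-- ACQ. -/
def ACQ {n q r : ℕ} (g : Vec n → Fin q → ℝ) (h : Vec n → Fin r → ℝ) : Prop :=
  tangentCone g h = linearizedCone g h

/-- GCQ. -/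
def GCQ {n q r : ℕ} (g : Vec n → Fin q → ℝ) (h : Vec n → Fin r → ℝ) : Prop :=
  polar (tangentCone g h) = polar (linearizedCone g h)

/-! ### `K[G]`-equivalence -/

/-- `φ` is a diffeomorphism-germ `(ℝⁿ,0) → (ℝⁿ,0)`. -/
def IsDiffeoGerm {n : ℕ} (φ : Vec n → Vec n) : Prop :=
  SmoothGerm φ ∧ φ 0 = 0 ∧ ∃ ψ : Vec n → Vec n, SmoothGerm ψ ∧ ψ 0 = 0 ∧
    (∀ᶠ x in 𝓝 (0 : Vec n), ψ (φ x) = x) ∧ ∀ᶠ x in 𝓝 (0 : Vec n), φ (ψ x) = x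

/-- The group generated by the diagonal matrices with positive diagonal entries and the
permutation matrices (their semidirect product). -/
def Ggp (q : ℕ) : Set (Matrix (Fin q) (Fin q) ℝ) :=
  {C | ∃ (c : Fin q → ℝ) (σ : Equiv.Perm (Fin q)), (∀ i, 0 < c i) ∧
    C = Matrix.diagonal c * σ.permMatrix ℝ}

/-- `(g,h)` and `(g',h')` are `K[G]`-equivalent:
`(g,h)(x) = (C(x) g'(φ x) + B(x) h'(φ x), A(x) h'(φ x))` near the origin, where `φ` (the inverse
of the coordinate change of the source) is a diffeomorphism-germ and the block matrix with
blocks `C, B, 0, A` is a smooth map-germ into the group `G`. -/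
def KGEquiv {n q r : ℕ} (g : Vec n → Fin q → ℝ) (h : Vec n → Fin r → ℝ)
    (g' : Vec n → Fin q → ℝ) (h' : Vec n → Fin r → ℝ) : Prop :=
  ∃ (φ : Vec n → Vec n) (C : Vec n → Matrix (Fin q) (Fin q) ℝ)
    (B : Vec n → Matrix (Fin q) (Fin r) ℝ) (A : Vec n → Matrix (Fin r) (Fin r) ℝ),
    IsDiffeoGerm φ ∧
    (∀ i j, SmoothGerm fun x => C x i j) ∧
    (∀ i j, SmoothGerm fun x => B x i j) ∧
    (∀ i j, SmoothGerm fun x => A x i j) ∧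
    ∀ᶠ x in 𝓝 (0 : Vec n), C x ∈ Ggp q ∧ IsUnit (A x) ∧
      g x = C x *ᵥ g' (φ x) + B x *ᵥ h' (φ x) ∧ h x = A x *ᵥ h' (φ x)

/-! ### Normal forms -/

/-- The coordinate `x_j`, numbered from `1` to `n` (and `0` for a number out of range, which
does not occur in an admissible normal form). -/
def coord {n : ℕ} (x : Vec n) (j : ℕ) : ℝ :=
  if hj : 1 ≤ j ∧ j ≤ n then x ⟨j - 1, by omega⟩ else 0

/-- `a` is `1` or `-1`. -/
def IsSign (a : ℝ) : Prop := a = 1 ∨ a = -1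

/-- The quadratic form `∑_{j=a}^{n} ε_j x_j²`. -/
def tail {n : ℕ} (ε : ℕ → ℝ) (a : ℕ) (x : Vec n) : ℝ :=
  ∑ j ∈ Finset.Icc a n, ε j * coord x j ^ 2

/-- Nondegeneracy of the binary form `δ₁ a² + δ₂ b² + α a b`. -/
def Star (δ : ℕ → ℝ) (α : ℝ) : Prop := 4 * δ 1 * δ 2 - α ^ 2 ≠ 0

/-- Nondegeneracy of the ternary form `∑ δ_i y_i² + ∑_{i<j} α_{ij} y_i y_j` and of its
restrictions to the coordinate planes. -/
def StarStar (δ : ℕ → ℝ) (α : ℕ → ℕ → ℝ) : Prop :=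
  (∀ i ∈ Finset.Icc 1 3, ∀ j ∈ Finset.Icc 1 3, i ≠ j → 4 * δ i * δ j - α i j ^ 2 ≠ 0) ∧
  4 * δ 1 * δ 2 * δ 3 + α 1 2 * α 1 3 * α 2 3
    - δ 3 * α 1 2 ^ 2 - δ 2 * α 1 3 ^ 2 - δ 1 * α 2 3 ^ 2 ≠ 0

/-- `{ε_a, …, ε_n} = {1, -1}`. -/
def BothSigns (ε : ℕ → ℝ) (a n : ℕ) : Prop := ε '' Set.Icc a n = {1, -1}

/-- `ε_a = ⋯ = ε_n = s`. -/
def AllEq (ε : ℕ → ℝ) (a n : ℕ) (s : ℝ) : Prop := ∀ j ∈ Set.Icc a n, ε j = s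

/-- The empty tuple of constraint functions. -/
def noConstraint {n : ℕ} : Vec n → Fin 0 → ℝ := fun _ j => j.elim0

/-- A single function as a one-component map. -/
def single {n : ℕ} (f : Vec n → ℝ) : Vec n → Fin 1 → ℝ := fun x _ => f x

/-- The map `(x_{a+1}, …, x_{a+m})`. -/
def coords {n : ℕ} (a m : ℕ) : Vec n → Fin m → ℝ := fun x i => coord x (a + i + 1)

/-! #### One equality constraint, no inequality constraints -/

/-- Types `(1,k)` and `(2)`. -/
inductive EqType
  | t1 (k : ℕ)
  | t2

namespace EqType

def form {n : ℕ} (ε : ℕ → ℝ) (x : Vec n) : EqType → ℝ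
  | t1 k => coord x 1 ^ k + tail ε 2 x
  | t2 => coord x 1 ^ 3 + ε 2 * coord x 1 * coord x 2 ^ 2 + coord x 3 ^ 2 + tail ε 4 x

/-- The range of the parameters; `n` is large enough for the quadratic part to be present. -/
def Admissible (n : ℕ) : EqType → Prop
  | t1 k => 2 ≤ k ∧ k ≤ 5 ∧ 2 ≤ n
  | t2 => 3 ≤ n

def GCQCond (n : ℕ) (ε : ℕ → ℝ) : EqType → Prop
  | t1 k => (k = 2 ∧ ∃ j ∈ Set.Icc 2 n, ε j = -1) ∨ (3 ≤ k ∧ BothSigns ε 2 n)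
  | t2 => ∃ j ∈ Set.Icc 4 n, ε j = -1

end EqType

/-! #### Inequality constraints only -/

/-- Types `(1,k)`, `(2)`, `(3,k)`, `(4,k)`, `(5)`, …, `(10)`, together with the parameters that
are not signs `ε_j`. -/
inductive IneqType
  | t1 (k : ℕ)
  | t2
  | t3 (k : ℕ)
  | t4 (k : ℕ)
  | t5
  | t6 (δ : ℕ → ℝ) (α : ℝ)
  | t7 (ε' : ℝ)
  | t8 (ε' : ℝ)
  | t9 (ε01 ε02 ε12 : ℝ)
  | t10 (δ : ℕ → ℝ) (α : ℕ → ℕ → ℝ)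

namespace IneqType

/-- `q - l`. -/
def gap : IneqType → ℕ
  | t1 _ => 1
  | t2 => 1
  | t3 _ => 2
  | t4 _ => 2
  | t5 => 2
  | t6 _ _ => 3
  | t7 _ => 3
  | t8 _ => 3
  | t9 _ _ _ => 3
  | t10 _ _ => 4

/-- The number `l`. -/
def len (q : ℕ) (T : IneqType) : ℕ := q - T.gap

/-- The function `g̃(x_{l+1}, …, x_n)`. -/
def form {n : ℕ} (q : ℕ) (ε : ℕ → ℝ) (x : Vec n) : IneqType → ℝ
  | t1 k => ε q * coord x q ^ k + tail ε (q + 1) x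
  | t2 => coord x q ^ 3 + ε (q + 1) * coord x q * coord x (q + 1) ^ 2 + tail ε (q + 2) x
  | t3 k => ε (q - 1) * coord x (q - 1) ^ k + tail ε q x
  | t4 k => ε q * coord x q ^ k + coord x (q - 1) * coord x q + tail ε (q + 1) x
  | t5 => ε (q - 1) * coord x (q - 1) ^ 2 + coord x q ^ 3 + tail ε (q + 1) x
  | t6 δ α => δ 1 * coord x (q - 1) ^ 2 + δ 2 * coord x (q - 2) ^ 2
      + α * coord x (q - 2) * coord x (q - 1) + tail ε q x
  | t7 ε' => ε (q - 2) * (coord x (q - 2) + ε' * coord x (q - 1)) ^ 2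
      + ε (q - 1) * coord x (q - 1) ^ 3 + tail ε q x
  | t8 ε' => ε (q - 2) * coord x (q - 2) ^ 3 + ε (q - 1) * coord x (q - 1) ^ 2
      + ε' * coord x (q - 2) * coord x (q - 1) + tail ε q x
  | t9 ε01 ε02 ε12 => coord x q ^ 3 + ε01 * coord x (q - 1) * coord x q
      + ε02 * coord x (q - 2) * coord x q + ε12 * coord x (q - 2) * coord x (q - 1)
      + tail ε (q + 1) x
  | t10 δ α => δ 1 * coord x (q - 3) ^ 2 + δ 2 * coord x (q - 2) ^ 2 + δ 3 * coord x (q - 1) ^ 2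
      + α 1 2 * coord x (q - 3) * coord x (q - 2) + α 1 3 * coord x (q - 3) * coord x (q - 1)
      + α 2 3 * coord x (q - 2) * coord x (q - 1)
      + ε 0 * coord x (q - 3) * coord x (q - 2) * coord x (q - 1) + tail ε q x

/-- The normal form `(x_1, …, x_{q-1}, ∑_{j ≤ l₁} x_j - ∑_{l₁ < j ≤ l} x_j + g̃)`. -/
def normalForm (n q l₁ : ℕ) (ε : ℕ → ℝ) (T : IneqType) : Vec n → Fin q → ℝ := fun x i =>
  if i.val + 1 < q then coord x (i.val + 1)
  else ∑ j ∈ Finset.Icc 1 l₁, coord x j - ∑ j ∈ Finset.Icc (l₁ + 1) (T.len q), coord x j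
    + T.form q ε x

/-- The range of the parameters; `q` is large enough for `l ≥ 0`, and `n` is large enough for the
sum of the `ε_j x_j²` to be nonempty. -/
def Admissible (n q : ℕ) (T : IneqType) : Prop :=
  T.gap ≤ q ∧
  match T with
  | t1 k => 2 ≤ k ∧ k ≤ 5 ∧ q + 1 ≤ n
  | t2 => q + 2 ≤ n
  | t3 k => 2 ≤ k ∧ k ≤ 4 ∧ q ≤ n
  | t4 k => (k = 3 ∨ k = 4) ∧ q + 1 ≤ n
  | t5 => q + 1 ≤ n
  | t6 δ α => IsSign (δ 1) ∧ IsSign (δ 2) ∧ Star δ α ∧ q ≤ n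
  | t7 ε' => IsSign ε' ∧ q ≤ n
  | t8 ε' => IsSign ε' ∧ q ≤ n
  | t9 ε01 ε02 ε12 => IsSign ε01 ∧ IsSign ε02 ∧ IsSign ε12 ∧ q + 1 ≤ n
  | t10 δ α => (∀ j ∈ Finset.Icc 1 3, IsSign (δ j)) ∧ (∀ i j, α i j = α j i) ∧
      StarStar δ α ∧ q ≤ n

/-- The condition on the coefficients `α_{ij}` in the ACQ criterion for type `(10)`. -/
def Dagger (α : ℕ → ℕ → ℝ) : Prop :=
  ∃ i ∈ Finset.Icc 1 3, ∃ j ∈ Finset.Icc 1 3, ∃ k ∈ Finset.Icc 1 3, i ≠ j ∧ i ≠ k ∧ j ≠ k ∧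
    ((α i j ≤ 0 ∧ α i k ≤ 0 ∧ α j k < 2) ∨
      (0 < α i j ∧ α i j < 2 ∧ 0 < α i k ∧ α i k < 2 ∧
        α j k + α i j * α i k / 2
          < 2 * Real.sqrt ((1 - α i j ^ 2 / 4) * (1 - α i k ^ 2 / 4))))

def ACQCond (n q : ℕ) (ε : ℕ → ℝ) : IneqType → Prop
  | t1 k => AllEq ε q n (-1) ∨ (3 ≤ k ∧ AllEq ε (q + 1) n (-1))
  | t2 => AllEq ε (q + 2) n (-1)
  | t3 k => AllEq ε (q - 1) n (-1) ∨ (3 ≤ k ∧ AllEq ε q n (-1))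
  | t4 _ => False
  | t5 => ε (q - 1) = -1 ∧ AllEq ε (q + 1) n (-1)
  | t6 δ α => δ 1 = -1 ∧ δ 2 = -1 ∧ α < 2 ∧ AllEq ε q n (-1)
  | t7 _ => ε (q - 2) = -1 ∧ AllEq ε q n (-1)
  | t8 ε' => ε (q - 1) = -1 ∧ ε' = -1 ∧ AllEq ε q n (-1)
  | t9 _ _ _ => False
  | t10 δ α => δ 1 = -1 ∧ δ 2 = -1 ∧ δ 3 = -1 ∧ AllEq ε q n (-1) ∧ Dagger α

def GCQCond (n q : ℕ) (ε : ℕ → ℝ) : IneqType → Prop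
  | t1 k => (k = 2 ∧ ¬ AllEq ε q n 1) ∨ ¬ AllEq ε (q + 1) n 1
  | t2 => ¬ AllEq ε (q + 2) n 1
  | t3 _ => ¬ AllEq ε q n 1
  | t4 k => ¬ AllEq ε (q + 1) n 1 ∨ ε q = (-1) ^ (k + 1)
  | t5 => ¬ AllEq ε (q + 1) n 1
  | t6 _ _ => ¬ AllEq ε q n 1
  | t7 _ => ¬ AllEq ε q n 1
  | t8 _ => ¬ AllEq ε q n 1
  | t9 ε01 ε02 _ => ¬ AllEq ε (q + 1) n 1 ∨ ε01 = 1 ∨ ε02 = 1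
  | t10 _ _ => ¬ AllEq ε q n 1

end IneqType

/-! #### One equality constraint and `q ≥ 1` inequality constraints -/

/-- Types `(1,k)`, `(2)`, `(3,k)`, `(4)`, …, `(8)`, together with the parameters that are not
signs `ε_j`. -/
inductive MixedType
  | t1 (k : ℕ)
  | t2
  | t3 (k : ℕ)
  | t4 (δ : ℕ → ℝ) (α : ℝ)
  | t5
  | t6
  | t7
  | t8 (δ : ℕ → ℝ) (α : ℕ → ℕ → ℝ)

namespace MixedType

/-- The number `q` of inequality constraints. -/
def numIneq : MixedType → ℕ
  | t1 _ => 1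
  | t2 => 1
  | t3 _ => 1
  | t4 _ _ => 2
  | t5 => 2
  | t6 => 2
  | t7 => 2
  | t8 _ _ => 3

/-- The equality constraint `h`; the inequality constraints are `x_1, …, x_q`. -/
def form {n : ℕ} (ε : ℕ → ℝ) (x : Vec n) : MixedType → ℝ
  | t1 k => coord x 1 ^ k + tail ε 2 x
  | t2 => coord x 2 ^ 3 + coord x 1 ^ 2 + tail ε 3 x
  | t3 k => coord x 2 ^ k + ε 1 * coord x 1 * coord x 2 + tail ε 3 x
  | t4 δ α => δ 1 * coord x 1 ^ 2 + δ 2 * coord x 2 ^ 2 + α * coord x 1 * coord x 2 + tail ε 3 x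
  | t5 => coord x 1 ^ 3 + ε 1 * coord x 2 ^ 2 + ε 2 * coord x 1 * coord x 2 + tail ε 3 x
  | t6 => (coord x 1 + ε 1 * coord x 2) ^ 2 + ε 2 * coord x 2 ^ 3 + tail ε 3 x
  | t7 => coord x 3 ^ 3 + ε 1 * coord x 2 * coord x 3 + ε 2 * coord x 3 * coord x 1
      + ε 3 * coord x 1 * coord x 2 + tail ε 4 x
  | t8 δ α => δ 1 * coord x 1 ^ 2 + δ 2 * coord x 2 ^ 2 + δ 3 * coord x 3 ^ 2
      + α 1 2 * coord x 1 * coord x 2 + α 1 3 * coord x 1 * coord x 3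
      + α 2 3 * coord x 2 * coord x 3
      + ε 1 * coord x 1 * coord x 2 * coord x 3 + tail ε 4 x

/-- The range of the parameters; `n` is large enough for the sum of the `ε_j x_j²` to be
nonempty. -/
def Admissible (n : ℕ) : MixedType → Prop
  | t1 k => 2 ≤ k ∧ k ≤ 4 ∧ 2 ≤ n
  | t2 => 3 ≤ n
  | t3 k => 3 ≤ k ∧ k ≤ 4 ∧ 3 ≤ n
  | t4 δ α => IsSign (δ 1) ∧ IsSign (δ 2) ∧ Star δ α ∧ 3 ≤ n
  | t5 => 3 ≤ n
  | t6 => 3 ≤ n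
  | t7 => 4 ≤ n
  | t8 δ α => (∀ j ∈ Finset.Icc 1 3, IsSign (δ j)) ∧ (∀ i j, α i j = α j i) ∧
      StarStar δ α ∧ 4 ≤ n

def GCQCond (n : ℕ) (ε : ℕ → ℝ) : MixedType → Prop
  | t1 _ => BothSigns ε 2 n
  | t2 => BothSigns ε 3 n
  | t3 k => (Even k ∧ ∃ j ∈ Set.Icc 3 n, ε j = -1) ∨ (Odd k ∧ (ε 1 = 1 ∨ BothSigns ε 3 n))
  | t4 _ _ => BothSigns ε 3 n
  | t5 => BothSigns ε 3 n
  | t6 => BothSigns ε 3 n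
  | t7 => BothSigns ε 4 n ∨ ε 1 = 1 ∨ ε 2 = 1
  | t8 _ _ => BothSigns ε 4 n

end MixedType

end CQ

end

/-!
A `K[G]`-equivalence induces an isomorphism of the tangent spaces carrying the feasible set, the
tangent cone and the linearized cone of one constraint map to those of the other, so every
constraint qualification may be checked on the normal form. There the linearized cone is cut out by
equations and sign conditions on coordinates, and the last constraint is a function `f` vanishing
to second order. Writing `f (s • y) = s² H s y` with `H` continuous up to `s = 0`, tangent
directions satisfy the constraint imposed by the quadratic form `H 0`. Conversely, a direction with
`H 0 d < 0` is tangent, and a direction with `H 0 d = 0` is reached by moving a coordinate that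
enters `H` through a square, or by solving for it with a square root.

Hence ACQ asks for the sign of `H 0` on the linearized cone. For GCQ only the convex hull of the
tangent cone matters: a free coordinate occurring with a favourable sign can be moved in both
directions, so that any direction of the linearized cone is a midpoint of tangent ones. If no sign
is favourable, a coordinate of a tangent direction is bounded in terms of `d_1, …, d_p`, which
yields a half-space containing the tangent cone but not the linearized cone. The cubic terms decide
the remaining cases, where `H 0` couples a free coordinate with a constrained one. LICQ amounts to
`(g_I, h)` being a submersion, straightened by the inverse function theorem.
-/

noncomputable section

namespace CQ

/-! ### Tangent cones -/

section PosTangentCone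

lemma eventually_fst_pos {X : Type*} (l : Filter X) :
    ∀ᶠ p : ℝ × X in 𝓝[>] (0 : ℝ) ×ˢ l, 0 < p.1 :=
  tendsto_fst.eventually eventually_mem_nhdsWithin

variable {E F : Type*} [NormedAddCommGroup E] [NormedSpace ℝ E] [NormedAddCommGroup F]
  [NormedSpace ℝ F] {M : Set E} {d : E}

lemma tendsto_fst_smul_snd (d : E) :
    Tendsto (fun p : ℝ × E => p.1 • p.2) (𝓝[>] (0 : ℝ) ×ˢ 𝓝 d) (𝓝 0) := by
  have hfst : Tendsto (fun p : ℝ × E => p.1) (𝓝[>] (0 : ℝ) ×ˢ 𝓝 d) (𝓝 0) :=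
    tendsto_fst.mono_right nhdsWithin_le_nhds
  simpa only [zero_smul] using hfst.smul (tendsto_snd (f := 𝓝[>] (0 : ℝ)) (g := 𝓝 d))

lemma mem_posTangentConeAt_zero_of_tendsto_smul {t : ℕ → ℝ} {x : ℕ → E} (ht : ∀ m, 0 < t m)
    (hx : Tendsto x atTop (𝓝 0)) (hxM : ∀ᶠ m in atTop, x m ∈ M)
    (htx : Tendsto (fun m => t m • x m) atTop (𝓝 d)) : d ∈ posTangentConeAt M 0 :=
  mem_tangentConeAt_of_seq atTop (fun m => (⟨t m, (ht m).le⟩ : NNReal)) x hx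
    (by simpa only [zero_add] using hxM) htx

lemma frequently_smul_mem_of_zero_mem_closure (h0 : 0 ∈ closure M) :
    ∃ᶠ p in 𝓝[>] (0 : ℝ) ×ˢ 𝓝 (0 : E), p.1 • p.2 ∈ M := by
  refine frequently_iff.2 fun {U} hU => ?_
  obtain ⟨a, ha, b, hb, hab⟩ := mem_prod_iff.1 hU
  obtain ⟨s, hsa, hs⟩ := ((eventually_mem_set.2 ha).and eventually_mem_nhdsWithin).exists
  have hsb : ∀ᶠ x in 𝓝 (0 : E), s⁻¹ • x ∈ b := by
    refine (continuous_const_smul s⁻¹).tendsto 0 |>.eventually ?_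
    rwa [smul_zero]
  obtain ⟨x, hxM, hxb⟩ := ((mem_closure_iff_frequently.1 h0).and_eventually hsb).exists
  exact ⟨(s, s⁻¹ • x), hab ⟨hsa, hxb⟩, by rwa [smul_inv_smul₀ (ne_of_gt hs)]⟩

lemma tendsto_inv_nhdsGT_zero_of_tendsto_smul {ι : Type*} {l : Filter ι} {c : ι → NNReal}
    {x : ι → E} (hd : d ≠ 0) (hx : Tendsto x l (𝓝 0))
    (hcx : Tendsto (fun m => c m • x m) l (𝓝 d)) :
    Tendsto (fun m => ((c m : ℝ))⁻¹) l (𝓝[>] 0) := by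
  have hne := hcx.eventually_ne hd
  refine tendsto_nhdsWithin_iff.2 ⟨?_, hne.mono fun m hm => ?_⟩
  · have hratio : Tendsto (fun m => ‖x m‖ / ‖c m • x m‖) l (𝓝 (‖(0 : E)‖ / ‖d‖)) :=
      hx.norm.div hcx.norm (norm_ne_zero_iff.2 hd)
    rw [norm_zero, zero_div] at hratio
    refine hratio.congr' (hne.mono fun m hm => ?_)
    obtain ⟨-, hxm⟩ := smul_ne_zero_iff.1 hm
    rw [NNReal.smul_def, norm_smul, Real.norm_of_nonneg (c m).coe_nonneg, ← div_div,
      div_right_comm, div_self (norm_ne_zero_iff.2 hxm), one_div]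
  · exact inv_pos.2 (NNReal.coe_pos.2 (pos_iff_ne_zero.2 (smul_ne_zero_iff.1 hm).1))

lemma mem_posTangentConeAt_zero_iff :
    d ∈ posTangentConeAt M 0 ↔ ∃ᶠ p in 𝓝[>] (0 : ℝ) ×ˢ 𝓝 d, p.1 • p.2 ∈ M := by
  constructor
  · intro hd
    rcases eq_or_ne d 0 with rfl | hd0
    · exact frequently_smul_mem_of_zero_mem_closure
        (mem_closure_of_nonempty_tangentConeAt ⟨0, hd⟩)
    · obtain ⟨ι, l, hl, c, x, hx, hxM, hcx⟩ := exists_fun_of_mem_tangentConeAt hd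
      have hpair := (tendsto_inv_nhdsGT_zero_of_tendsto_smul hd0 hx hcx).prodMk hcx
      refine hpair.frequently (Eventually.frequently ?_)
      filter_upwards [hxM, hcx.eventually_ne hd0] with m hm hne
      rw [zero_add] at hm
      have hc : (c m : ℝ) ≠ 0 := NNReal.coe_ne_zero.2 (smul_ne_zero_iff.1 hne).1
      simpa only [NNReal.smul_def, inv_smul_smul₀ hc] using hm
  · intro hd
    obtain ⟨u, hu, huM⟩ :=
      exists_seq_forall_of_frequently (hd.and_eventually (eventually_fst_pos (𝓝 d)))
    refine mem_posTangentConeAt_zero_of_tendsto_smul (t := fun m => (u m).1⁻¹)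
      (fun m => inv_pos.2 (huM m).2) ((tendsto_fst_smul_snd d).comp hu)
      (.of_forall fun m => (huM m).1) ((tendsto_snd.comp hu).congr fun m => ?_)
    exact (inv_smul_smul₀ (huM m).2.ne' _).symm

lemma mem_posTangentConeAt_zero_of_curve {γ : ℝ → E} (hγ : Tendsto γ (𝓝[>] 0) (𝓝 d))
    (hM : ∀ᶠ s in 𝓝[>] (0 : ℝ), s • γ s ∈ M) : d ∈ posTangentConeAt M 0 :=
  mem_posTangentConeAt_zero_iff.2
    ((tendsto_id.prodMk hγ : Tendsto (fun s => (s, γ s)) _ _).frequently hM.frequently)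

lemma isClosed_posTangentConeAt (M : Set E) (x : E) : IsClosed (posTangentConeAt M x) := by
  rw [posTangentConeAt, tangentConeAt_eq_biInter_closure]
  exact isClosed_biInter fun _ _ => isClosed_closure

lemma mapsTo_posTangentConeAt {φ : E → F} {φ' : E →L[ℝ] F} {x : E} {M' : Set F}
    (hφ : HasFDerivWithinAt φ φ' M x) (hM : ∀ᶠ y in 𝓝[M] x, φ y ∈ M') :
    Set.MapsTo φ' (posTangentConeAt M x) (posTangentConeAt M' (φ x)) := by
  intro d hd
  obtain ⟨ι, l, hl, c, y, hy, hyM, hcy⟩ := exists_fun_of_mem_tangentConeAt hd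
  have hy' : Tendsto (fun m => x + y m) l (𝓝[M] x) :=
    tendsto_nhdsWithin_iff.2 ⟨by simpa only [add_zero] using tendsto_const_nhds.add hy, hyM⟩
  refine mem_tangentConeAt_of_seq l c (fun m => φ (x + y m) - φ x) ?_ ?_
    (hφ.lim (c := fun m => (c m : ℝ)) hy hyM hcy)
  · simpa only [sub_self, Function.comp_def] using
      (hφ.continuousWithinAt.tendsto.comp hy').sub_const (φ x)
  · simpa only [add_sub_cancel] using hy'.eventually hM

lemma eventually_apply_add_smul_neg {f : E → ℝ} {f' : E →L[ℝ] ℝ} {x : E}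
    (hf : HasFDerivAt f f' x) (h0 : f x = 0) (hd : f' d < 0) :
    ∀ᶠ s in 𝓝[>] (0 : ℝ), f (x + s • d) < 0 := by
  have hslope := (hf.hasLineDerivAt d).tendsto_slope_zero_right
  simp only [h0, sub_zero] at hslope
  filter_upwards [hslope.eventually (gt_mem_nhds hd), self_mem_nhdsWithin] with s hs hs0
  exact neg_of_mul_neg_right hs (inv_pos.2 hs0).le

end PosTangentCone

section ConstraintGerm

variable {n q r : ℕ} {g : Vec n → Fin q → ℝ} {h : Vec n → Fin r → ℝ}

lemma tangentCone_eq_posTangentConeAt (g : Vec n → Fin q → ℝ) (h : Vec n → Fin r → ℝ) :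
    tangentCone g h = posTangentConeAt (feasibleSet g h) 0 := by
  refine Set.Subset.antisymm ?_ fun d hd => ?_
  · rintro d ⟨x, t, hxM, hx, ht, htx⟩
    exact mem_posTangentConeAt_zero_of_tendsto_smul ht hx (.of_forall hxM) htx
  · obtain ⟨u, hu, huM⟩ := exists_seq_forall_of_frequently
      ((mem_posTangentConeAt_zero_iff.1 hd).and_eventually (eventually_fst_pos (𝓝 d)))
    exact ⟨fun m => (u m).1 • (u m).2, fun m => (u m).1⁻¹, fun m => (huM m).1,
      (tendsto_fst_smul_snd d).comp hu, fun m => inv_pos.2 (huM m).2,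
      (tendsto_snd.comp hu).congr fun m => (inv_smul_smul₀ (huM m).2.ne' _).symm⟩

/-- A map all of whose components vanish and are differentiable at the origin: for a centered `g`
every inequality constraint is active. -/
structure IsCentered {m : ℕ} (f : Vec n → Fin m → ℝ) : Prop where
  zero : f 0 = 0
  differentiableAt : ∀ i, DifferentiableAt ℝ (fun x => f x i) 0

lemma IsCentered.hasFDerivAt (hg : IsCentered g) (i : Fin q) :
    HasFDerivAt (fun x => g x i) (diff g i) 0 :=
  (hg.differentiableAt i).hasFDerivAt

lemma isCentered_of_isEmpty (h : Vec n → Fin 0 → ℝ) : IsCentered h :=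
  ⟨Subsingleton.elim _ _, fun i => i.elim0⟩

lemma mem_linearizedCone (hg : g 0 = 0) {d : Vec n} :
    d ∈ linearizedCone g h ↔ (∀ i, diff g i d ≤ 0) ∧ ∀ j, diff h j d = 0 := by
  simp [linearizedCone, hg]

lemma tangentCone_subset_linearizedCone (hg : IsCentered g) (hh : IsCentered h) :
    tangentCone g h ⊆ linearizedCone g h := by
  intro d hd
  rw [tangentCone_eq_posTangentConeAt] at hd
  have hmax : ∀ i, IsLocalMaxOn (fun x => g x i) (feasibleSet g h) 0 := fun i =>
    eventually_mem_nhdsWithin.mono fun x hx => (hx.1 i).trans_eq (by simp [hg.zero])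
  have hmax' : ∀ j, IsLocalMaxOn (fun x => h x j) (feasibleSet g h) 0 := fun j =>
    eventually_mem_nhdsWithin.mono fun x hx => (hx.2 j).trans_le (by simp [hh.zero])
  have hmin : ∀ j, IsLocalMinOn (fun x => h x j) (feasibleSet g h) 0 := fun j =>
    eventually_mem_nhdsWithin.mono fun x hx => (hx.2 j).ge.trans' (by simp [hh.zero])
  refine (mem_linearizedCone hg.zero).2 ⟨fun i =>
    (hmax i).hasFDerivWithinAt_nonpos (hg.hasFDerivAt i).hasFDerivWithinAt hd,
    fun j => le_antisymm
      ((hmax' j).hasFDerivWithinAt_nonpos (hh.hasFDerivAt j).hasFDerivWithinAt hd)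
      ((hmin j).hasFDerivWithinAt_nonneg (hh.hasFDerivAt j).hasFDerivWithinAt hd)⟩

/-- The polar of `C` is contained in the polar of `L`, in terms of linear functionals. -/
def PolarLE {E : Type*} [AddCommGroup E] [Module ℝ E] (C L : Set E) : Prop :=
  ∀ ℓ : E →ₗ[ℝ] ℝ, (∀ d ∈ C, ℓ d ≤ 0) → ∀ d ∈ L, ℓ d ≤ 0

lemma polar_subset_polar_iff {X Y : Set (Vec n)} : polar X ⊆ polar Y ↔ PolarLE X Y := by
  constructor
  · intro hXY ℓ hℓ d hd
    have hdot : ∀ d, ℓ d = dotProductEquiv ℝ (Fin n) ((dotProductEquiv ℝ (Fin n)).symm ℓ) d :=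
      fun d => by rw [LinearEquiv.apply_symm_apply]
    rw [hdot]
    exact hXY (fun e he => (hdot e).symm.trans_le (hℓ e he)) d hd
  · exact fun hXY v hv d hd => hXY (dotProductEquiv ℝ (Fin n) v) hv d hd

lemma gcq_iff_polarLE (hsub : tangentCone g h ⊆ linearizedCone g h) :
    GCQ g h ↔ PolarLE (tangentCone g h) (linearizedCone g h) := by
  rw [← polar_subset_polar_iff]
  exact ⟨fun hG => hG.subset, fun hP => hP.antisymm fun v hv d hd => hv d (hsub hd)⟩

lemma ACQ.gcq (H : ACQ g h) : GCQ g h := congrArg polar H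

/-- If there are no equality constraints, MFCQ implies ACQ: tilt `d ∈ L⁺` towards a strictly
feasible direction `e`, and let the tilt tend to `0`. -/
lemma MFCQ.acq {h : Vec n → Fin 0 → ℝ} (hg : IsCentered g) (H : MFCQ g h) : ACQ g h := by
  refine (tangentCone_subset_linearizedCone hg (isCentered_of_isEmpty h)).antisymm fun d hd => ?_
  obtain ⟨-, e, he, -⟩ := H
  rw [mem_linearizedCone hg.zero] at hd
  rw [tangentCone_eq_posTangentConeAt]
  have hlim : Tendsto (fun η : ℝ => d + η • e) (𝓝[>] 0) (𝓝 d) := by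
    have hcont : Continuous fun η : ℝ => d + η • e := by fun_prop
    simpa using (hcont.tendsto 0).mono_left nhdsWithin_le_nhds
  refine (isClosed_posTangentConeAt _ _).mem_of_tendsto hlim ?_
  filter_upwards [self_mem_nhdsWithin] with η hη
  have hneg : ∀ i, diff g i (d + η • e) < 0 := fun i => by
    rw [map_add, map_smul, smul_eq_mul]
    exact add_neg_of_nonpos_of_neg (hd.1 i)
      (mul_neg_of_pos_of_neg hη (he ⟨i, by simp [hg.zero]⟩))
  refine mem_posTangentConeAt_of_frequently_mem (Eventually.frequently ?_)
  filter_upwards [eventually_all.2 fun i => eventually_apply_add_smul_neg (hg.hasFDerivAt i)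
    (by simp [hg.zero]) (hneg i)] with s hs
  exact ⟨fun i => (hs i).le, fun j => j.elim0⟩

end ConstraintGerm

/-! ### Invariance under `K[G]`-equivalence -/

section BlockMatrices

lemma exists_mulVec_apply_eq_of_mem_Ggp {q : ℕ} {C : Matrix (Fin q) (Fin q) ℝ} (hC : C ∈ Ggp q) :
    ∃ (c : Fin q → ℝ) (σ : Equiv.Perm (Fin q)), (∀ i, 0 < c i) ∧
      ∀ v i, (C *ᵥ v) i = c i * v (σ i) := by
  obtain ⟨c, σ, hc, rfl⟩ := hC
  refine ⟨c, σ, hc, fun v i => ?_⟩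
  rw [← Matrix.mulVec_mulVec, Matrix.mulVec_diagonal, Matrix.permMatrix_mulVec]
  rfl

lemma mulVec_nonpos_iff_of_mem_Ggp {q : ℕ} {C : Matrix (Fin q) (Fin q) ℝ} (hC : C ∈ Ggp q)
    {v : Fin q → ℝ} : (∀ i, (C *ᵥ v) i ≤ 0) ↔ ∀ i, v i ≤ 0 := by
  obtain ⟨c, σ, hc, hCv⟩ := exists_mulVec_apply_eq_of_mem_Ggp hC
  simp only [hCv, ← not_lt, mul_pos_iff_of_pos_left (hc _)]
  exact (σ.surjective.forall (p := fun i => ¬ 0 < v i)).symm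

lemma mulVec_neg_iff_of_mem_Ggp {q : ℕ} {C : Matrix (Fin q) (Fin q) ℝ} (hC : C ∈ Ggp q)
    {v : Fin q → ℝ} : (∀ i, (C *ᵥ v) i < 0) ↔ ∀ i, v i < 0 := by
  obtain ⟨c, σ, hc, hCv⟩ := exists_mulVec_apply_eq_of_mem_Ggp hC
  simp only [hCv, ← smul_eq_mul, smul_neg_iff_of_pos_left (hc _)]
  exact (σ.surjective.forall (p := fun i => v i < 0)).symm

lemma isUnit_of_mem_Ggp {q : ℕ} {C : Matrix (Fin q) (Fin q) ℝ} (hC : C ∈ Ggp q) : IsUnit C := by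
  obtain ⟨c, σ, hc, hCv⟩ := exists_mulVec_apply_eq_of_mem_Ggp hC
  refine Matrix.mulVec_surjective_iff_isUnit.1 fun y =>
    ⟨fun i => (c (σ.symm i))⁻¹ * y (σ.symm i), funext fun i => ?_⟩
  rw [hCv, σ.symm_apply_apply, mul_inv_cancel_left₀ (hc i).ne']

lemma mulVec_eq_zero_iff_of_isUnit {r : ℕ} {A : Matrix (Fin r) (Fin r) ℝ} (hA : IsUnit A)
    {v : Fin r → ℝ} : A *ᵥ v = 0 ↔ v = 0 := by
  simpa only [Matrix.mulVec_zero] using (Matrix.mulVec_injective_of_isUnit hA).eq_iff (b := 0)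

end BlockMatrices

section Germs

variable {n : ℕ}

lemma SmoothGerm.differentiableAt {F : Type} [NormedAddCommGroup F] [NormedSpace ℝ F]
    {f : Vec n → F} (hf : SmoothGerm f) : DifferentiableAt ℝ f 0 :=
  (hf.self_of_nhds).differentiableAt (by simp)

lemma comp_fderiv_eq_id_of_eventually_leftInverse {E F : Type*} [NormedAddCommGroup E]
    [NormedSpace ℝ E] [NormedAddCommGroup F] [NormedSpace ℝ F] {φ : E → F} {ψ : F → E} {x : E}
    (hφ : DifferentiableAt ℝ φ x) (hψ : DifferentiableAt ℝ ψ (φ x))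
    (hinv : ∀ᶠ y in 𝓝 x, ψ (φ y) = y) :
    (fderiv ℝ ψ (φ x)).comp (fderiv ℝ φ x) = ContinuousLinearMap.id ℝ E :=
  (hψ.hasFDerivAt.comp x hφ.hasFDerivAt).unique ((hasFDerivAt_id x).congr_of_eventuallyEq hinv)

lemma IsDiffeoGerm.exists_hasFDerivAt_equiv {φ : Vec n → Vec n} (hφ : IsDiffeoGerm φ) :
    ∃ (L : Vec n ≃L[ℝ] Vec n) (ψ : Vec n → Vec n), HasFDerivAt φ (L : Vec n →L[ℝ] Vec n) 0 ∧
      HasFDerivAt ψ (L.symm : Vec n →L[ℝ] Vec n) 0 ∧ ψ 0 = 0 ∧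
      ∀ᶠ x in 𝓝 (0 : Vec n), φ (ψ x) = x := by
  obtain ⟨hφs, hφ0, ψ, hψs, hψ0, hψφ, hφψ⟩ := hφ
  have hφd := hφs.differentiableAt
  have hψd := hψs.differentiableAt
  have hleft := comp_fderiv_eq_id_of_eventually_leftInverse hφd (by rwa [hφ0]) hψφ
  have hright := comp_fderiv_eq_id_of_eventually_leftInverse hψd (by rwa [hψ0]) hφψ
  rw [hφ0] at hleft
  rw [hψ0] at hright
  exact ⟨.equivOfInverse (fderiv ℝ φ 0) (fderiv ℝ ψ 0) (DFunLike.congr_fun hleft)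
    (DFunLike.congr_fun hright), ψ, hφd.hasFDerivAt, hψd.hasFDerivAt, hψ0, hφψ⟩

/-- The differential at the origin of a map, assembled from those of its components. -/
def jacobian {m : ℕ} (f : Vec n → Fin m → ℝ) : Vec n →L[ℝ] (Fin m → ℝ) :=
  ContinuousLinearMap.pi (diff f)

@[simp]
lemma jacobian_apply {m : ℕ} (f : Vec n → Fin m → ℝ) (d : Vec n) (i : Fin m) :
    jacobian f d i = diff f i d := rfl

lemma jacobian_eq {m : ℕ} {f : Vec n → Fin m → ℝ} {f' : Vec n →L[ℝ] (Fin m → ℝ)}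
    (hf : HasFDerivAt f f' 0) : jacobian f = f' := by
  ext d i
  exact DFunLike.congr_fun (hasFDerivAt_pi'.1 hf i).fderiv d

lemma isCentered_of_hasFDerivAt {m : ℕ} {f : Vec n → Fin m → ℝ} {f' : Vec n →L[ℝ] (Fin m → ℝ)}
    (hf : HasFDerivAt f f' 0) (h0 : f 0 = 0) : IsCentered f :=
  ⟨h0, fun i => (hasFDerivAt_pi'.1 hf i).differentiableAt⟩

lemma IsCentered.hasFDerivAt_jacobian {m : ℕ} {f : Vec n → Fin m → ℝ} (hf : IsCentered f) :
    HasFDerivAt f (jacobian f) 0 :=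
  hasFDerivAt_pi.2 hf.hasFDerivAt

lemma hasFDerivAt_mulVec_comp {m k : ℕ} {A : Vec n → Matrix (Fin m) (Fin k) ℝ}
    (hA : ∀ i j, SmoothGerm fun x => A x i j) {f : Vec n → Fin k → ℝ} (hf : IsCentered f)
    {φ : Vec n → Vec n} {φ' : Vec n →L[ℝ] Vec n} (hφ : HasFDerivAt φ φ' 0) (h0 : φ 0 = 0) :
    HasFDerivAt (fun x => A x *ᵥ f (φ x))
      ((A 0).mulVecLin.toContinuousLinearMap ∘L jacobian f ∘L φ') 0 := by
  have hfφ : HasFDerivAt (fun x => f (φ x)) (jacobian f ∘L φ') 0 :=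
    HasFDerivAt.comp 0 (by rw [h0]; exact hf.hasFDerivAt_jacobian) hφ
  refine hasFDerivAt_pi'.2 fun i => ?_
  have hsum := HasFDerivAt.fun_sum (u := Finset.univ) fun j _ =>
    (hA i j).differentiableAt.hasFDerivAt.fun_mul (hasFDerivAt_pi'.1 hfφ j)
  refine HasFDerivAt.congr_fderiv hsum ?_
  ext d
  simp [h0, hf.zero, Matrix.mulVec, dotProduct]

end Germs

section Invariance

variable {n q r : ℕ} {g g' : Vec n → Fin q → ℝ} {h h' : Vec n → Fin r → ℝ}

lemma linearIndependent_iff_exists_forall_apply_eq {ι E : Type*} [Finite ι] [AddCommGroup E]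
    [Module ℝ E] [TopologicalSpace E] {f : ι → E →L[ℝ] ℝ} :
    LinearIndependent ℝ f ↔ ∀ y : ι → ℝ, ∃ d, ∀ i, f i d = y i := by
  have hcoe : LinearIndependent ℝ f ↔ LinearIndependent ℝ fun i => ⇑(f i) := by
    let coeFun : (E →L[ℝ] ℝ) →ₗ[ℝ] (E → ℝ) :=
      { toFun := fun ℓ => ⇑ℓ, map_add' := fun _ _ => rfl, map_smul' := fun _ _ => rfl }
    exact (coeFun.linearIndependent_iff (LinearMap.ker_eq_bot.2 DFunLike.coe_injective)).symm
  let F : E →ₗ[ℝ] (ι → ℝ) := LinearMap.pi fun i => (f i : E →ₗ[ℝ] ℝ)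
  have hspan : Submodule.span ℝ (Set.range (flip fun i => ⇑(f i))) = LinearMap.range F :=
    Submodule.span_eq (LinearMap.range F)
  rw [hcoe, ← span_flip_eq_top_iff_linearIndependent, hspan, LinearMap.range_eq_top]
  exact forall_congr' fun y => exists_congr fun d => funext_iff

lemma licq_iff_active_surjective {s : ℕ} (e : Fin s ≃ Active g) :
    LICQ g h ↔ ∀ y z, ∃ d, jacobian (fun x a => g x (e a).1) d = y ∧ jacobian h d = z := by
  rw [LICQ, linearIndependent_iff_exists_forall_apply_eq]
  constructor
  · intro hsurj y z
    obtain ⟨d, hd⟩ := hsurj (Sum.elim (fun i => y (e.symm i)) z)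
    refine ⟨d, funext fun a => (hd (.inl (e a))).trans ?_, funext fun j => hd (.inr j)⟩
    rw [Sum.elim_inl, e.symm_apply_apply]
  · intro hsurj y
    obtain ⟨d, hgd, hhd⟩ := hsurj (fun a => y (.inl (e a))) fun j => y (.inr j)
    refine ⟨d, Sum.rec (e.surjective.forall.2 fun a => congrFun hgd a) (congrFun hhd)⟩

lemma licq_iff_surjective (hg : g 0 = 0) :
    LICQ g h ↔ ∀ y z, ∃ d, jacobian g d = y ∧ jacobian h d = z :=
  licq_iff_active_surjective (Equiv.subtypeUnivEquiv fun i => congrFun hg i).symm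

lemma mfcq_iff_surjective (hg : g 0 = 0) :
    MFCQ g h ↔ (∀ z, ∃ d, jacobian h d = z) ∧
      ∃ d, (∀ i, jacobian g d i < 0) ∧ jacobian h d = 0 := by
  simp [MFCQ, linearIndependent_iff_exists_forall_apply_eq, funext_iff, hg]

lemma not_licq_of_diff_eq_zero {j : Fin r} (hj : diff h j = 0) : ¬ LICQ g h := fun H =>
  H.ne_zero (Sum.inr j) (by simpa using hj)

lemma not_mfcq_of_diff_eq_zero {j : Fin r} (hj : diff h j = 0) : ¬ MFCQ g h := fun H =>
  H.1.ne_zero j hj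

/-- The first-order part of a `K[G]`-equivalence between centered constraint maps: the values at
the origin of the block matrix and the differential of the coordinate change. It determines all
four constraint qualifications. -/
structure FirstOrderEquiv (g : Vec n → Fin q → ℝ) (h : Vec n → Fin r → ℝ)
    (g' : Vec n → Fin q → ℝ) (h' : Vec n → Fin r → ℝ) where
  L : Vec n ≃L[ℝ] Vec n
  C : Matrix (Fin q) (Fin q) ℝ
  B : Matrix (Fin q) (Fin r) ℝ
  A : Matrix (Fin r) (Fin r) ℝ
  mem_Ggp : C ∈ Ggp q
  isUnit : IsUnit A
  isCentered_left : IsCentered g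
  isCentered_right : IsCentered h
  jacobian_left : ∀ d, jacobian g d = C *ᵥ jacobian g' (L d) + B *ᵥ jacobian h' (L d)
  jacobian_right : ∀ d, jacobian h d = A *ᵥ jacobian h' (L d)
  mem_tangentCone_iff : ∀ d, d ∈ tangentCone g h ↔ L d ∈ tangentCone g' h'

lemma nonpos_and_eq_zero_iff_of_block {C : Matrix (Fin q) (Fin q) ℝ}
    {B : Matrix (Fin q) (Fin r) ℝ} {A : Matrix (Fin r) (Fin r) ℝ} (hC : C ∈ Ggp q)
    (hA : IsUnit A) {y : Fin q → ℝ} {z : Fin r → ℝ} :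
    ((∀ i, (C *ᵥ y + B *ᵥ z) i ≤ 0) ∧ ∀ j, (A *ᵥ z) j = 0) ↔ (∀ i, y i ≤ 0) ∧ ∀ j, z j = 0 := by
  have hz : (∀ j, (A *ᵥ z) j = 0) ↔ ∀ j, z j = 0 :=
    funext_iff.symm.trans ((mulVec_eq_zero_iff_of_isUnit hA).trans funext_iff)
  rw [hz]
  refine and_congr_left fun hz0 => ?_
  rw [funext hz0, show (fun _ : Fin r => (0 : ℝ)) = 0 from rfl, Matrix.mulVec_zero, add_zero,
    mulVec_nonpos_iff_of_mem_Ggp hC]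

lemma mem_tangentCone_iff_of_eventually {φ ψ : Vec n → Vec n} {L : Vec n ≃L[ℝ] Vec n}
    (hφ : HasFDerivAt φ (L : Vec n →L[ℝ] Vec n) 0) (hφ0 : φ 0 = 0)
    (hψ : HasFDerivAt ψ (L.symm : Vec n →L[ℝ] Vec n) 0) (hψ0 : ψ 0 = 0)
    (hφψ : ∀ᶠ x in 𝓝 (0 : Vec n), φ (ψ x) = x)
    (hM : ∀ᶠ x in 𝓝 (0 : Vec n), x ∈ feasibleSet g h ↔ φ x ∈ feasibleSet g' h') (d : Vec n) :
    d ∈ tangentCone g h ↔ L d ∈ tangentCone g' h' := by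
  simp only [tangentCone_eq_posTangentConeAt]
  constructor
  · intro hd
    have hmem : ∀ᶠ x in 𝓝[feasibleSet g h] 0, φ x ∈ feasibleSet g' h' := by
      filter_upwards [nhdsWithin_le_nhds hM, self_mem_nhdsWithin] with x hx hxM using hx.1 hxM
    simpa only [hφ0, ContinuousLinearEquiv.coe_coe] using
      mapsTo_posTangentConeAt hφ.hasFDerivWithinAt hmem hd
  · intro hd
    have hψlim : Tendsto ψ (𝓝 0) (𝓝 0) := by simpa only [hψ0] using hψ.continuousAt.tendsto
    have hmem : ∀ᶠ x in 𝓝[feasibleSet g' h'] 0, ψ x ∈ feasibleSet g h := by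
      filter_upwards [nhdsWithin_le_nhds (hψlim.eventually hM), nhdsWithin_le_nhds hφψ,
        self_mem_nhdsWithin] with x hx hφψx hxM
      rwa [hx, hφψx]
    simpa [hψ0] using mapsTo_posTangentConeAt hψ.hasFDerivWithinAt hmem hd

lemma KGEquiv.nonempty_firstOrderEquiv (H : KGEquiv g h g' h') (hg' : IsCentered g')
    (hh' : IsCentered h') : Nonempty (FirstOrderEquiv g h g' h') := by
  obtain ⟨φ, C, B, A, hφ, hC, hB, hA, hev⟩ := H
  obtain ⟨L, ψ, hL, hψ, hψ0, hφψ⟩ := hφ.exists_hasFDerivAt_equiv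
  have hφ0 := hφ.2.1
  obtain ⟨hC0, hA0, hg0, hh0⟩ := hev.self_of_nhds
  have dg := ((hasFDerivAt_mulVec_comp hC hg' hL hφ0).add
    (hasFDerivAt_mulVec_comp hB hh' hL hφ0)).congr_of_eventuallyEq (hev.mono fun x hx => hx.2.2.1)
  have dh := (hasFDerivAt_mulVec_comp hA hh' hL hφ0).congr_of_eventuallyEq
    (hev.mono fun x hx => hx.2.2.2)
  have hM : ∀ᶠ x in 𝓝 (0 : Vec n), x ∈ feasibleSet g h ↔ φ x ∈ feasibleSet g' h' := by
    filter_upwards [hev] with x ⟨hCx, hAx, hgx, hhx⟩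
    simpa only [feasibleSet, Set.mem_ofPred_eq, hgx, hhx] using
      nonpos_and_eq_zero_iff_of_block hCx hAx
  exact ⟨{
    L, C := C 0, B := B 0, A := A 0, mem_Ggp := hC0, isUnit := hA0
    isCentered_left := isCentered_of_hasFDerivAt dg (by simp [hg0, hφ0, hg'.zero, hh'.zero])
    isCentered_right := isCentered_of_hasFDerivAt dh (by simp [hh0, hφ0, hh'.zero])
    jacobian_left := fun d => by simp [jacobian_eq dg]
    jacobian_right := fun d => by simp [jacobian_eq dh]
    mem_tangentCone_iff := mem_tangentCone_iff_of_eventually hL hφ0 hψ hψ0 hφψ hM }⟩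

namespace FirstOrderEquiv

lemma mem_linearizedCone_iff (e : FirstOrderEquiv g h g' h') (hg' : g' 0 = 0) (d : Vec n) :
    d ∈ linearizedCone g h ↔ e.L d ∈ linearizedCone g' h' := by
  rw [mem_linearizedCone e.isCentered_left.zero, mem_linearizedCone hg']
  simp only [← jacobian_apply, e.jacobian_left, e.jacobian_right]
  exact nonpos_and_eq_zero_iff_of_block e.mem_Ggp e.isUnit

lemma acq_iff (e : FirstOrderEquiv g h g' h') (hg' : g' 0 = 0) : ACQ g h ↔ ACQ g' h' := by
  simp only [ACQ, Set.ext_iff, e.mem_tangentCone_iff, e.mem_linearizedCone_iff hg']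
  exact (e.L.surjective.forall
    (p := fun x => x ∈ tangentCone g' h' ↔ x ∈ linearizedCone g' h')).symm

lemma gcq_iff (e : FirstOrderEquiv g h g' h') (hg' : IsCentered g') (hh' : IsCentered h') :
    GCQ g h ↔ GCQ g' h' := by
  rw [gcq_iff_polarLE (tangentCone_subset_linearizedCone e.isCentered_left e.isCentered_right),
    gcq_iff_polarLE (tangentCone_subset_linearizedCone hg' hh')]
  have hT := e.mem_tangentCone_iff
  have hL := e.mem_linearizedCone_iff hg'.zero
  constructor
  · intro hP ℓ hℓ d hd
    simpa using hP (ℓ ∘ₗ (e.L : Vec n →ₗ[ℝ] Vec n)) (fun d hd => hℓ _ ((hT d).1 hd))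
      (e.L.symm d) ((hL _).2 (by simpa using hd))
  · intro hP ℓ hℓ d hd
    simpa using hP (ℓ ∘ₗ (e.L.symm : Vec n →ₗ[ℝ] Vec n))
      (fun d hd => hℓ _ ((hT _).2 (by simpa using hd))) (e.L d) ((hL d).1 hd)

lemma jacobian_eq_block_iff (e : FirstOrderEquiv g h g' h') {d : Vec n} {y : Fin q → ℝ}
    {z : Fin r → ℝ} : jacobian g d = e.C *ᵥ y + e.B *ᵥ z ∧ jacobian h d = e.A *ᵥ z ↔
      jacobian g' (e.L d) = y ∧ jacobian h' (e.L d) = z := by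
  rw [e.jacobian_left, e.jacobian_right, (Matrix.mulVec_injective_of_isUnit e.isUnit).eq_iff]
  refine and_congr_left fun hz => ?_
  rw [hz, add_left_inj, (Matrix.mulVec_injective_of_isUnit (isUnit_of_mem_Ggp e.mem_Ggp)).eq_iff]

lemma licq_iff (e : FirstOrderEquiv g h g' h') (hg' : g' 0 = 0) : LICQ g h ↔ LICQ g' h' := by
  rw [licq_iff_surjective hg', licq_iff_surjective e.isCentered_left.zero]
  constructor
  · intro H y z
    obtain ⟨d, hd⟩ := H (e.C *ᵥ y + e.B *ᵥ z) (e.A *ᵥ z)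
    exact ⟨e.L d, e.jacobian_eq_block_iff.1 hd⟩
  · intro H y z
    obtain ⟨z, rfl⟩ := Matrix.mulVec_surjective_iff_isUnit.2 e.isUnit z
    obtain ⟨y', hy'⟩ := Matrix.mulVec_surjective_iff_isUnit.2 (isUnit_of_mem_Ggp e.mem_Ggp)
      (y - e.B *ᵥ z)
    obtain ⟨d, hd⟩ := H y' z
    refine ⟨e.L.symm d, ?_⟩
    rw [← sub_add_cancel y (e.B *ᵥ z), ← hy', e.jacobian_eq_block_iff, e.L.apply_symm_apply]
    exact hd

lemma mfcq_iff (e : FirstOrderEquiv g h g' h') (hg' : g' 0 = 0) : MFCQ g h ↔ MFCQ g' h' := by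
  rw [mfcq_iff_surjective hg', mfcq_iff_surjective e.isCentered_left.zero]
  refine and_congr ?_ (Iff.trans (exists_congr fun d => ?_) e.L.surjective.exists.symm)
  · rw [(Matrix.mulVec_surjective_iff_isUnit.2 e.isUnit).forall]
    refine forall_congr' fun z => Iff.trans (exists_congr fun d => ?_) e.L.surjective.exists.symm
    rw [e.jacobian_right, (Matrix.mulVec_injective_of_isUnit e.isUnit).eq_iff]
  · rw [e.jacobian_right, mulVec_eq_zero_iff_of_isUnit e.isUnit, e.jacobian_left]
    refine and_congr_left fun hd => ?_
    rw [hd, Matrix.mulVec_zero, add_zero, mulVec_neg_iff_of_mem_Ggp e.mem_Ggp]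

end FirstOrderEquiv

end Invariance

/-! ### Regular germs -/

section RegularGerms

variable {n m : ℕ}

lemma contDiffAt_symm_of_isInvertible {E : Type*} [NormedAddCommGroup E] [NormedSpace ℝ E]
    [CompleteSpace E] {φ : E → E} (e : OpenPartialHomeomorph E E) (he : ⇑e = φ) {y : E}
    (hy : y ∈ e.target) (hφ : ContDiffAt ℝ ∞ φ (e.symm y))
    (hinv : (fderiv ℝ φ (e.symm y)).IsInvertible) : ContDiffAt ℝ ∞ e.symm y := by
  obtain ⟨L, hL⟩ := hinv
  refine e.contDiffAt_symm (f₀' := L) hy ?_ (he ▸ hφ)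
  rw [hL, he]
  exact (hφ.differentiableAt (by simp)).hasFDerivAt

lemma isDiffeoGerm_of_hasFDerivAt {φ : Vec n → Vec n} (hs : SmoothGerm φ) (h0 : φ 0 = 0)
    {L : Vec n ≃L[ℝ] Vec n} (hL : HasFDerivAt φ (L : Vec n →L[ℝ] Vec n) 0) : IsDiffeoGerm φ := by
  have hφ : ContDiffAt ℝ ∞ φ 0 := hs.self_of_nhds
  have hne : (∞ : WithTop ℕ∞) ≠ 0 := by simp
  let e := hφ.toOpenPartialHomeomorph φ hL hne
  have he : ⇑e = φ := rfl
  have hsrc : (0 : Vec n) ∈ e.source := hφ.mem_toOpenPartialHomeomorph_source hL hne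
  have htgt : (0 : Vec n) ∈ e.target := h0 ▸ hφ.image_mem_toOpenPartialHomeomorph_target hL hne
  have hs0 : e.symm 0 = 0 := by
    simpa only [he, h0] using e.left_inv hsrc
  have hcont : Tendsto e.symm (𝓝 0) (𝓝 0) := by
    simpa only [hs0] using (e.continuousAt_symm htgt).tendsto
  have hinv : ∀ᶠ x in 𝓝 (0 : Vec n), (fderiv ℝ φ x).IsInvertible := by
    have hfderiv := (hφ.continuousAt_fderiv hne).tendsto
    rw [hL.fderiv] at hfderiv
    exact hfderiv.eventually (ContinuousLinearEquiv.nhds L)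
  refine ⟨hs, h0, e.symm, ?_, hs0, ?_, ?_⟩
  · filter_upwards [hcont.eventually (hinv.and hs), e.open_target.mem_nhds htgt] with y hy hyt
    exact contDiffAt_symm_of_isInvertible e he hyt hy.2 hy.1
  · filter_upwards [e.open_source.mem_nhds hsrc] with x hx using e.left_inv hx
  · filter_upwards [e.open_target.mem_nhds htgt] with x hx using e.right_inv hx

lemma exists_linearEquiv_castAdd_eq {k : ℕ} {Φ : Vec (m + k) →ₗ[ℝ] (Fin m → ℝ)}
    (hΦ : Function.Surjective Φ) :
    ∃ L : Vec (m + k) ≃L[ℝ] Vec (m + k), ∀ d i, L d (Fin.castAdd k i) = Φ d i := by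
  obtain ⟨P, hP⟩ := LinearMap.exists_leftInverse_of_injective (LinearMap.ker Φ).subtype
    (Submodule.ker_subtype _)
  have hcompl : IsCompl (LinearMap.ker Φ) (LinearMap.ker P) :=
    LinearMap.isCompl_of_proj fun d => LinearMap.congr_fun hP d
  have hPsurj : Function.Surjective P := fun d => ⟨d, LinearMap.congr_fun hP d⟩
  have hrank := LinearMap.finrank_range_add_finrank_ker Φ
  rw [LinearMap.range_eq_top.2 hΦ, finrank_top, Module.finrank_fin_fun, Module.finrank_fin_fun]
    at hrank
  let κ : LinearMap.ker Φ ≃ₗ[ℝ] (Fin k → ℝ) :=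
    LinearEquiv.ofFinrankEq _ _ (by rw [Module.finrank_fin_fun]; omega)
  let L : Vec (m + k) ≃ₗ[ℝ] Vec (m + k) :=
    Φ.equivProdOfSurjectiveOfIsCompl P (LinearMap.range_eq_top.2 hΦ)
        (LinearMap.range_eq_top.2 hPsurj) hcompl
      ≪≫ₗ LinearEquiv.prodCongr (.refl ℝ _) κ
      ≪≫ₗ (LinearEquiv.sumArrowLequivProdArrow (Fin m) (Fin k) ℝ ℝ).symm
      ≪≫ₗ LinearEquiv.funCongrLeft ℝ ℝ finSumFinEquiv.symm
  exact ⟨L.toContinuousLinearEquiv, fun d i => by simp [L, LinearEquiv.funCongrLeft]⟩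

lemma coord_of_le (x : Vec n) {j : ℕ} (h1 : 1 ≤ j) (h2 : j ≤ n) :
    coord x j = x ⟨j - 1, by omega⟩ := dif_pos ⟨h1, h2⟩

lemma exists_isDiffeoGerm_coords_comp_eq {f : Vec n → Fin m → ℝ} (hs : SmoothGerm f)
    (h0 : f 0 = 0) (hf : Function.Surjective (jacobian f)) :
    m ≤ n ∧ ∃ φ : Vec n → Vec n, IsDiffeoGerm φ ∧ ∀ x, coords 0 m (φ x) = f x := by
  have hmn : m ≤ n := by
    simpa using LinearMap.finrank_le_finrank_of_surjective
      (f := (jacobian f : Vec n →ₗ[ℝ] (Fin m → ℝ))) hf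
  obtain ⟨k, rfl⟩ := Nat.exists_eq_add_of_le hmn
  obtain ⟨L, hL⟩ := exists_linearEquiv_castAdd_eq hf
  let φ : Vec (m + k) → Vec (m + k) := fun x => Fin.append (f x) fun i => L x (Fin.natAdd m i)
  refine ⟨hmn, φ, isDiffeoGerm_of_hasFDerivAt (L := L) ?_ ?_ ?_, fun x => funext fun i => ?_⟩
  · filter_upwards [hs] with x hx
    refine contDiffAt_pi.2 (Fin.addCases (fun i => ?_) fun i => ?_)
    · simpa only [φ, Fin.append_left] using contDiffAt_pi.1 hx i
    · simpa only [φ, Fin.append_right] using contDiffAt_pi.1 L.contDiff.contDiffAt _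
  · refine funext (Fin.addCases (fun i => ?_) fun i => ?_) <;> simp [φ, h0]
  · refine hasFDerivAt_pi'.2 (Fin.addCases (fun i => ?_) fun i => ?_)
    · simp only [φ, Fin.append_left]
      have hfi := (isCentered_of_hasFDerivAt hs.differentiableAt.hasFDerivAt h0).hasFDerivAt i
      exact hfi.congr_fderiv (ContinuousLinearMap.ext fun d => (hL d i).symm)
    · simp only [φ, Fin.append_right]
      exact hasFDerivAt_pi'.1 L.hasFDerivAt _
  · rw [coords, coord_of_le _ (by omega) (by omega)]
    simp only [zero_add, add_tsub_cancel_right]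
    exact Fin.append_left (f x) _ i

end RegularGerms

section LICQ

variable {n : ℕ}

/-- The coordinate `x_j` as a linear functional. -/
def coordL (n j : ℕ) : Vec n →L[ℝ] ℝ :=
  if hj : 1 ≤ j ∧ j ≤ n then ContinuousLinearMap.proj ⟨j - 1, by omega⟩ else 0

@[simp]
lemma coordL_apply (j : ℕ) (x : Vec n) : coordL n j x = coord x j := by
  by_cases hj : 1 ≤ j ∧ j ≤ n <;> simp [coordL, coord, hj]

lemma hasFDerivAt_coord (j : ℕ) (x : Vec n) :
    HasFDerivAt (fun x => coord x j) (coordL n j) x := by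
  rw [← funext (coordL_apply j)]
  exact (coordL n j).hasFDerivAt

lemma diff_coords (a m : ℕ) (i : Fin m) :
    diff (coords (n := n) a m) i = coordL n (a + i + 1) := (hasFDerivAt_coord _ _).fderiv

lemma isCentered_coords (a m : ℕ) : IsCentered (coords (n := n) a m) where
  zero := funext fun i => by simp [coords, ← coordL_apply]
  differentiableAt _ := (hasFDerivAt_coord _ _).differentiableAt

lemma licq_coords {s r : ℕ} (hsr : s + r ≤ n) :
    LICQ (coords (n := n) 0 s) (coords (n := n) s r) := by
  rw [licq_iff_surjective (isCentered_coords 0 s).zero]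
  refine fun y z => ⟨fun k => if hk : k.1 < s + r then Fin.append y z ⟨k, hk⟩ else 0,
    funext fun i => ?_, funext fun j => ?_⟩
  · have hi : i.1 < s + r := by omega
    rw [jacobian_apply, diff_coords, coordL_apply, coord_of_le _ (by omega) (by omega)]
    simp only [zero_add, add_tsub_cancel_right, hi, dif_pos]
    exact Fin.append_left y z i
  · rw [jacobian_apply, diff_coords, coordL_apply, coord_of_le _ (by omega) (by omega)]
    simp only [add_tsub_cancel_right, add_lt_add_iff_left, j.isLt, dif_pos]
    exact Fin.append_right y z j

lemma kGEquiv_of_comp_eq {q r : ℕ} {g g' : Vec n → Fin q → ℝ} {h h' : Vec n → Fin r → ℝ}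
    {φ : Vec n → Vec n} (hφ : IsDiffeoGerm φ) (hg : ∀ x, g x = g' (φ x))
    (hh : ∀ x, h x = h' (φ x)) : KGEquiv g h g' h' := by
  have hconst : ∀ c : ℝ, SmoothGerm fun _ : Vec n => c := fun c => .of_forall fun _ =>
    contDiffAt_const
  refine ⟨φ, fun _ => 1, fun _ => 0, fun _ => 1, hφ, fun _ _ => hconst _, fun _ _ => hconst _,
    fun _ _ => hconst _, .of_forall fun x => ⟨?_, isUnit_one, ?_, ?_⟩⟩
  · exact ⟨1, 1, fun _ => one_pos, by simp⟩
  · rw [Matrix.one_mulVec, Matrix.zero_mulVec, add_zero, hg]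
  · rw [Matrix.one_mulVec, hh]

theorem licq_iff_regular {q r : ℕ} {g : Vec n → Fin q → ℝ} {h : Vec n → Fin r → ℝ}
    (hg : SmoothGerm g) (hh : SmoothGerm h) (h0 : h 0 = 0) :
    LICQ g h ↔ ∃ (s : ℕ) (e : Fin s ≃ Active g), s + r ≤ n ∧
      KGEquiv (fun x a => g x (e a).1) h (coords 0 s) (coords s r) := by
  constructor
  · intro hl
    let e : Fin (Fintype.card (Active g)) ≃ Active g := (Fintype.equivFin _).symm
    rw [licq_iff_active_surjective e] at hl
    let f : Vec n → Fin (_ + r) → ℝ := fun x => Fin.append (fun a => g x (e a).1) (h x)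
    have hf : SmoothGerm f := by
      filter_upwards [hg, hh] with x hgx hhx
      refine contDiffAt_pi.2 (Fin.addCases (fun a => ?_) fun b => ?_)
      · simpa only [f, Fin.append_left] using contDiffAt_pi.1 hgx _
      · simpa only [f, Fin.append_right] using contDiffAt_pi.1 hhx b
    have hf0 : f 0 = 0 :=
      funext (Fin.addCases (fun a => by simp [f, (e a).2]) fun b => by simp [f, h0])
    have hsurj : Function.Surjective (jacobian f) := by
      intro y
      obtain ⟨d, hgd, hhd⟩ := hl (fun a => y (Fin.castAdd r a)) fun b => y (Fin.natAdd _ b)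
      refine ⟨d, funext (Fin.addCases (fun a => ?_) fun b => ?_)⟩
      · simpa [f, diff] using congrFun hgd a
      · simpa [f, diff] using congrFun hhd b
    obtain ⟨hsr, φ, hφ, hφf⟩ := exists_isDiffeoGerm_coords_comp_eq hf hf0 hsurj
    refine ⟨_, e, hsr, kGEquiv_of_comp_eq hφ (fun x => funext fun a => ?_)
      fun x => funext fun b => ?_⟩
    · simpa [f, coords] using (congrFun (hφf x) (Fin.castAdd r a)).symm
    · simpa [f, coords] using (congrFun (hφf x) (Fin.natAdd _ b)).symm
  · rintro ⟨s, e, hsr, H⟩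
    obtain ⟨E⟩ := H.nonempty_firstOrderEquiv (isCentered_coords _ _) (isCentered_coords _ _)
    rw [licq_iff_active_surjective e, ← licq_iff_surjective E.isCentered_left.zero,
      E.licq_iff (isCentered_coords _ _).zero]
    exact licq_coords hsr

end LICQ

/-! ### Coordinates -/

section Coordinates

variable {n : ℕ}

@[simp] lemma coord_smul (s : ℝ) (x : Vec n) (j : ℕ) : coord (s • x) j = s * coord x j := by
  simp only [← coordL_apply, map_smul, smul_eq_mul]

@[simp] lemma coord_zero (j : ℕ) : coord (0 : Vec n) j = 0 := by
  simp only [← coordL_apply, map_zero]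

@[fun_prop] lemma continuous_coord (j : ℕ) : Continuous fun x : Vec n => coord x j := by
  simp only [← coordL_apply]
  fun_prop

@[fun_prop] lemma differentiable_coord (j : ℕ) : Differentiable ℝ fun x : Vec n => coord x j :=
  fun x => (hasFDerivAt_coord j x).differentiableAt

@[simp] lemma tail_smul (ε : ℕ → ℝ) (a : ℕ) (s : ℝ) (x : Vec n) :
    tail ε a (s • x) = s ^ 2 * tail ε a x := by
  simp only [tail, Finset.mul_sum, coord_smul]
  exact Finset.sum_congr rfl fun j _ => by ring

@[simp] lemma tail_zero (ε : ℕ → ℝ) (a : ℕ) : tail ε a (0 : Vec n) = 0 := by simp [tail]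

@[fun_prop] lemma continuous_tail (ε : ℕ → ℝ) (a : ℕ) : Continuous fun x : Vec n => tail ε a x := by
  unfold tail
  fun_prop

@[fun_prop] lemma differentiable_tail (ε : ℕ → ℝ) (a : ℕ) :
    Differentiable ℝ fun x : Vec n => tail ε a x := by
  unfold tail
  fun_prop

/-- Replace the coordinate `x_j` by `r`; coordinates are numbered from `1`, as in `coord`.
In particular `setCoord 0 j 1` is the `j`-th unit vector. -/
def setCoord (x : Vec n) (j : ℕ) (r : ℝ) : Vec n := fun i => if i.val + 1 = j then r else x i

lemma coord_setCoord_self (x : Vec n) {j : ℕ} (h1 : 1 ≤ j) (h2 : j ≤ n) (r : ℝ) :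
    coord (setCoord x j r) j = r := by
  rw [coord_of_le _ h1 h2, setCoord, if_pos (by simp only []; omega)]

lemma coord_setCoord_ne (x : Vec n) {i j : ℕ} (h : i ≠ j) (r : ℝ) :
    coord (setCoord x j r) i = coord x i := by
  unfold coord
  split_ifs with hi
  · rw [setCoord, if_neg (by simp only []; omega)]
  · rfl

lemma setCoord_eq_add_smul (x : Vec n) {j : ℕ} (h1 : 1 ≤ j) (h2 : j ≤ n) (r : ℝ) :
    setCoord x j r = x + (r - coord x j) • setCoord 0 j 1 := by
  ext i
  by_cases hi : i.val + 1 = j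
  · subst hi
    simp [setCoord, coord_of_le x h1 h2]
  · simp [setCoord, hi]

lemma map_setCoord (ℓ : Vec n →ₗ[ℝ] ℝ) (x : Vec n) {j : ℕ} (h1 : 1 ≤ j) (h2 : j ≤ n) (r : ℝ) :
    ℓ (setCoord x j r) = ℓ x + (r - coord x j) * ℓ (setCoord 0 j 1) := by
  rw [setCoord_eq_add_smul x h1 h2, map_add, map_smul, smul_eq_mul]

lemma setCoord_coord (x : Vec n) {j : ℕ} (h1 : 1 ≤ j) (h2 : j ≤ n) :
    setCoord x j (coord x j) = x := by
  rw [setCoord_eq_add_smul x h1 h2, sub_self, zero_smul, add_zero]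

lemma tendsto_setCoord {x : Vec n} {j : ℕ} {F : Filter ℝ} {r : ℝ → ℝ} {c : ℝ}
    (hr : Tendsto r F (𝓝 c)) {y : ℝ → Vec n} (hy : Tendsto y F (𝓝 x)) :
    Tendsto (fun s => setCoord (y s) j (r s)) F (𝓝 (setCoord x j c)) := by
  refine tendsto_pi_nhds.2 fun i => ?_
  by_cases hi : i.val + 1 = j
  · simpa [setCoord, hi] using hr
  · simpa [setCoord, hi] using tendsto_pi_nhds.1 hy i

/-- The coordinate `x_j` enters the function `F` only through a summand `e * x_j ^ 2`. -/
def HasSquareTerm (F : Vec n → ℝ) (j : ℕ) (e : ℝ) : Prop :=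
  ∀ x r, F (setCoord x j r) = F x + e * (r ^ 2 - coord x j ^ 2)

lemma tail_setCoord_of_lt (ε : ℕ → ℝ) {a j : ℕ} (h : j < a) (x : Vec n) (r : ℝ) :
    tail ε a (setCoord x j r) = tail ε a x := by
  refine Finset.sum_congr rfl fun i hi => ?_
  rw [coord_setCoord_ne _ (by have := (Finset.mem_Icc.1 hi).1; omega)]

lemma hasSquareTerm_tail (ε : ℕ → ℝ) {a j : ℕ} (h1 : 1 ≤ j) (ha : a ≤ j) (h2 : j ≤ n) :
    HasSquareTerm (tail (n := n) ε a) j (ε j) := by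
  intro x r
  have hj : j ∈ Finset.Icc a n := Finset.mem_Icc.2 ⟨ha, h2⟩
  have hrest : ∀ i ∈ (Finset.Icc a n).erase j,
      ε i * coord (setCoord x j r) i ^ 2 = ε i * coord x i ^ 2 := fun i hi => by
    rw [coord_setCoord_ne x (Finset.ne_of_mem_erase hi) r]
  unfold tail
  rw [← Finset.add_sum_erase _ _ hj, ← Finset.add_sum_erase _ (fun i => ε i * coord x i ^ 2) hj,
    coord_setCoord_self _ h1 h2, Finset.sum_congr rfl hrest]
  ring

lemma tail_nonneg {ε : ℕ → ℝ} {a : ℕ} (h : AllEq ε a n 1) (x : Vec n) : 0 ≤ tail ε a x :=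
  Finset.sum_nonneg fun j hj => by
    rw [h j (by simpa using hj)]
    positivity

lemma coord_sq_le_tail {ε : ℕ → ℝ} {a : ℕ} (h : AllEq ε a n 1) (x : Vec n) {m : ℕ}
    (ha : a ≤ m) (hm : m ≤ n) : coord x m ^ 2 ≤ tail ε a x := by
  have hsingle := Finset.single_le_sum (s := Finset.Icc a n) (f := fun j => ε j * coord x j ^ 2)
    (fun j hj => by rw [h j (by simpa using hj)]; positivity) (Finset.mem_Icc.2 ⟨ha, hm⟩)
  simpa [tail, h m ⟨ha, hm⟩] using hsingle

lemma tail_neg (ε : ℕ → ℝ) (a : ℕ) (x : Vec n) : tail (fun j => -ε j) a x = -tail ε a x := by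
  simp [tail]

lemma tail_nonpos {ε : ℕ → ℝ} {a : ℕ} (h : AllEq ε a n (-1)) (x : Vec n) : tail ε a x ≤ 0 := by
  have hneg := tail_nonneg (ε := fun j => -ε j) (a := a) (fun j hj => by simp [h j hj]) x
  rw [tail_neg] at hneg
  linarith

/-- The polyhedral cone `d_1 = ⋯ = d_l = 0`, `d_1, …, d_p ≤ 0`: the linearized cone of a normal
form. -/
def coordCone (n l p : ℕ) : Set (Vec n) :=
  {d | (∀ j, 1 ≤ j → j ≤ l → coord d j = 0) ∧ ∀ j, 1 ≤ j → j ≤ p → coord d j ≤ 0}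

lemma zero_mem_coordCone (l p : ℕ) : (0 : Vec n) ∈ coordCone n l p := by simp [coordCone]

lemma setCoord_mem_coordCone {l p j : ℕ} {d : Vec n} (hd : d ∈ coordCone n l p) {r : ℝ}
    (hl : l < j) (hn : j ≤ n) (hr : j ≤ p → r ≤ 0) : setCoord d j r ∈ coordCone n l p := by
  refine ⟨fun i h1 h2 => ?_, fun i h1 h2 => ?_⟩
  · rw [coord_setCoord_ne _ (by omega)]
    exact hd.1 i h1 h2
  · rcases eq_or_ne i j with rfl | hij
    · rw [coord_setCoord_self _ h1 hn]
      exact hr h2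
    · rw [coord_setCoord_ne _ hij]
      exact hd.2 i h1 h2

lemma smul_mem_coordCone {l p : ℕ} {d : Vec n} (hd : d ∈ coordCone n l p) {s : ℝ} (hs : 0 ≤ s) :
    s • d ∈ coordCone n l p :=
  ⟨fun i h1 h2 => by rw [coord_smul, hd.1 i h1 h2, mul_zero],
    fun i h1 h2 => by rw [coord_smul]; exact mul_nonpos_of_nonneg_of_nonpos hs (hd.2 i h1 h2)⟩

end Coordinates

/-! ### Quadratic blow-ups -/

/-- The blow-up `f (s • y) = s ^ 2 * H s y` of a function that vanishes to second order at the
origin. The blown-up function `H` is continuous up to `s = 0`, and `H 0` is the quadratic part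
of `f`. -/
structure IsBlowup {n : ℕ} (f : Vec n → ℝ) (H : ℝ → Vec n → ℝ) : Prop where
  apply_smul : ∀ s y, f (s • y) = s ^ 2 * H s y
  continuous : Continuous fun p : ℝ × Vec n => H p.1 p.2
  differentiableAt : DifferentiableAt ℝ f 0

namespace IsBlowup

variable {n : ℕ} {f : Vec n → ℝ} {H : ℝ → Vec n → ℝ}

lemma map_zero (hf : IsBlowup f H) : f 0 = 0 := by simpa using hf.apply_smul 0 0

lemma tendsto_prod (hf : IsBlowup f H) (d : Vec n) :
    Tendsto (fun p : ℝ × Vec n => H p.1 p.2) (𝓝[>] (0 : ℝ) ×ˢ 𝓝 d) (𝓝 (H 0 d)) := by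
  refine (hf.continuous.tendsto (0, d)).mono_left ?_
  rw [nhds_prod_eq]
  exact prod_mono nhdsWithin_le_nhds le_rfl

lemma tendsto_fst (hf : IsBlowup f H) (d : Vec n) :
    Tendsto (fun s => H s d) (𝓝[>] 0) (𝓝 (H 0 d)) :=
  (hf.tendsto_prod d).comp (tendsto_id.prodMk tendsto_const_nhds)

lemma apply_zero_right (hf : IsBlowup f H) {s : ℝ} (hs : s ≠ 0) : H s 0 = 0 := by
  have h0 := hf.apply_smul s 0
  rw [smul_zero, hf.map_zero] at h0
  exact (mul_eq_zero.1 h0.symm).resolve_left (pow_ne_zero 2 hs)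

lemma apply_zero_zero (hf : IsBlowup f H) : H 0 0 = 0 := by
  refine tendsto_nhds_unique (hf.tendsto_fst 0) (tendsto_const_nhds.congr' ?_)
  filter_upwards [self_mem_nhdsWithin] with s hs using (hf.apply_zero_right (ne_of_gt hs)).symm

lemma fderiv_eq_zero (hf : IsBlowup f H) : fderiv ℝ f 0 = 0 := by
  ext1 d
  have hslope := (hf.differentiableAt.hasFDerivAt.hasLineDerivAt d).tendsto_slope_zero_right
  have hlim : Tendsto (fun s : ℝ => s * H s d) (𝓝[>] 0) (𝓝 (0 * H 0 d)) :=
    (tendsto_id.mono_left nhdsWithin_le_nhds).mul (hf.tendsto_fst d)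
  rw [zero_mul] at hlim
  refine tendsto_nhds_unique hslope (hlim.congr' ?_)
  filter_upwards [self_mem_nhdsWithin] with s hs
  have hs' : s ≠ 0 := ne_of_gt hs
  rw [zero_add, hf.map_zero, sub_zero, hf.apply_smul, smul_eq_mul]
  field_simp

lemma neg (hf : IsBlowup f H) : IsBlowup (fun x => -f x) (fun s y => -H s y) :=
  ⟨fun s y => by rw [hf.apply_smul]; ring, hf.continuous.neg, hf.differentiableAt.neg⟩

lemma apply_nonpos_of_mem_posTangentConeAt (hf : IsBlowup f H) {M : Set (Vec n)}
    (hM : ∀ x ∈ M, f x ≤ 0) {d : Vec n} (hd : d ∈ posTangentConeAt M 0) : H 0 d ≤ 0 := by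
  by_contra! hlt
  obtain ⟨p, hpM, hp, hHp⟩ := ((mem_posTangentConeAt_zero_iff.1 hd).and_eventually
    ((eventually_fst_pos (𝓝 d)).and ((hf.tendsto_prod d).eventually (lt_mem_nhds hlt)))).exists
  have hfp := hM _ hpM
  rw [hf.apply_smul] at hfp
  exact hfp.not_gt (by positivity)

lemma apply_eq_zero_of_mem_posTangentConeAt (hf : IsBlowup f H) {M : Set (Vec n)}
    (hM : ∀ x ∈ M, f x = 0) {d : Vec n} (hd : d ∈ posTangentConeAt M 0) : H 0 d = 0 :=
  le_antisymm (hf.apply_nonpos_of_mem_posTangentConeAt (fun x hx => (hM x hx).le) hd)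
    (neg_nonpos.1 (hf.neg.apply_nonpos_of_mem_posTangentConeAt (fun x hx => by simp [hM x hx]) hd))

end IsBlowup

section PolarLE

variable {n l p : ℕ} {C L D : Set (Vec n)}

lemma not_polarLE_of_pos (ℓ : Vec n →L[ℝ] ℝ) (hC : ∀ d ∈ C, ℓ d ≤ 0) {d : Vec n} (hd : d ∈ L)
    (hpos : 0 < ℓ d) : ¬ PolarLE C L := fun h =>
  hpos.not_ge (h (ℓ : Vec n →ₗ[ℝ] ℝ) hC d hd)

lemma apply_nonpos_of_mem_posTangentConeAt {M : Set (Vec n)} (ℓ : Vec n →L[ℝ] ℝ)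
    (hM : ∀ x ∈ M, ℓ x ≤ 0) {d : Vec n} (hd : d ∈ posTangentConeAt M 0) : ℓ d ≤ 0 := by
  have hmax : IsLocalMaxOn ℓ M 0 :=
    eventually_mem_nhdsWithin.mono fun x hx => (hM x hx).trans (map_zero ℓ).ge
  exact hmax.hasFDerivWithinAt_nonpos ℓ.hasFDerivAt.hasFDerivWithinAt hd

/-- With `S = d_1 + ⋯ + d_p ≤ 0`, the set `C` lies in the half-space `d_m + (1 + |c|) S ≤ 0`, which
does not contain the `m`-th unit vector. -/
lemma not_polarLE_of_coord_sq_le {m : ℕ} (hl : l < m) (hp : p < m) (hn : m ≤ n) (c : ℝ)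
    (hC : C ⊆ coordCone n 0 p)
    (hCsq : ∀ d ∈ C, coord d m ^ 2 ≤ c * (∑ j ∈ Finset.Icc 1 p, coord d j) ^ 2) :
    ¬ PolarLE C (coordCone n l p) := by
  let S : Vec n →L[ℝ] ℝ := ∑ j ∈ Finset.Icc 1 p, coordL n j
  have hS (d : Vec n) : S d = ∑ j ∈ Finset.Icc 1 p, coord d j := by simp [S]
  refine not_polarLE_of_pos (coordL n m + (1 + |c|) • S) (fun d hd => ?_)
    (setCoord_mem_coordCone (zero_mem_coordCone l p) (r := 1) hl hn (by omega)) ?_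
  · have hSd : S d ≤ 0 := hS d ▸ Finset.sum_nonpos fun j hj =>
      (hC hd).2 j (Finset.mem_Icc.1 hj).1 (Finset.mem_Icc.1 hj).2
    have hsq : coord d m ^ 2 ≤ ((1 + |c|) * S d) ^ 2 := (hCsq d hd).trans <| by
      rw [← hS, mul_pow]
      gcongr
      nlinarith [le_abs_self c, abs_nonneg c]
    have habs := sq_le_sq.1 hsq
    rw [abs_of_nonpos (mul_nonpos_of_nonneg_of_nonpos (by positivity) hSd)] at habs
    simp only [add_apply, smul_apply, coordL_apply, smul_eq_mul]
    linarith [le_abs_self (coord d m)]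
  · have hS0 : S (setCoord 0 m 1) = 0 := hS _ ▸ Finset.sum_eq_zero fun j hj => by
      rw [coord_setCoord_ne _ (by have := Finset.mem_Icc.1 hj; omega), coord_zero]
    simp only [add_apply, smul_apply, coordL_apply, hS0, smul_zero, add_zero,
      coord_setCoord_self _ (show 1 ≤ m by omega) hn, zero_lt_one]

lemma map_nonpos_of_forall_coord_neg (ℓ : Vec n →ₗ[ℝ] ℝ) {u : ℕ} (hu : 1 ≤ u) (hun : u ≤ n)
    (hDu : ∀ d ∈ D, coord d u ≤ 0) (hDset : ∀ d ∈ D, ∀ r ≤ 0, setCoord d u r ∈ D)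
    (hℓ : ∀ d ∈ D, coord d u < 0 → ℓ d ≤ 0) {d : Vec n} (hd : d ∈ D) : ℓ d ≤ 0 := by
  have hlim : Tendsto (fun s : ℝ => ℓ d + -s * ℓ (setCoord 0 u 1)) (𝓝[>] 0) (𝓝 (ℓ d)) := by
    have hcont : Continuous fun s : ℝ => ℓ d + -s * ℓ (setCoord 0 u 1) := by fun_prop
    simpa using (hcont.tendsto 0).mono_left nhdsWithin_le_nhds
  refine le_of_tendsto hlim (eventually_mem_nhdsWithin.mono fun s (hs : 0 < s) => ?_)
  have hdu := hDu d hd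
  have hneg := hℓ (setCoord d u (coord d u - s)) (hDset d hd _ (by linarith))
    (by rw [coord_setCoord_self _ hu hun]; linarith)
  rw [map_setCoord ℓ _ hu hun] at hneg
  linarith

end PolarLE

/-- `|Q d| ≤ c (d_1 + ⋯ + d_p)²` for some `c` and all `d` with `d_1, …, d_p ≤ 0`. Such a `Q` is
harmless for the polar cone: see `not_polarLE_of_coord_sq_le`. -/
def DominatedBySumSq {n : ℕ} (p : ℕ) (Q : Vec n → ℝ) : Prop :=
  ∃ c, ∀ d ∈ coordCone n 0 p, |Q d| ≤ c * (∑ j ∈ Finset.Icc 1 p, coord d j) ^ 2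

namespace DominatedBySumSq

variable {n p : ℕ} {Q R : Vec n → ℝ}

lemma zero : DominatedBySumSq p fun _ : Vec n => 0 := ⟨0, fun _ _ => by simp⟩

lemma congr (hQ : DominatedBySumSq p Q) (h : ∀ d, R d = Q d) : DominatedBySumSq p R :=
  funext h ▸ hQ

lemma add (hQ : DominatedBySumSq p Q) (hR : DominatedBySumSq p R) :
    DominatedBySumSq p fun d => Q d + R d := by
  obtain ⟨c, hc⟩ := hQ
  obtain ⟨c', hc'⟩ := hR
  refine ⟨c + c', fun d hd => (abs_add_le _ _).trans ?_⟩
  rw [add_mul]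
  exact add_le_add (hc d hd) (hc' d hd)

lemma const_mul (hQ : DominatedBySumSq p Q) (b : ℝ) : DominatedBySumSq p fun d => b * Q d := by
  obtain ⟨c, hc⟩ := hQ
  refine ⟨|b| * c, fun d hd => ?_⟩
  rw [abs_mul, mul_assoc]
  gcongr
  exact hc d hd

lemma coord_mul_coord {i j : ℕ} (hi : i ∈ Finset.Icc 1 p) (hj : j ∈ Finset.Icc 1 p) :
    DominatedBySumSq p fun d : Vec n => coord d i * coord d j := by
  refine ⟨1, fun d hd => ?_⟩
  have hle {k : ℕ} (hk : k ∈ Finset.Icc 1 p) : |coord d k| ≤ |∑ j ∈ Finset.Icc 1 p, coord d j| := by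
    have hnonpos : ∀ j ∈ Finset.Icc 1 p, coord d j ≤ 0 := fun j hj =>
      hd.2 j (Finset.mem_Icc.1 hj).1 (Finset.mem_Icc.1 hj).2
    rw [abs_of_nonpos (hnonpos k hk), abs_of_nonpos (Finset.sum_nonpos hnonpos),
      ← Finset.sum_neg_distrib]
    exact Finset.single_le_sum (f := fun j => -coord d j)
      (fun j hj => neg_nonneg.2 (hnonpos j hj)) hk
  rw [abs_mul, one_mul, ← sq_abs, sq]
  exact mul_le_mul (hle hi) (hle hj) (abs_nonneg _) (abs_nonneg _)

lemma binary_form {i j : ℕ} (hi : i ∈ Finset.Icc 1 p) (hj : j ∈ Finset.Icc 1 p) (a b c : ℝ) :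
    DominatedBySumSq p fun d : Vec n =>
      a * coord d i ^ 2 + b * coord d j ^ 2 + c * coord d i * coord d j :=
  ((((coord_mul_coord hi hi).const_mul a).add ((coord_mul_coord hj hj).const_mul b)).add
    ((coord_mul_coord hi hj).const_mul c)).congr fun d => by ring

lemma ternary_form {i j k : ℕ} (hi : i ∈ Finset.Icc 1 p) (hj : j ∈ Finset.Icc 1 p)
    (hk : k ∈ Finset.Icc 1 p) (a b c α β γ : ℝ) :
    DominatedBySumSq p fun d : Vec n =>
      a * coord d i ^ 2 + b * coord d j ^ 2 + c * coord d k ^ 2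
        + α * coord d i * coord d j + β * coord d i * coord d k + γ * coord d j * coord d k :=
  (((binary_form hi hj a b α).add (binary_form hi hk 0 c β)).add
    ((coord_mul_coord hj hk).const_mul γ)).congr fun d => by ring

end DominatedBySumSq

/-! ### One inequality constraint on a cone -/

/-- The feasible set given by `x_1, …, x_p ≤ 0` and `f x ≤ x_1 + ⋯ + x_l`. -/
def ineqSet {n : ℕ} (l p : ℕ) (f : Vec n → ℝ) : Set (Vec n) :=
  {x | (∀ j, 1 ≤ j → j ≤ p → coord x j ≤ 0) ∧ f x ≤ ∑ j ∈ Finset.Icc 1 l, coord x j}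

section IneqSet

variable {n l p : ℕ} {f : Vec n → ℝ} {H : ℝ → Vec n → ℝ}

lemma apply_nonpos_of_mem_ineqSet (hlp : l ≤ p) {x : Vec n} (hx : x ∈ ineqSet l p f) : f x ≤ 0 :=
  hx.2.trans <| Finset.sum_nonpos fun j hj =>
    hx.1 j (Finset.mem_Icc.1 hj).1 ((Finset.mem_Icc.1 hj).2.trans hlp)

lemma mem_posTangentConeAt_ineqSet (hf : IsBlowup f H) {d : Vec n} (hd : d ∈ coordCone n l p)
    (h : ∀ᶠ s in 𝓝[>] (0 : ℝ), H s d ≤ 0) : d ∈ posTangentConeAt (ineqSet l p f) 0 := by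
  refine mem_posTangentConeAt_zero_of_curve (γ := fun _ => d) tendsto_const_nhds ?_
  filter_upwards [h, self_mem_nhdsWithin] with s hs (hs0 : 0 < s)
  have hsd := smul_mem_coordCone hd hs0.le
  refine ⟨hsd.2, ?_⟩
  rw [hf.apply_smul, Finset.sum_eq_zero fun j hj =>
    hsd.1 j (Finset.mem_Icc.1 hj).1 (Finset.mem_Icc.1 hj).2]
  exact mul_nonpos_of_nonneg_of_nonpos (sq_nonneg s) hs

lemma mem_posTangentConeAt_ineqSet_of_neg (hf : IsBlowup f H) {d : Vec n}
    (hd : d ∈ coordCone n l p) (h : H 0 d < 0) : d ∈ posTangentConeAt (ineqSet l p f) 0 :=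
  mem_posTangentConeAt_ineqSet hf hd
    (((hf.tendsto_fst d).eventually (gt_mem_nhds h)).mono fun _ hs => le_of_lt hs)

/-- Directions on which the quadratic part vanishes are limits of directions on which it is
negative: push the coordinate with the negative square away from `0`. -/
lemma mem_posTangentConeAt_ineqSet_of_nonpos (hf : IsBlowup f H) (hlp : l ≤ p) {j : ℕ}
    (hp : p < j) (hn : j ≤ n) (hj : HasSquareTerm (H 0) j (-1)) {d : Vec n}
    (hd : d ∈ coordCone n l p) (h : H 0 d ≤ 0) : d ∈ posTangentConeAt (ineqSet l p f) 0 := by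
  obtain ⟨c, hc, hcd⟩ : ∃ c : ℝ, c ^ 2 = 1 ∧ 0 ≤ c * coord d j := by
    rcases le_total 0 (coord d j) with hdj | hdj
    · exact ⟨1, by norm_num, by linarith⟩
    · exact ⟨-1, by norm_num, by linarith⟩
  have hpush : Tendsto (fun s : ℝ => coord d j + c * s) (𝓝[>] 0) (𝓝 (coord d j)) := by
    have hcont : Continuous fun s : ℝ => coord d j + c * s := by fun_prop
    simpa using (hcont.tendsto 0).mono_left nhdsWithin_le_nhds
  have hlim := tendsto_setCoord (j := j) hpush (tendsto_const_nhds (x := d))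
  rw [setCoord_coord d (by omega) hn] at hlim
  refine (isClosed_posTangentConeAt _ _).mem_of_tendsto hlim ?_
  filter_upwards [self_mem_nhdsWithin] with s (hs : 0 < s)
  refine mem_posTangentConeAt_ineqSet_of_neg hf
    (setCoord_mem_coordCone hd (by omega) hn (by omega)) ?_
  rw [hj]
  have hsq : (coord d j + c * s) ^ 2 - coord d j ^ 2 = 2 * s * (c * coord d j) + s ^ 2 := by
    linear_combination s ^ 2 * hc
  rw [hsq]
  nlinarith [mul_nonneg hs.le hcd, pow_pos hs 2]

lemma coordCone_subset_posTangentConeAt_ineqSet_iff (hf : IsBlowup f H) (hlp : l ≤ p) {j : ℕ}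
    (hp : p < j) (hn : j ≤ n) {e : ℝ} (he : IsSign e) (hj : HasSquareTerm (H 0) j e) :
    coordCone n l p ⊆ posTangentConeAt (ineqSet l p f) 0 ↔ ∀ d ∈ coordCone n l p, H 0 d ≤ 0 := by
  refine ⟨fun h d hd => hf.apply_nonpos_of_mem_posTangentConeAt
    (fun x hx => apply_nonpos_of_mem_ineqSet hlp hx) (h hd), fun h d hd => ?_⟩
  rcases he with rfl | rfl
  · have hunit := h _ (setCoord_mem_coordCone (zero_mem_coordCone l p) (j := j) (r := 1)
      (by omega) hn (by omega))
    rw [hj, hf.apply_zero_zero, coord_zero] at hunit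
    norm_num at hunit
  · exact mem_posTangentConeAt_ineqSet_of_nonpos hf hlp hp hn hj hd (h d hd)

lemma exists_lt_sq_add_mul_and_lt_sq_sub_mul (a b : ℝ) :
    ∃ N : ℝ, b < N ^ 2 + 2 * a * N ∧ b < N ^ 2 - 2 * a * N := by
  refine ⟨2 * |a| + |b| + 1, ?_, ?_⟩ <;>
    nlinarith [abs_nonneg a, le_abs_self b, abs_nonneg b, le_abs_self a, neg_abs_le a]

/-- `d` is the midpoint of two tangent directions obtained by moving the coordinate with the
negative square far to both sides. -/
lemma polarLE_ineqSet (hf : IsBlowup f H) (hlp : l ≤ p) {j : ℕ} (hp : p < j) (hn : j ≤ n)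
    (hj : HasSquareTerm (H 0) j (-1)) :
    PolarLE (posTangentConeAt (ineqSet l p f) 0) (coordCone n l p) := by
  intro ℓ hℓ d hd
  obtain ⟨N, hpos, hneg⟩ := exists_lt_sq_add_mul_and_lt_sq_sub_mul (coord d j) (H 0 d)
  have hmove : ∀ r, H 0 d < r ^ 2 + 2 * coord d j * r → ℓ d + r * ℓ (setCoord 0 j 1) ≤ 0 := by
    intro r hr
    have hmem : setCoord d j (coord d j + r) ∈ posTangentConeAt (ineqSet l p f) 0 :=
      mem_posTangentConeAt_ineqSet_of_neg hf
        (setCoord_mem_coordCone hd (by omega) hn (by omega)) (by rw [hj]; linarith)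
    have hle := hℓ _ hmem
    rw [map_setCoord ℓ _ (by omega) hn] at hle
    linarith
  linarith [hmove N hpos, hmove (-N) (by linarith)]

/-- If `H 0 d = d_u d_w + T d` with `d_u ≤ 0` and `d_w` free, then `H 0` becomes negative for
large `d_w` as soon as `d_u < 0`. -/
lemma map_nonpos_of_coupled_ineqSet (hf : IsBlowup f H) {u w : ℕ} (hl : l < u) (hup : u ≤ p)
    (hpw : p < w) (hwn : w ≤ n) {D : Set (Vec n)} (hD : D ⊆ coordCone n l p)
    (hDw : ∀ d ∈ D, ∀ r, setCoord d w r ∈ D) (hDu : ∀ d ∈ D, ∀ r ≤ 0, setCoord d u r ∈ D)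
    {T : Vec n → ℝ} (hT : ∀ d r, T (setCoord d w r) = T d)
    (hH : ∀ d ∈ D, H 0 d = coord d u * coord d w + T d) {ℓ : Vec n →ₗ[ℝ] ℝ}
    (hℓ : ∀ d ∈ posTangentConeAt (ineqSet l p f) 0, ℓ d ≤ 0) (hw : 0 ≤ ℓ (setCoord 0 w 1))
    {d : Vec n} (hd : d ∈ D) : ℓ d ≤ 0 := by
  refine map_nonpos_of_forall_coord_neg ℓ (by omega) (by omega)
    (fun d hd => (hD hd).2 u (by omega) hup) hDu (fun d hd hu => ?_) hd
  set X := max (coord d w) ((T d + 1) / -coord d u)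
  have hX : T d + 1 ≤ X * -coord d u := (div_le_iff₀ (by linarith)).1 (le_max_right _ _)
  have hmem : setCoord d w X ∈ posTangentConeAt (ineqSet l p f) 0 := by
    refine mem_posTangentConeAt_ineqSet_of_neg hf (hD (hDw d hd X)) ?_
    rw [hH _ (hDw d hd X), coord_setCoord_ne _ (by omega), coord_setCoord_self _ (by omega) hwn,
      hT]
    linarith
  have hle := hℓ _ hmem
  rw [map_setCoord ℓ _ (by omega) hwn] at hle
  have hwX : coord d w ≤ X := le_max_left _ _
  linarith [mul_nonneg (sub_nonneg.2 hwX) hw]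

end IneqSet

/-! ### One equality constraint on a cone -/

/-- The feasible set given by `x_1, …, x_p ≤ 0` and `f x = 0`. -/
def eqSet {n : ℕ} (p : ℕ) (f : Vec n → ℝ) : Set (Vec n) :=
  {x | (∀ j, 1 ≤ j → j ≤ p → coord x j ≤ 0) ∧ f x = 0}

section EqSet

variable {n p : ℕ} {f : Vec n → ℝ} {H : ℝ → Vec n → ℝ}

lemma mem_posTangentConeAt_eqSet (hf : IsBlowup f H) {d : Vec n} {γ : ℝ → Vec n}
    (hγ : Tendsto γ (𝓝[>] 0) (𝓝 d)) (hc : ∀ᶠ s in 𝓝[>] (0 : ℝ), γ s ∈ coordCone n 0 p)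
    (h : ∀ᶠ s in 𝓝[>] (0 : ℝ), H s (γ s) = 0) : d ∈ posTangentConeAt (eqSet p f) 0 := by
  refine mem_posTangentConeAt_zero_of_curve hγ ?_
  filter_upwards [h, hc, self_mem_nhdsWithin] with s hs hsc hs0
  exact ⟨(smul_mem_coordCone hsc (le_of_lt hs0)).2, by rw [hf.apply_smul, hs, mul_zero]⟩

lemma not_coordCone_subset_posTangentConeAt_eqSet (hf : IsBlowup f H) {j : ℕ} (hp : p < j)
    (hn : j ≤ n) (hj : H 0 (setCoord 0 j 1) ≠ 0) :
    ¬ coordCone n 0 p ⊆ posTangentConeAt (eqSet p f) 0 := fun h =>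
  hj (hf.apply_eq_zero_of_mem_posTangentConeAt (fun x hx => hx.2)
    (h (setCoord_mem_coordCone (zero_mem_coordCone 0 p) (by omega) hn (by omega))))

section OppositeSquares

variable {j k : ℕ}

lemma setCoord_setCoord_mem_coordCone (hpj : p < j) (hjn : j ≤ n) (hpk : p < k) (hkn : k ≤ n)
    {d : Vec n} (hd : d ∈ coordCone n 0 p) (a b : ℝ) :
    setCoord (setCoord d j a) k b ∈ coordCone n 0 p :=
  setCoord_mem_coordCone (setCoord_mem_coordCone hd (by omega) hjn (by omega)) (by omega) hkn
    (by omega)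

lemma map_setCoord_setCoord (ℓ : Vec n →ₗ[ℝ] ℝ) (hjk : j ≠ k) (hj1 : 1 ≤ j) (hjn : j ≤ n)
    (hk1 : 1 ≤ k) (hkn : k ≤ n) (d : Vec n) (a b : ℝ) :
    ℓ (setCoord (setCoord d j a) k b) = ℓ d + (a - coord d j) * ℓ (setCoord 0 j 1)
      + (b - coord d k) * ℓ (setCoord 0 k 1) := by
  rw [map_setCoord ℓ _ hk1 hkn, map_setCoord ℓ _ hj1 hjn, coord_setCoord_ne _ hjk.symm]

lemma HasSquareTerm.apply_setCoord_setCoord {F : Vec n → ℝ} (hj : HasSquareTerm F j 1)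
    (hk : HasSquareTerm F k (-1)) (hjk : j ≠ k) (d : Vec n) (a b : ℝ) :
    F (setCoord (setCoord d j a) k b) =
      F d + (a ^ 2 - coord d j ^ 2) - (b ^ 2 - coord d k ^ 2) := by
  rw [hk, hj, coord_setCoord_ne _ hjk.symm]
  ring

lemma map_setCoord_eq_zero_of_opposite_squares (hf : IsBlowup f H) (hjk : j ≠ k) (hpj : p < j)
    (hjn : j ≤ n) (hpk : p < k) (hkn : k ≤ n) (hj : ∀ s, HasSquareTerm (H s) j 1)
    (hk : ∀ s, HasSquareTerm (H s) k (-1)) {ℓ : Vec n →ₗ[ℝ] ℝ}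
    (hℓ : ∀ d ∈ posTangentConeAt (eqSet p f) 0, ℓ d ≤ 0) :
    ℓ (setCoord 0 j 1) = 0 ∧ ℓ (setCoord 0 k 1) = 0 := by
  have hnull : ∀ a b : ℝ, a ^ 2 = b ^ 2 →
      a * ℓ (setCoord 0 j 1) + b * ℓ (setCoord 0 k 1) ≤ 0 := by
    intro a b hab
    have hmem : setCoord (setCoord 0 j a) k b ∈ posTangentConeAt (eqSet p f) 0 := by
      refine mem_posTangentConeAt_eqSet hf tendsto_const_nhds (.of_forall fun _ =>
        setCoord_setCoord_mem_coordCone hpj hjn hpk hkn (zero_mem_coordCone 0 p) a b) ?_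
      filter_upwards [self_mem_nhdsWithin] with s hs
      rw [(hj s).apply_setCoord_setCoord (hk s) hjk, hf.apply_zero_right (ne_of_gt hs), hab]
      simp
    have hle := hℓ _ hmem
    rw [map_setCoord_setCoord ℓ hjk (by omega) hjn (by omega) hkn] at hle
    simpa using hle
  constructor <;> linarith [hnull 1 1 rfl, hnull 1 (-1) (by norm_num), hnull (-1) 1 (by norm_num),
    hnull (-1) (-1) rfl]

/-- For `d_j = d_k = 0`, the equation `H s = 0` is solved along `d` by square roots in the
coordinates `j` and `k`. -/
lemma exists_setCoord_setCoord_mem_posTangentConeAt_eqSet (hf : IsBlowup f H) (hjk : j ≠ k)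
    (hpj : p < j) (hjn : j ≤ n) (hpk : p < k) (hkn : k ≤ n)
    (hj : ∀ s, HasSquareTerm (H s) j 1) (hk : ∀ s, HasSquareTerm (H s) k (-1))
    {d : Vec n} (hd : d ∈ coordCone n 0 p) :
    ∃ a b, setCoord (setCoord d j a) k b ∈ posTangentConeAt (eqSet p f) 0 := by
  set d₀ := setCoord (setCoord d j 0) k 0
  have hd₀j : coord d₀ j = 0 := by
    rw [coord_setCoord_ne _ hjk, coord_setCoord_self _ (by omega) hjn]
  have hd₀k : coord d₀ k = 0 := coord_setCoord_self _ (by omega) hkn _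
  have hover : ∀ a b, setCoord (setCoord d₀ j a) k b = setCoord (setCoord d j a) k b := by
    intro a b
    ext i
    simp only [d₀, setCoord]
    split_ifs <;> rfl
  have hlim := hf.tendsto_fst d₀
  refine ⟨_, _, mem_posTangentConeAt_eqSet hf
    (tendsto_setCoord (hlim.max (tendsto_const_nhds (x := 0))).sqrt
      (tendsto_setCoord (hlim.neg.max (tendsto_const_nhds (x := 0))).sqrt tendsto_const_nhds))
    (.of_forall fun s => setCoord_setCoord_mem_coordCone hpj hjn hpk hkn hd _ _)
    (.of_forall fun s => ?_)⟩
  rw [← hover, (hj s).apply_setCoord_setCoord (hk s) hjk, hd₀j, hd₀k,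
    Real.sq_sqrt (le_max_right _ _), Real.sq_sqrt (le_max_right _ _)]
  rcases le_total 0 (H s d₀) with h | h
  · rw [max_eq_left h, max_eq_right (by linarith)]
    ring
  · rw [max_eq_right h, max_eq_left (by linarith)]
    ring

lemma polarLE_eqSet (hf : IsBlowup f H) (hjk : j ≠ k) (hpj : p < j) (hjn : j ≤ n) (hpk : p < k)
    (hkn : k ≤ n) (hj : ∀ s, HasSquareTerm (H s) j 1) (hk : ∀ s, HasSquareTerm (H s) k (-1)) :
    PolarLE (posTangentConeAt (eqSet p f) 0) (coordCone n 0 p) := by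
  intro ℓ hℓ d hd
  obtain ⟨hℓj, hℓk⟩ := map_setCoord_eq_zero_of_opposite_squares hf hjk hpj hjn hpk hkn hj hk hℓ
  obtain ⟨a, b, hab⟩ := exists_setCoord_setCoord_mem_posTangentConeAt_eqSet hf hjk hpj hjn hpk hkn
    hj hk hd
  have hle := hℓ _ hab
  rw [map_setCoord_setCoord ℓ hjk (by omega) hjn (by omega) hkn, hℓj, hℓk] at hle
  simpa using hle

end OppositeSquares

section Coupled

variable {u w m k : ℕ} {D : Set (Vec n)} {T : Vec n → ℝ} {e : ℝ}

/-- Choose `X` as the value of the free coordinate `d_w` that solves the equation at `s = 0`; for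
`s > 0` the equation is linear in `d_u`, and its solution tends to `d_u < 0`. -/
lemma exists_setCoord_mem_posTangentConeAt_eqSet (hf : IsBlowup f H) (hu1 : 1 ≤ u) (hup : u ≤ p)
    (hpw : p < w) (hwn : w ≤ n) (hm : m ≠ 0) (hk : k ≠ 0) (hD : D ⊆ coordCone n 0 p)
    (hDw : ∀ d ∈ D, ∀ r, setCoord d w r ∈ D) (hDu : ∀ d ∈ D, ∀ r ≤ 0, setCoord d u r ∈ D)
    (hTw : ∀ d r, T (setCoord d w r) = T d) (hTu : ∀ d r, T (setCoord d u r) = T d) (he : e ≠ 0)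
    (hH : ∀ d ∈ D, ∀ s, H s d = s ^ m * coord d w ^ k + e * coord d u * coord d w + T d)
    {d : Vec n} (hd : d ∈ D) (hdu : coord d u < 0) :
    ∃ X, setCoord d w X ∈ posTangentConeAt (eqSet p f) 0 := by
  by_cases hT : T d = 0
  · refine ⟨0, mem_posTangentConeAt_eqSet hf (γ := fun _ => setCoord d w 0) tendsto_const_nhds
      (.of_forall fun _ => hD (hDw d hd 0)) (.of_forall fun s => ?_)⟩
    rw [hH _ (hDw d hd 0), hTw, hT, coord_setCoord_self _ (by omega) hwn, zero_pow hk]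
    ring
  set X := -T d / (e * coord d u) with hX
  have hX0 : X ≠ 0 := div_ne_zero (neg_ne_zero.2 hT) (mul_ne_zero he hdu.ne)
  set c : ℝ → ℝ := fun s => -(T d + s ^ m * X ^ k) / (e * X) with hc
  have hc0 : c 0 = coord d u := by
    have hu0 := hdu.ne
    simp only [hc, zero_pow hm, zero_mul, add_zero]
    rw [div_eq_iff (mul_ne_zero he hX0), hX]
    field_simp
  have hclim : Tendsto c (𝓝[>] 0) (𝓝 (coord d u)) := by
    have hcont : Continuous c := by fun_prop
    rw [← hc0]
    exact (hcont.tendsto 0).mono_left nhdsWithin_le_nhds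
  have hγ := tendsto_setCoord (j := u) hclim (tendsto_const_nhds (x := setCoord d w X))
  rw [← coord_setCoord_ne d (show u ≠ w by omega) X, setCoord_coord _ hu1 (by omega)] at hγ
  have hneg := hclim.eventually (gt_mem_nhds hdu)
  refine ⟨X, mem_posTangentConeAt_eqSet hf hγ ?_ ?_⟩
  · exact hneg.mono fun s hs => hD (hDu _ (hDw d hd X) _ hs.le)
  · refine hneg.mono fun s hs => ?_
    rw [hH _ (hDu _ (hDw d hd X) _ hs.le), hTu, hTw, coord_setCoord_self _ hu1 (by omega),
      coord_setCoord_ne _ (by omega), coord_setCoord_self _ (by omega) hwn]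
    simp only [hc]
    field_simp
    ring

lemma map_nonpos_of_coupled_eqSet (hf : IsBlowup f H) (hu1 : 1 ≤ u) (hup : u ≤ p)
    (hpw : p < w) (hwn : w ≤ n) (hm : m ≠ 0) (hk : k ≠ 0) (hD : D ⊆ coordCone n 0 p)
    (hDw : ∀ d ∈ D, ∀ r, setCoord d w r ∈ D) (hDu : ∀ d ∈ D, ∀ r ≤ 0, setCoord d u r ∈ D)
    (hTw : ∀ d r, T (setCoord d w r) = T d) (hTu : ∀ d r, T (setCoord d u r) = T d) (he : e ≠ 0)
    (hH : ∀ d ∈ D, ∀ s, H s d = s ^ m * coord d w ^ k + e * coord d u * coord d w + T d)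
    {ℓ : Vec n →ₗ[ℝ] ℝ} (hℓ : ∀ d ∈ posTangentConeAt (eqSet p f) 0, ℓ d ≤ 0)
    (hw : ℓ (setCoord 0 w 1) = 0) {d : Vec n} (hd : d ∈ D) : ℓ d ≤ 0 := by
  refine map_nonpos_of_forall_coord_neg ℓ hu1 (by omega) (fun d hd => (hD hd).2 u hu1 hup) hDu
    (fun d hd hdu => ?_) hd
  obtain ⟨X, hX⟩ := exists_setCoord_mem_posTangentConeAt_eqSet hf hu1 hup hpw hwn hm hk hD hDw hDu
    hTw hTu he hH hd hdu
  have hle := hℓ _ hX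
  rw [map_setCoord ℓ _ (by omega) hwn, hw] at hle
  linarith

end Coupled

end EqSet

/-! ### Blow-ups of the normal forms -/

/-- The family `H` with `form (s • y) = s² H s y` for the equality constraint of a class without
inequality constraints. -/
def EqType.blow {n : ℕ} (ε : ℕ → ℝ) (s : ℝ) (x : Vec n) : EqType → ℝ
  | t1 k => s ^ (k - 2) * coord x 1 ^ k + tail ε 2 x
  | t2 => s * (coord x 1 ^ 3 + ε 2 * coord x 1 * coord x 2 ^ 2) + coord x 3 ^ 2 + tail ε 4 x

lemma EqType.isBlowup {n : ℕ} (ε : ℕ → ℝ) {T : EqType} (hT : T.Admissible n) :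
    IsBlowup (fun x : Vec n => T.form ε x) (fun s x => T.blow ε s x) := by
  cases T with
  | t1 k =>
    obtain ⟨m, rfl⟩ : ∃ m, k = m + 2 := Nat.exists_eq_add_of_le' hT.1
    simp only [form, blow, Nat.add_sub_cancel]
    exact ⟨fun s x => by simp only [coord_smul, tail_smul]; ring, by fun_prop, by fun_prop⟩
  | t2 =>
    simp only [form, blow]
    exact ⟨fun s x => by simp only [coord_smul, tail_smul]; ring, by fun_prop, by fun_prop⟩

/-- The family `H` with `form (s • y) = s² H s y` for the function `g̃` of a class without equality
constraints. -/
def IneqType.blow {n : ℕ} (q : ℕ) (ε : ℕ → ℝ) (s : ℝ) (x : Vec n) : IneqType → ℝ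
  | t1 k => ε q * s ^ (k - 2) * coord x q ^ k + tail ε (q + 1) x
  | t2 => s * (coord x q ^ 3 + ε (q + 1) * coord x q * coord x (q + 1) ^ 2) + tail ε (q + 2) x
  | t3 k => ε (q - 1) * s ^ (k - 2) * coord x (q - 1) ^ k + tail ε q x
  | t4 k => ε q * s ^ (k - 2) * coord x q ^ k + coord x (q - 1) * coord x q + tail ε (q + 1) x
  | t5 => ε (q - 1) * coord x (q - 1) ^ 2 + s * coord x q ^ 3 + tail ε (q + 1) x
  | t6 δ α => δ 1 * coord x (q - 1) ^ 2 + δ 2 * coord x (q - 2) ^ 2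
      + α * coord x (q - 2) * coord x (q - 1) + tail ε q x
  | t7 ε' => ε (q - 2) * (coord x (q - 2) + ε' * coord x (q - 1)) ^ 2
      + s * (ε (q - 1) * coord x (q - 1) ^ 3) + tail ε q x
  | t8 ε' => s * (ε (q - 2) * coord x (q - 2) ^ 3) + ε (q - 1) * coord x (q - 1) ^ 2
      + ε' * coord x (q - 2) * coord x (q - 1) + tail ε q x
  | t9 ε01 ε02 ε12 => s * coord x q ^ 3 + ε01 * coord x (q - 1) * coord x q
      + ε02 * coord x (q - 2) * coord x q + ε12 * coord x (q - 2) * coord x (q - 1)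
      + tail ε (q + 1) x
  | t10 δ α => δ 1 * coord x (q - 3) ^ 2 + δ 2 * coord x (q - 2) ^ 2 + δ 3 * coord x (q - 1) ^ 2
      + α 1 2 * coord x (q - 3) * coord x (q - 2) + α 1 3 * coord x (q - 3) * coord x (q - 1)
      + α 2 3 * coord x (q - 2) * coord x (q - 1)
      + s * (ε 0 * coord x (q - 3) * coord x (q - 2) * coord x (q - 1)) + tail ε q x

lemma IneqType.isBlowup {n q : ℕ} (ε : ℕ → ℝ) {T : IneqType} (hT : T.Admissible n q) :
    IsBlowup (fun x : Vec n => T.form q ε x) (fun s x => T.blow q ε s x) := by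
  cases T with
  | t1 k | t3 k | t4 k =>
    obtain ⟨m, rfl⟩ : ∃ m, k = m + 2 := Nat.exists_eq_add_of_le' (by have := hT.2.1; omega)
    simp only [form, blow, Nat.add_sub_cancel]
    exact ⟨fun s x => by simp only [coord_smul, tail_smul]; ring, by fun_prop, by fun_prop⟩
  | _ =>
    simp only [form, blow]
    exact ⟨fun s x => by simp only [coord_smul, tail_smul]; ring, by fun_prop, by fun_prop⟩

/-- The family `H` with `form (s • y) = s² H s y` for the equality constraint of a class with
inequality constraints. -/
def MixedType.blow {n : ℕ} (ε : ℕ → ℝ) (s : ℝ) (x : Vec n) : MixedType → ℝ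
  | t1 k => s ^ (k - 2) * coord x 1 ^ k + tail ε 2 x
  | t2 => s * coord x 2 ^ 3 + coord x 1 ^ 2 + tail ε 3 x
  | t3 k => s ^ (k - 2) * coord x 2 ^ k + ε 1 * coord x 1 * coord x 2 + tail ε 3 x
  | t4 δ α => δ 1 * coord x 1 ^ 2 + δ 2 * coord x 2 ^ 2 + α * coord x 1 * coord x 2 + tail ε 3 x
  | t5 => s * coord x 1 ^ 3 + ε 1 * coord x 2 ^ 2 + ε 2 * coord x 1 * coord x 2 + tail ε 3 x
  | t6 => (coord x 1 + ε 1 * coord x 2) ^ 2 + s * (ε 2 * coord x 2 ^ 3) + tail ε 3 x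
  | t7 => s * coord x 3 ^ 3 + ε 1 * coord x 2 * coord x 3 + ε 2 * coord x 3 * coord x 1
      + ε 3 * coord x 1 * coord x 2 + tail ε 4 x
  | t8 δ α => δ 1 * coord x 1 ^ 2 + δ 2 * coord x 2 ^ 2 + δ 3 * coord x 3 ^ 2
      + α 1 2 * coord x 1 * coord x 2 + α 1 3 * coord x 1 * coord x 3
      + α 2 3 * coord x 2 * coord x 3
      + s * (ε 1 * coord x 1 * coord x 2 * coord x 3) + tail ε 4 x

lemma MixedType.isBlowup {n : ℕ} (ε : ℕ → ℝ) {T : MixedType} (hT : T.Admissible n) :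
    IsBlowup (fun x : Vec n => T.form ε x) (fun s x => T.blow ε s x) := by
  cases T with
  | t1 k | t3 k =>
    obtain ⟨m, rfl⟩ : ∃ m, k = m + 2 := Nat.exists_eq_add_of_le' (by have := hT.1; omega)
    simp only [form, blow, Nat.add_sub_cancel]
    exact ⟨fun s x => by simp only [coord_smul, tail_smul]; ring, by fun_prop, by fun_prop⟩
  | _ =>
    simp only [form, blow]
    exact ⟨fun s x => by simp only [coord_smul, tail_smul]; ring, by fun_prop, by fun_prop⟩

section OneEquality

variable {n p : ℕ} {f : Vec n → ℝ} {H : ℝ → Vec n → ℝ}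

lemma forall_coord_succ_iff {P : ℝ → Prop} {x : Vec n} :
    (∀ i : Fin p, P (coord x (0 + i + 1))) ↔ ∀ j, 1 ≤ j → j ≤ p → P (coord x j) := by
  refine ⟨fun h j h1 h2 => ?_, fun h i => h _ (by omega) (by omega)⟩
  obtain ⟨m, rfl⟩ := Nat.exists_eq_add_of_le' h1
  simpa only [zero_add] using h ⟨m, h2⟩

lemma feasibleSet_coords_single : feasibleSet (coords 0 p) (single f) = eqSet p f :=
  Set.ext fun _ => and_congr (forall_coord_succ_iff (P := (· ≤ 0))) ⟨fun h => h 0, fun h _ => h⟩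

lemma IsBlowup.isCentered_single (hf : IsBlowup f H) : IsCentered (single f) :=
  ⟨funext fun _ => hf.map_zero, fun _ => hf.differentiableAt⟩

lemma IsBlowup.diff_single (hf : IsBlowup f H) (j : Fin 1) : diff (single f) j = 0 :=
  hf.fderiv_eq_zero

lemma IsBlowup.linearizedCone_coords_single (hf : IsBlowup f H) :
    linearizedCone (coords 0 p) (single f) = coordCone n 0 p := by
  ext d
  rw [mem_linearizedCone (isCentered_coords 0 p).zero]
  simp only [hf.diff_single, diff_coords, coordL_apply, zero_apply, implies_true, and_true,
    forall_coord_succ_iff (P := (· ≤ 0))]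
  exact ⟨fun h => ⟨fun j h1 h2 => by omega, h⟩, fun h => h.2⟩

theorem IsBlowup.constraintQualifications_single (hf : IsBlowup f H) {g : Vec n → Fin p → ℝ}
    {h : Vec n → Fin 1 → ℝ} (hK : KGEquiv g h (coords 0 p) (single f)) {j : ℕ} (hp : p < j)
    (hn : j ≤ n) (hj : H 0 (setCoord 0 j 1) ≠ 0) :
    ¬ LICQ g h ∧ ¬ MFCQ g h ∧ ¬ ACQ g h ∧
      (GCQ g h ↔ PolarLE (posTangentConeAt (eqSet p f) 0) (coordCone n 0 p)) := by
  have hc := isCentered_coords (n := n) 0 p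
  have hs := hf.isCentered_single
  obtain ⟨e⟩ := hK.nonempty_firstOrderEquiv hc hs
  rw [e.licq_iff hc.zero, e.mfcq_iff hc.zero, e.acq_iff hc.zero, e.gcq_iff hc hs,
    gcq_iff_polarLE (tangentCone_subset_linearizedCone hc hs), ACQ,
    hf.linearizedCone_coords_single, tangentCone_eq_posTangentConeAt, feasibleSet_coords_single]
  exact ⟨not_licq_of_diff_eq_zero (hf.diff_single 0), not_mfcq_of_diff_eq_zero (hf.diff_single 0),
    fun hACQ => not_coordCone_subset_posTangentConeAt_eqSet hf hp hn hj hACQ.superset, Iff.rfl⟩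

end OneEquality

namespace IneqType

variable {n q l₁ : ℕ} {ε : ℕ → ℝ} {T : IneqType}

lemma one_le_gap (T : IneqType) : 1 ≤ T.gap := by cases T <;> simp [gap]

lemma Admissible.len_lt (hT : T.Admissible n q) : T.len q < q := by
  have := hT.1
  have := T.one_le_gap
  rw [len]
  omega

lemma Admissible.le (hT : T.Admissible n q) : q ≤ n := by
  cases T <;> simp only [Admissible] at hT <;> omega

lemma normalForm_apply_pred {j : ℕ} (h1 : 1 ≤ j) (hj : j < q) (x : Vec n) :
    T.normalForm n q l₁ ε x ⟨j - 1, by omega⟩ = coord x j := by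
  rw [normalForm, if_pos (by simp only []; omega), Nat.sub_add_cancel h1]

lemma normalForm_apply_last (hq : 1 ≤ q) (x : Vec n) :
    T.normalForm n q l₁ ε x ⟨q - 1, by omega⟩ =
      ∑ j ∈ Finset.Icc 1 l₁, coord x j - ∑ j ∈ Finset.Icc (l₁ + 1) (T.len q), coord x j
        + T.form q ε x :=
  if_neg (by simp only []; omega)

lemma hasFDerivAt_normalForm (hT : T.Admissible n q) (i : Fin q) :
    HasFDerivAt (fun x => T.normalForm n q l₁ ε x i)
      (if i.val + 1 < q then coordL n (i.val + 1)
        else ∑ j ∈ Finset.Icc 1 l₁, coordL n j - ∑ j ∈ Finset.Icc (l₁ + 1) (T.len q), coordL n j)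
      0 := by
  unfold normalForm
  split_ifs with hi
  · exact hasFDerivAt_coord _ _
  · have hform := (isBlowup ε hT).differentiableAt.hasFDerivAt
    rw [(isBlowup ε hT).fderiv_eq_zero] at hform
    simpa only [add_zero] using ((HasFDerivAt.fun_sum (u := Finset.Icc 1 l₁)
      fun j _ => hasFDerivAt_coord j (0 : Vec n)).fun_sub
      (HasFDerivAt.fun_sum (u := Finset.Icc (l₁ + 1) (T.len q))
        fun j _ => hasFDerivAt_coord j (0 : Vec n))).fun_add hform

lemma isCentered_normalForm (hT : T.Admissible n q) : IsCentered (T.normalForm n q l₁ ε) where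
  zero := funext fun i => by simp [normalForm, (isBlowup (n := n) ε hT).map_zero]
  differentiableAt i := (hasFDerivAt_normalForm hT i).differentiableAt

lemma diff_normalForm_pred (hT : T.Admissible n q) {j : ℕ} (h1 : 1 ≤ j) (hj : j < q) (d : Vec n) :
    diff (T.normalForm n q l₁ ε) ⟨j - 1, by omega⟩ d = coord d j := by
  rw [diff, (hasFDerivAt_normalForm hT _).fderiv, if_pos (by simp only []; omega), coordL_apply]
  simp only [Nat.sub_add_cancel h1]

lemma diff_normalForm_last (hT : T.Admissible n q) (hq : 1 ≤ q) (d : Vec n) :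
    diff (T.normalForm n q l₁ ε) ⟨q - 1, by omega⟩ d =
      ∑ j ∈ Finset.Icc 1 l₁, coord d j - ∑ j ∈ Finset.Icc (l₁ + 1) (T.len q), coord d j := by
  rw [diff, (hasFDerivAt_normalForm hT _).fderiv, if_neg (by simp only []; omega)]
  simp

lemma forall_fin_iff_pred_and_last (hq : 1 ≤ q) {P : Fin q → Prop} :
    (∀ i, P i) ↔ (∀ j, ∀ h1 : 1 ≤ j, ∀ hj : j < q, P ⟨j - 1, by omega⟩) ∧ P ⟨q - 1, by omega⟩ := by
  refine ⟨fun h => ⟨fun j h1 hj => h _, h _⟩, fun h i => ?_⟩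
  by_cases hi : i.val + 1 < q
  · exact h.1 (i.val + 1) (by omega) hi
  · rw [show i = ⟨q - 1, by omega⟩ from Fin.ext (by simp only []; omega)]
    exact h.2

lemma not_licq_normalForm (hT : T.Admissible n q) (hl : l₁ < q) {h : Vec n → Fin 0 → ℝ} :
    ¬ LICQ (T.normalForm n q l₁ ε) h := by
  have hlen := hT.len_lt
  have hq : 1 ≤ q := by omega
  rw [licq_iff_surjective (isCentered_normalForm hT).zero]
  intro hsurj
  obtain ⟨d, hd, -⟩ := hsurj (fun i => if i.val + 1 < q then 0 else 1) 0
  have hcoord : ∀ j, 1 ≤ j → j < q → coord d j = 0 := fun j h1 hj => by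
    rw [← diff_normalForm_pred (l₁ := l₁) (ε := ε) hT h1 hj, ← jacobian_apply, hd]
    exact if_pos (by simp only []; omega)
  have hlast := congrFun hd ⟨q - 1, by omega⟩
  rw [jacobian_apply, diff_normalForm_last hT hq, if_neg (by simp only []; omega),
    Finset.sum_eq_zero fun j hj => hcoord j (Finset.mem_Icc.1 hj).1
      (by have := Finset.mem_Icc.1 hj; omega),
    Finset.sum_eq_zero fun j hj => hcoord j (by have := Finset.mem_Icc.1 hj; omega)
      (by have := Finset.mem_Icc.1 hj; omega)] at hlast
  norm_num at hlast

lemma exists_coord_neg_and_sum_lt (hn : 1 ≤ n) {l : ℕ} (h1 : 1 ≤ l₁) (hl₁ : l₁ ≤ n) (hl : l ≤ n) :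
    ∃ d : Vec n, (∀ j, 1 ≤ j → j ≤ n → coord d j < 0) ∧
      ∑ j ∈ Finset.Icc 1 l₁, coord d j < ∑ j ∈ Finset.Icc (l₁ + 1) l, coord d j := by
  set d : Vec n := setCoord (fun _ => -1) 1 (-(n + 1))
  have hone : coord d 1 = -(n + 1) := coord_setCoord_self _ le_rfl hn _
  have hcoord : ∀ j, 2 ≤ j → j ≤ n → coord d j = -1 := fun j h2 hj => by
    rw [coord_setCoord_ne _ (by omega), coord_of_le _ (by omega) hj]
  have hneg : ∀ j, 1 ≤ j → j ≤ n → coord d j < 0 := fun j h1 hj => by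
    rcases h1.eq_or_lt with rfl | h2
    · rw [hone]
      linarith [(Nat.cast_nonneg n : (0 : ℝ) ≤ n)]
    · rw [hcoord j h2 hj]
      norm_num
  refine ⟨d, hneg, ?_⟩
  calc ∑ j ∈ Finset.Icc 1 l₁, coord d j
      ≤ coord d 1 := by
        rw [← Finset.add_sum_erase _ _ (Finset.left_mem_Icc.2 h1)]
        refine add_le_of_nonpos_right (Finset.sum_nonpos fun j hj => ?_)
        have := Finset.mem_Icc.1 (Finset.mem_of_mem_erase hj)
        exact (hneg j this.1 (by omega)).le
    _ < -((l + 1 - (l₁ + 1) : ℕ) : ℝ) := by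
        rw [hone, neg_lt_neg_iff]
        exact_mod_cast (by omega : l + 1 - (l₁ + 1) < n + 1)
    _ = ∑ j ∈ Finset.Icc (l₁ + 1) l, coord d j := by
        rw [Finset.sum_congr rfl (g := fun _ => (-1 : ℝ)) fun j hj =>
          have := Finset.mem_Icc.1 hj
          hcoord j (by omega) (by omega)]
        simp

lemma mfcq_normalForm_iff (hT : T.Admissible n q) (hl : l₁ < q) {h : Vec n → Fin 0 → ℝ} :
    MFCQ (T.normalForm n q l₁ ε) h ↔ 0 < l₁ := by
  have hlen := hT.len_lt
  have hn := hT.le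
  have hq : 1 ≤ q := by omega
  rw [mfcq_iff_surjective (isCentered_normalForm hT).zero]
  simp only [jacobian_apply, forall_fin_iff_pred_and_last hq, diff_normalForm_last hT hq]
  constructor
  · rintro ⟨-, d, ⟨hpred, hlast⟩, -⟩
    by_contra! h0
    obtain rfl : l₁ = 0 := by omega
    have hsum : ∑ j ∈ Finset.Icc (0 + 1) (T.len q), coord d j ≤ 0 :=
      Finset.sum_nonpos fun j hj => by
        have := Finset.mem_Icc.1 hj
        rw [← diff_normalForm_pred (l₁ := 0) (ε := ε) hT (by omega) (by omega : j < q)]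
        exact (hpred j (by omega) (by omega)).le
    rw [Finset.Icc_eq_empty_of_lt zero_lt_one, Finset.sum_empty] at hlast
    linarith
  · intro h0
    obtain ⟨d, hd, hsum⟩ := exists_coord_neg_and_sum_lt (n := n) (by omega) h0 (by omega)
      (by omega : T.len q ≤ n)
    refine ⟨fun z => ⟨0, Subsingleton.elim _ _⟩, d, ⟨fun j h1 hj => ?_, sub_neg.2 hsum⟩,
      Subsingleton.elim _ _⟩
    rw [diff_normalForm_pred hT h1 hj]
    exact hd j h1 (by omega)

lemma linearizedCone_normalForm (hT : T.Admissible n q) {h : Vec n → Fin 0 → ℝ} :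
    linearizedCone (T.normalForm n q 0 ε) h = coordCone n (T.len q) (q - 1) := by
  have hlen := hT.len_lt
  have hq : 1 ≤ q := by omega
  ext d
  rw [mem_linearizedCone (isCentered_normalForm hT).zero, forall_fin_iff_pred_and_last hq,
    diff_normalForm_last hT hq, Finset.Icc_eq_empty_of_lt zero_lt_one, Finset.sum_empty, zero_sub,
    neg_nonpos, zero_add]
  simp only [IsEmpty.forall_iff, and_true]
  constructor
  · rintro ⟨hpred, hlast⟩
    have hnonpos : ∀ j, 1 ≤ j → j ≤ q - 1 → coord d j ≤ 0 := fun j h1 hj => by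
      rw [← diff_normalForm_pred (l₁ := 0) (ε := ε) hT h1 (by omega : j < q)]
      exact hpred j h1 (by omega)
    have hnonpos' : ∀ j ∈ Finset.Icc 1 (T.len q), coord d j ≤ 0 := fun j hj => by
      have := Finset.mem_Icc.1 hj
      exact hnonpos j this.1 (by omega)
    have hzero := (Finset.sum_eq_zero_iff_of_nonpos hnonpos').1
      (le_antisymm (Finset.sum_nonpos hnonpos') hlast)
    exact ⟨fun j h1 hj => hzero j (Finset.mem_Icc.2 ⟨h1, hj⟩), hnonpos⟩
  · rintro ⟨hzero, hnonpos⟩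
    refine ⟨fun j h1 hj => ?_, ?_⟩
    · rw [diff_normalForm_pred hT h1 hj]
      exact hnonpos j h1 (by omega)
    · exact (Finset.sum_eq_zero fun j hj =>
        hzero j (Finset.mem_Icc.1 hj).1 (Finset.mem_Icc.1 hj).2).ge

lemma feasibleSet_normalForm (hq : 1 ≤ q) {h : Vec n → Fin 0 → ℝ} :
    feasibleSet (T.normalForm n q 0 ε) h =
      ineqSet (T.len q) (q - 1) fun x => T.form q ε x := by
  ext x
  simp only [feasibleSet, ineqSet, Set.mem_ofPred_eq, IsEmpty.forall_iff, and_true]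
  rw [forall_fin_iff_pred_and_last hq, normalForm_apply_last hq,
    Finset.Icc_eq_empty_of_lt zero_lt_one, Finset.sum_empty, zero_sub, zero_add,
    neg_add_nonpos_iff]
  refine and_congr ⟨fun h j h1 hj => ?_, fun h j h1 hj => ?_⟩ Iff.rfl
  · rw [← normalForm_apply_pred (T := T) (l₁ := 0) (ε := ε) h1 (by omega : j < q)]
    exact h j h1 (by omega)
  · rw [normalForm_apply_pred h1 hj]
    exact h j h1 (by omega)

theorem constraintQualifications (hT : T.Admissible n q) (hl : l₁ < q) {g : Vec n → Fin q → ℝ}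
    {h : Vec n → Fin 0 → ℝ} (hK : KGEquiv g h (T.normalForm n q l₁ ε) noConstraint) :
    ¬ LICQ g h ∧ (MFCQ g h ↔ 0 < l₁) ∧ (0 < l₁ → ACQ g h ∧ GCQ g h) ∧
      (l₁ = 0 →
        (ACQ g h ↔ coordCone n (T.len q) (q - 1) ⊆
          posTangentConeAt (ineqSet (T.len q) (q - 1) fun x => T.form q ε x) 0) ∧
        (GCQ g h ↔ PolarLE (posTangentConeAt (ineqSet (T.len q) (q - 1) fun x => T.form q ε x) 0)
          (coordCone n (T.len q) (q - 1)))) := by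
  have hc := isCentered_normalForm (l₁ := l₁) (ε := ε) hT
  have hh := isCentered_of_isEmpty (noConstraint (n := n))
  have hsub := tangentCone_subset_linearizedCone hc hh
  obtain ⟨e⟩ := hK.nonempty_firstOrderEquiv hc hh
  rw [e.licq_iff hc.zero, e.mfcq_iff hc.zero, e.acq_iff hc.zero, e.gcq_iff hc hh]
  refine ⟨not_licq_normalForm hT hl, mfcq_normalForm_iff hT hl, fun h0 => ?_, fun h0 => ?_⟩
  · have hACQ := ((mfcq_normalForm_iff hT hl (h := noConstraint)).2 h0).acq hc
    exact ⟨hACQ, hACQ.gcq⟩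
  · subst h0
    rw [gcq_iff_polarLE hsub, ACQ, Set.Subset.antisymm_iff, and_iff_right hsub,
      linearizedCone_normalForm hT, tangentCone_eq_posTangentConeAt,
      feasibleSet_normalForm (by omega)]
    exact ⟨Iff.rfl, Iff.rfl⟩

end IneqType

section Signs

variable {a n : ℕ} {ε : ℕ → ℝ}

lemma IsSign.ne_zero {e : ℝ} (he : IsSign e) : e ≠ 0 := by rcases he with rfl | rfl <;> norm_num

lemma IsSign.mul {e e' : ℝ} (he : IsSign e) (he' : IsSign e') : IsSign (e * e') := by
  rcases he with rfl | rfl <;> rcases he' with rfl | rfl <;> simp [IsSign]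

lemma exists_eq_neg_one_of_not_allEq (hε : ∀ j, IsSign (ε j)) (h : ¬ AllEq ε a n 1) :
    ∃ j, a ≤ j ∧ j ≤ n ∧ ε j = -1 := by
  simp only [AllEq, not_forall] at h
  obtain ⟨j, hj, h1⟩ := h
  exact ⟨j, hj.1, hj.2, (hε j).resolve_left h1⟩

lemma bothSigns_iff (hε : ∀ j, IsSign (ε j)) :
    BothSigns ε a n ↔ (∃ j ∈ Set.Icc a n, ε j = 1) ∧ ∃ j ∈ Set.Icc a n, ε j = -1 := by
  have hsub : ε '' Set.Icc a n ⊆ {1, -1} := Set.image_subset_iff.2 fun j _ => hε j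
  rw [BothSigns, Set.Subset.antisymm_iff, and_iff_right hsub, Set.insert_subset_iff,
    Set.singleton_subset_iff]
  rfl

lemma allEq_or_allEq_of_not_bothSigns (hε : ∀ j, IsSign (ε j)) (h : ¬ BothSigns ε a n) :
    AllEq ε a n 1 ∨ AllEq ε a n (-1) := by
  rw [bothSigns_iff hε, not_and_or] at h
  push Not at h
  exact h.symm.imp (fun h j hj => (hε j).resolve_right (h j hj))
    fun h j hj => (hε j).resolve_left (h j hj)

lemma coord_sq_le_abs_tail (hε : AllEq ε a n 1 ∨ AllEq ε a n (-1)) (x : Vec n) {m : ℕ}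
    (ha : a ≤ m) (hm : m ≤ n) : coord x m ^ 2 ≤ |tail ε a x| := by
  rcases hε with hε | hε
  · exact (coord_sq_le_tail hε x ha hm).trans (le_abs_self _)
  · refine (coord_sq_le_tail (ε := fun j => -ε j) (fun j hj => ?_) x ha hm).trans ?_
    · simp only [hε j hj, neg_neg]
    · rw [tail_neg]
      exact neg_le_abs _

lemma exists_isSign_forall_mul_tail_nonneg (hε : ∀ j, IsSign (ε j)) (h : ¬ BothSigns ε a n) :
    ∃ σ, IsSign σ ∧ ∀ x : Vec n, 0 ≤ σ * tail ε a x := by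
  rcases allEq_or_allEq_of_not_bothSigns hε h with h | h
  · exact ⟨1, Or.inl rfl, fun x => by rw [one_mul]; exact tail_nonneg h x⟩
  · exact ⟨-1, Or.inr rfl, fun x => by linarith [tail_nonpos h x]⟩

end Signs

section EqSetSigns

variable {n p a : ℕ} {f : Vec n → ℝ} {H : ℝ → Vec n → ℝ} {ε : ℕ → ℝ}

lemma coord_nonpos_of_mem_posTangentConeAt {M : Set (Vec n)} {j : ℕ} (hM : ∀ x ∈ M, coord x j ≤ 0)
    {d : Vec n} (hd : d ∈ posTangentConeAt M 0) : coord d j ≤ 0 := by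
  simpa only [coordL_apply] using
    apply_nonpos_of_mem_posTangentConeAt (coordL n j) (by simpa only [coordL_apply] using hM) hd

lemma posTangentConeAt_eqSet_subset_coordCone :
    posTangentConeAt (eqSet p f) 0 ⊆ coordCone n 0 p := fun _ hd =>
  ⟨fun j h1 h2 => by omega,
    fun j h1 h2 => coord_nonpos_of_mem_posTangentConeAt (fun x hx => hx.1 j h1 h2) hd⟩

lemma polarLE_eqSet_of_bothSigns (hf : IsBlowup f H) (hε : ∀ j, IsSign (ε j)) (hpa : p < a)
    (hsq : ∀ j, a ≤ j → j ≤ n → ∀ s, HasSquareTerm (H s) j (ε j)) (h : BothSigns ε a n) :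
    PolarLE (posTangentConeAt (eqSet p f) 0) (coordCone n 0 p) := by
  obtain ⟨⟨j, ⟨haj, hjn⟩, hj⟩, k, ⟨hak, hkn⟩, hk⟩ := (bothSigns_iff hε).1 h
  have hjk : j ≠ k := by
    rintro rfl
    norm_num [hj] at hk
  exact polarLE_eqSet hf hjk (by omega) hjn (by omega) hkn (fun s => hj ▸ hsq j haj hjn s)
    fun s => hk ▸ hsq k hak hkn s

lemma not_polarLE_eqSet_of_coord_sq_le (hf : IsBlowup f H) {m : ℕ} (hpm : p < m) (hm : m ≤ n)
    (hH : ∀ d, coord d m ^ 2 ≤ H 0 d) :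
    ¬ PolarLE (posTangentConeAt (eqSet p f) 0) (coordCone n 0 p) :=
  not_polarLE_of_coord_sq_le (by omega) hpm hm 0 posTangentConeAt_eqSet_subset_coordCone
    fun d hd => by
      simpa only [zero_mul, hf.apply_eq_zero_of_mem_posTangentConeAt (fun _ hx => hx.2) hd]
        using hH d

lemma not_polarLE_eqSet_of_dominated (hf : IsBlowup f H) (hpa : p < a) (han : a ≤ n)
    (hε : AllEq ε a n 1 ∨ AllEq ε a n (-1))
    (hdom : DominatedBySumSq p fun d => H 0 d - tail ε a d) :
    ¬ PolarLE (posTangentConeAt (eqSet p f) 0) (coordCone n 0 p) := by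
  obtain ⟨c, hc⟩ := hdom
  refine not_polarLE_of_coord_sq_le (by omega) hpa han c posTangentConeAt_eqSet_subset_coordCone
    fun d hd => (coord_sq_le_abs_tail hε d le_rfl han).trans ?_
  have hbound : |H 0 d - tail ε a d| ≤ _ := hc d (posTangentConeAt_eqSet_subset_coordCone hd)
  rwa [hf.apply_eq_zero_of_mem_posTangentConeAt (fun _ hx => hx.2) hd, zero_sub, abs_neg] at hbound

theorem polarLE_eqSet_iff_bothSigns (hf : IsBlowup f H) (hε : ∀ j, IsSign (ε j)) (hpa : p < a)
    (han : a ≤ n) (hsq : ∀ j, a ≤ j → j ≤ n → ∀ s, HasSquareTerm (H s) j (ε j))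
    (hdom : DominatedBySumSq p fun d => H 0 d - tail ε a d) :
    PolarLE (posTangentConeAt (eqSet p f) 0) (coordCone n 0 p) ↔ BothSigns ε a n :=
  ⟨not_imp_not.1 fun h =>
    not_polarLE_eqSet_of_dominated hf hpa han (allEq_or_allEq_of_not_bothSigns hε h) hdom,
    polarLE_eqSet_of_bothSigns hf hε hpa hsq⟩

end EqSetSigns

/-! ### One equality constraint, no inequality constraint -/

namespace EqType

variable {n : ℕ} {ε : ℕ → ℝ}

lemma hasSquareTerm_blow_t1 (k : ℕ) {j : ℕ} (h2 : 2 ≤ j) (hj : j ≤ n) (s : ℝ) :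
    HasSquareTerm (fun x : Vec n => (t1 k).blow ε s x) j (ε j) := fun x r => by
  simp only [blow, coord_setCoord_ne x (show 1 ≠ j by omega),
    hasSquareTerm_tail ε (by omega) h2 hj x r]
  ring

lemma polarLE_t1_two_iff (hε : ∀ j, IsSign (ε j)) (hn : 2 ≤ n) :
    PolarLE (posTangentConeAt (eqSet 0 fun x : Vec n => (t1 2).form ε x) 0) (coordCone n 0 0) ↔
      ∃ j ∈ Set.Icc 2 n, ε j = -1 := by
  have hf := isBlowup (n := n) ε (show (t1 2).Admissible n from ⟨le_rfl, by norm_num, hn⟩)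
  constructor
  · rw [← not_imp_not]
    intro hneg
    have hall : AllEq ε 2 n 1 := fun j hj => (hε j).resolve_right fun h => hneg ⟨j, hj, h⟩
    refine not_polarLE_eqSet_of_coord_sq_le hf two_pos hn fun d => ?_
    simp only [blow, Nat.sub_self, pow_zero, one_mul]
    exact (coord_sq_le_tail hall d le_rfl hn).trans (le_add_of_nonneg_left (sq_nonneg _))
  · rintro ⟨j, ⟨hj2, hjn⟩, hj⟩
    refine polarLE_eqSet hf (j := 1) (k := j) (by omega) one_pos (by omega) (by omega) hjn
      (fun s x r => ?_) fun s => hj ▸ hasSquareTerm_blow_t1 2 hj2 hjn s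
    simp only [blow, Nat.sub_self, pow_zero, coord_setCoord_self x le_rfl (show 1 ≤ n by omega),
      tail_setCoord_of_lt ε one_lt_two]
    ring

lemma polarLE_t1_iff_bothSigns (hε : ∀ j, IsSign (ε j)) {k : ℕ} (hk : 3 ≤ k)
    (hT : (t1 k).Admissible n) :
    PolarLE (posTangentConeAt (eqSet 0 fun x : Vec n => (t1 k).form ε x) 0) (coordCone n 0 0) ↔
      BothSigns ε 2 n :=
  polarLE_eqSet_iff_bothSigns (isBlowup ε hT) hε two_pos hT.2.2
    (fun _ => hasSquareTerm_blow_t1 k) <| by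
      simpa [blow, zero_pow (show k - 2 ≠ 0 by omega)] using DominatedBySumSq.zero

lemma polarLE_t2_iff (hε : ∀ j, IsSign (ε j)) (hn : 3 ≤ n) :
    PolarLE (posTangentConeAt (eqSet 0 fun x : Vec n => t2.form ε x) 0) (coordCone n 0 0) ↔
      ∃ j ∈ Set.Icc 4 n, ε j = -1 := by
  have hf := isBlowup (n := n) ε (show t2.Admissible n from hn)
  constructor
  · rw [← not_imp_not]
    intro hneg
    have hall : AllEq ε 4 n 1 := fun j hj => (hε j).resolve_right fun h => hneg ⟨j, hj, h⟩
    refine not_polarLE_eqSet_of_coord_sq_le hf three_pos hn fun d => ?_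
    simp only [blow, zero_mul, zero_add]
    exact le_add_of_nonneg_right (tail_nonneg hall d)
  · rintro ⟨j, ⟨hj4, hjn⟩, hj⟩
    refine polarLE_eqSet hf (j := 3) (k := j) (by omega) three_pos hn (by omega) hjn
      (fun s x r => ?_) fun s x r => ?_
    · simp only [blow, coord_setCoord_self x (show 1 ≤ 3 by norm_num) hn, one_mul,
        coord_setCoord_ne x (show 1 ≠ 3 by norm_num), coord_setCoord_ne x (show 2 ≠ 3 by norm_num),
        tail_setCoord_of_lt ε (show 3 < 4 by norm_num)]
      ring
    · simp only [blow, coord_setCoord_ne x (show 1 ≠ j by omega),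
        coord_setCoord_ne x (show 2 ≠ j by omega), coord_setCoord_ne x (show 3 ≠ j by omega),
        hasSquareTerm_tail ε (by omega) hj4 hjn x r, hj]
      ring

lemma polarLE_iff {T : EqType} (hε : ∀ j, IsSign (ε j)) (hT : T.Admissible n) :
    PolarLE (posTangentConeAt (eqSet 0 fun x : Vec n => T.form ε x) 0) (coordCone n 0 0) ↔
      T.GCQCond n ε := by
  cases T with
  | t1 k =>
    rcases hT.1.eq_or_lt with rfl | hk
    · simpa [GCQCond] using polarLE_t1_two_iff hε hT.2.2
    · simpa [GCQCond, hk.ne', show 3 ≤ k from hk] using polarLE_t1_iff_bothSigns hε hk hT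
  | t2 => exact polarLE_t2_iff hε hT

theorem classification {T : EqType} (hε : ∀ j, IsSign (ε j)) (hT : T.Admissible n)
    {g : Vec n → Fin 0 → ℝ} {h : Vec n → Fin 1 → ℝ}
    (hK : KGEquiv g h noConstraint (single fun x => T.form ε x)) :
    ¬ LICQ g h ∧ ¬ MFCQ g h ∧ ¬ ACQ g h ∧ (GCQ g h ↔ T.GCQCond n ε) := by
  rw [Subsingleton.elim noConstraint (coords (n := n) 0 0)] at hK
  rw [← polarLE_iff hε hT]
  cases T with
  | t1 k =>
    refine (isBlowup ε hT).constraintQualifications_single hK two_pos hT.2.2 ?_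
    refine (hasSquareTerm_blow_t1 k le_rfl hT.2.2 0 0 1).trans_ne ?_
    simpa [(isBlowup ε hT).apply_zero_zero] using (hε 2).ne_zero
  | t2 =>
    refine (isBlowup ε hT).constraintQualifications_single hK three_pos hT ?_
    simp only [blow, tail_setCoord_of_lt ε (show 3 < 4 by norm_num), tail_zero,
      coord_setCoord_self (0 : Vec n) (show 1 ≤ 3 by norm_num) hT]
    norm_num

end EqType

section CubicGerm

variable {n l p : ℕ}

lemma map_setCoord_one_nonneg {C : Set (Vec n)} {ℓ : Vec n →ₗ[ℝ] ℝ} (hℓ : ∀ d ∈ C, ℓ d ≤ 0)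
    {j : ℕ} (h1 : 1 ≤ j) (hn : j ≤ n) (hC : setCoord 0 j (-1) ∈ C) :
    0 ≤ ℓ (setCoord 0 j 1) := by
  have hle := hℓ _ hC
  rw [map_setCoord ℓ _ h1 hn, coord_zero, map_zero] at hle
  linarith

lemma map_setCoord_one_eq_zero {j : ℕ} (h1 : 1 ≤ j) (hn : j ≤ n) {ℓ : Vec n →ₗ[ℝ] ℝ}
    {C : Set (Vec n)} (hℓ : ∀ d ∈ C, ℓ d ≤ 0) (hC : ∀ c : ℝ, c ^ 2 = 1 → setCoord 0 j c ∈ C) :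
    ℓ (setCoord 0 j 1) = 0 :=
  le_antisymm (hℓ _ (hC 1 (by norm_num)))
    (map_setCoord_one_nonneg hℓ h1 hn (hC (-1) (by norm_num)))

lemma tendsto_setCoord_mul {j : ℕ} (h1 : 1 ≤ j) (hn : j ≤ n) {d : Vec n} (hd : coord d j = 0)
    (c : ℝ) : Tendsto (fun s : ℝ => setCoord d j (c * s)) (𝓝[>] 0) (𝓝 d) := by
  have hlim : Tendsto (fun s : ℝ => c * s) (𝓝[>] 0) (𝓝 (coord d j)) := by
    have hcont : Continuous fun s : ℝ => c * s := by fun_prop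
    simpa [hd] using (hcont.tendsto 0).mono_left nhdsWithin_le_nhds
  have hset := tendsto_setCoord (j := j) hlim (tendsto_const_nhds (x := d))
  rwa [setCoord_coord _ h1 hn] at hset

lemma not_polarLE_of_forall_mul_coord_nonpos {M : Set (Vec n)} {j : ℕ} (hl : l < j) (hp : p < j)
    (hn : j ≤ n) {σ : ℝ} (hσ : σ ≠ 0) (hM : ∀ x ∈ M, σ * coord x j ≤ 0) :
    ¬ PolarLE (posTangentConeAt M 0) (coordCone n l p) := by
  refine not_polarLE_of_pos (σ • coordL n j)
    (fun d hd => apply_nonpos_of_mem_posTangentConeAt _ (by simpa using hM) hd)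
    (setCoord_mem_coordCone (zero_mem_coordCone l p) (r := σ) hl hn (by omega)) ?_
  simpa [coord_setCoord_self (0 : Vec n) (show 1 ≤ j by omega) hn] using mul_self_pos.2 hσ

/-- For `a, b ≤ 0` and `x > -(a + b)`, the term `x (x² - a - b)` would dominate `a b`. -/
lemma add_add_nonpos_of_cubic {x a b c t : ℝ} (ha : a ≤ 0) (hb : b ≤ 0) (hc : IsSign c)
    (ht : 0 ≤ t) (h : x ^ 3 - b * x - a * x + c * a * b + t ≤ 0) : x + a + b ≤ 0 := by
  by_contra! hpos
  have hab : 0 ≤ a * b := mul_nonneg_of_nonpos_of_nonpos ha hb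
  have hx : 0 < x := by linarith
  have hcube : 0 < x ^ 3 := by positivity
  have hdom : (a + b) ^ 2 ≤ -(a + b) * x := by nlinarith
  have hcab : -(a * b) ≤ c * a * b := by
    rcases hc with rfl | rfl <;> linarith
  nlinarith [sq_nonneg a, sq_nonneg b]

variable {f : Vec n → ℝ} {H : ℝ → Vec n → ℝ} {ε : ℕ → ℝ} {a u : ℕ} {c c' : ℝ}

/-- The cubic term is compensated by `d_u = -s`. -/
lemma setCoord_three_mem_posTangentConeAt_eqSet (hf : IsBlowup f H) (hau : a ≠ u)
    (ha : a ∈ Set.Icc 1 2) (hu : u ∈ Set.Icc 1 2) (hn : 3 ≤ n)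
    (hH : ∀ s d, H s d = s * coord d 3 ^ 3 + coord d u * coord d 3 + c * coord d a * coord d 3
      + c' * coord d a * coord d u + tail ε 4 d) {e : ℝ} (he : e ^ 2 = 1) :
    setCoord 0 3 e ∈ posTangentConeAt (eqSet 2 f) 0 := by
  obtain ⟨ha1, ha2⟩ := ha
  obtain ⟨hu1, hu2⟩ := hu
  refine mem_posTangentConeAt_eqSet hf (tendsto_setCoord_mul (j := u) hu1 (by omega)
    (by rw [coord_setCoord_ne _ (by omega), coord_zero]) (-1)) ?_ (.of_forall fun s => ?_)
  · filter_upwards [self_mem_nhdsWithin] with s (hs : 0 < s)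
    exact setCoord_mem_coordCone (setCoord_mem_coordCone (zero_mem_coordCone 0 2) (by omega) hn
      (by omega)) (by omega) (by omega) fun _ => by linarith
  · rw [hH]
    simp (disch := omega) only [coord_setCoord_ne, coord_setCoord_self, tail_setCoord_of_lt,
      coord_zero, tail_zero]
    linear_combination s * e * he

/-- On `d_a = 0` the product `d_u d_3` couples a constrained with a free coordinate, and the unit
vector in the remaining direction `a` is minus a tangent vector. -/
lemma polarLE_eqSet_cubic (hf : IsBlowup f H) (hau : a ≠ u) (ha : a ∈ Set.Icc 1 2)
    (hu : u ∈ Set.Icc 1 2) (hn : 3 ≤ n)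
    (hH : ∀ s d, H s d = s * coord d 3 ^ 3 + coord d u * coord d 3 + c * coord d a * coord d 3
      + c' * coord d a * coord d u + tail ε 4 d) :
    PolarLE (posTangentConeAt (eqSet 2 f) 0) (coordCone n 0 2) := by
  have ⟨ha1, ha2⟩ := ha
  have ⟨hu1, hu2⟩ := hu
  intro ℓ hℓ d hd
  have hfree : ℓ (setCoord 0 3 1) = 0 :=
    map_setCoord_one_eq_zero (by omega) hn hℓ fun e he =>
      setCoord_three_mem_posTangentConeAt_eqSet hf hau ha hu hn hH he
  have hdir : 0 ≤ ℓ (setCoord 0 a 1) := by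
    refine map_setCoord_one_nonneg hℓ ha1 (by omega) <| mem_posTangentConeAt_eqSet hf
      (γ := fun _ => setCoord 0 a (-1)) tendsto_const_nhds
      (.of_forall fun _ => setCoord_mem_coordCone (zero_mem_coordCone 0 2) (by omega) (by omega)
        (by norm_num))
      (.of_forall fun s => by
        rw [hH]
        simp (disch := omega) only [coord_setCoord_ne, coord_setCoord_self, tail_setCoord_of_lt,
          coord_zero, tail_zero]
        ring)
  have hplane := map_nonpos_of_coupled_eqSet hf (m := 1) (k := 3) (T := tail ε 4) hu1 hu2
    (Nat.lt_succ_self 2) hn one_ne_zero three_ne_zero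
    (D := {d | d ∈ coordCone n 0 2 ∧ coord d a = 0}) (fun d hd => hd.1)
    (fun d hd r => ⟨setCoord_mem_coordCone hd.1 (by omega) hn (by omega), by
      rw [coord_setCoord_ne _ (by omega), hd.2]⟩)
    (fun d hd r hr => ⟨setCoord_mem_coordCone hd.1 (by omega) (by omega) fun _ => hr, by
      rw [coord_setCoord_ne _ hau, hd.2]⟩)
    (tail_setCoord_of_lt ε (by omega)) (tail_setCoord_of_lt ε (by omega)) one_ne_zero
    (fun d hd s => by rw [hH, hd.2]; ring) hℓ hfree (d := setCoord d a 0)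
    ⟨setCoord_mem_coordCone hd (by omega) (by omega) fun _ => le_rfl,
      coord_setCoord_self _ ha1 (by omega) _⟩
  rw [map_setCoord ℓ _ ha1 (by omega)] at hplane
  linarith [mul_nonpos_of_nonpos_of_nonneg (hd.2 a ha1 ha2) hdir]

end CubicGerm

/-! ### One equality and at least one inequality constraint -/

namespace MixedType

/-- The number of the first coordinate in the sum of the `ε_j x_j²`. -/
def tailStart : MixedType → ℕ
  | t1 _ => 2
  | t2 | t3 _ | t4 _ _ | t5 | t6 => 3
  | t7 | t8 _ _ => 4

variable {n k : ℕ} {ε : ℕ → ℝ} {T : MixedType}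

lemma numIneq_lt_tailStart (T : MixedType) : T.numIneq < T.tailStart := by
  cases T <;> simp [numIneq, tailStart]

lemma Admissible.tailStart_le (hT : T.Admissible n) : T.tailStart ≤ n := by
  cases T <;> simp only [Admissible] at hT <;> simp only [tailStart] <;> omega

lemma hasSquareTerm_blow {j : ℕ} (hj : T.tailStart ≤ j) (hn : j ≤ n) (s : ℝ) :
    HasSquareTerm (fun x : Vec n => T.blow ε s x) j (ε j) := fun x r => by
  cases T <;> simp only [tailStart] at hj <;> simp only [blow] <;>
    simp (disch := omega) only [coord_setCoord_ne] <;>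
    rw [hasSquareTerm_tail ε (by omega) hj hn] <;> ring

lemma polarLE_of_bothSigns (hε : ∀ j, IsSign (ε j)) (hT : T.Admissible n)
    (h : BothSigns ε T.tailStart n) :
    PolarLE (posTangentConeAt (eqSet T.numIneq fun x : Vec n => T.form ε x) 0)
      (coordCone n 0 T.numIneq) :=
  polarLE_eqSet_of_bothSigns (isBlowup ε hT) hε T.numIneq_lt_tailStart
    (fun _ => hasSquareTerm_blow) h

lemma polarLE_t3_of_forall_setCoord_mem (hT : (t3 k).Admissible n) (hε : ε 1 ≠ 0)
    (h : ∀ c : ℝ, c ^ 2 = 1 →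
      setCoord 0 2 c ∈ posTangentConeAt (eqSet 1 fun x : Vec n => (t3 k).form ε x) 0) :
    PolarLE (posTangentConeAt (eqSet 1 fun x : Vec n => (t3 k).form ε x) 0) (coordCone n 0 1) := by
  obtain ⟨hk3, -, hn⟩ := id hT
  intro ℓ hℓ d hd
  exact map_nonpos_of_coupled_eqSet (isBlowup ε hT) (m := k - 2) (k := k) (D := coordCone n 0 1)
    (T := tail ε 3) le_rfl le_rfl one_lt_two (by omega) (by omega) (by omega) subset_rfl
    (fun d hd r => setCoord_mem_coordCone hd (by omega) (by omega) (by omega))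
    (fun d hd r hr => setCoord_mem_coordCone hd (by omega) (by omega) fun _ => hr)
    (tail_setCoord_of_lt ε (by omega)) (tail_setCoord_of_lt ε (by omega)) hε (fun d _ s => rfl) hℓ
    (map_setCoord_one_eq_zero (by omega) (by omega) hℓ h) hd

lemma polarLE_t3_three_of_eq_one (hT : (t3 3).Admissible n) (h : ε 1 = 1) :
    PolarLE (posTangentConeAt (eqSet 1 fun x : Vec n => (t3 3).form ε x) 0) (coordCone n 0 1) := by
  have hn := hT.2.2
  refine polarLE_t3_of_forall_setCoord_mem hT (by norm_num [h]) fun c hc => ?_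
  refine mem_posTangentConeAt_eqSet (isBlowup ε hT) (tendsto_setCoord_mul (j := 1) le_rfl
    (by omega) (by rw [coord_setCoord_ne _ (by omega), coord_zero]) (-1)) ?_
    (.of_forall fun s => ?_)
  · filter_upwards [self_mem_nhdsWithin] with s (hs : 0 < s)
    exact setCoord_mem_coordCone (setCoord_mem_coordCone (zero_mem_coordCone 0 1) (by omega)
      (by omega) (by omega)) (by omega) (by omega) fun _ => by linarith
  · simp only [blow, h]
    simp (disch := omega) only [coord_setCoord_ne, coord_setCoord_self, tail_setCoord_of_lt,
      tail_zero]
    linear_combination s * c * hc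

lemma polarLE_t3_four_of_eq_neg_one (hT : (t3 4).Admissible n) (hε : ε 1 ≠ 0) {j : ℕ}
    (hj : j ∈ Set.Icc 3 n) (h : ε j = -1) :
    PolarLE (posTangentConeAt (eqSet 1 fun x : Vec n => (t3 4).form ε x) 0) (coordCone n 0 1) := by
  obtain ⟨hj3, hjn⟩ := hj
  refine polarLE_t3_of_forall_setCoord_mem hT hε fun c hc => ?_
  refine mem_posTangentConeAt_eqSet (isBlowup ε hT) (tendsto_setCoord_mul (j := j) (by omega) hjn
    (by rw [coord_setCoord_ne _ (by omega), coord_zero]) 1) (.of_forall fun s =>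
      setCoord_mem_coordCone (setCoord_mem_coordCone (zero_mem_coordCone 0 1) (by omega)
        (by omega) (by omega)) (by omega) hjn (by omega)) (.of_forall fun s => ?_)
  simp only [blow]
  rw [hasSquareTerm_tail ε (by omega) hj3 hjn]
  simp (disch := omega) only [coord_setCoord_ne, coord_setCoord_self, tail_setCoord_of_lt,
    coord_zero, tail_zero, h]
  linear_combination s ^ 2 * (c ^ 2 + 1) * hc

lemma not_polarLE_t3_three (hε : ∀ j, IsSign (ε j)) (hn : 2 ≤ n) (h1 : ε 1 = -1)
    (h : ¬ BothSigns ε 3 n) :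
    ¬ PolarLE (posTangentConeAt (eqSet 1 fun x : Vec n => (t3 3).form ε x) 0)
      (coordCone n 0 1) := by
  obtain ⟨σ, hσ, htail⟩ := exists_isSign_forall_mul_tail_nonneg hε h
  refine not_polarLE_of_forall_mul_coord_nonpos (by omega) one_lt_two hn hσ.ne_zero
    fun x ⟨hx, hform⟩ => ?_
  simp only [form, h1] at hform
  have hprod : σ * coord x 2 * (coord x 2 ^ 2 - coord x 1) = -(σ * tail ε 3 x) := by
    linear_combination σ * hform
  by_contra! hpos
  have hsq : 0 < coord x 2 ^ 2 := sq_pos_of_ne_zero fun h0 => by simp [h0] at hpos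
  linarith [htail x, mul_pos hpos (show 0 < coord x 2 ^ 2 - coord x 1 by
    linarith [hx 1 le_rfl le_rfl])]

lemma not_polarLE_t3_four (hε : ε 1 ≠ 0) (hn : 2 ≤ n) (h : AllEq ε 3 n 1) :
    ¬ PolarLE (posTangentConeAt (eqSet 1 fun x : Vec n => (t3 4).form ε x) 0)
      (coordCone n 0 1) := by
  refine not_polarLE_of_forall_mul_coord_nonpos (by omega) one_lt_two hn (neg_ne_zero.2 hε)
    fun x ⟨hx, hform⟩ => ?_
  simp only [form] at hform
  by_contra! hpos
  have hfour : 0 < coord x 2 ^ 4 := by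
    have : coord x 2 ≠ 0 := fun h0 => by simp [h0] at hpos
    positivity
  linarith [tail_nonneg h x, mul_nonneg_of_nonpos_of_nonpos (hx 1 le_rfl le_rfl)
    (show ε 1 * coord x 2 ≤ 0 by linarith)]

lemma polarLE_t3_iff (hε : ∀ j, IsSign (ε j)) (hT : (t3 k).Admissible n) :
    PolarLE (posTangentConeAt (eqSet 1 fun x : Vec n => (t3 k).form ε x) 0) (coordCone n 0 1) ↔
      (t3 k).GCQCond n ε := by
  have hn : 2 ≤ n := by linarith [hT.2.2]
  obtain rfl | rfl : k = 3 ∨ k = 4 := by have := hT.1; have := hT.2.1; omega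
  · simp only [GCQCond, show ¬ Even 3 by decide, show Odd 3 by decide, false_and, true_and,
      false_or]
    refine ⟨not_imp_not.1 fun h => ?_, ?_⟩
    · rw [not_or] at h
      exact not_polarLE_t3_three hε hn ((hε 1).resolve_left h.1) h.2
    · rintro (h | h)
      exacts [polarLE_t3_three_of_eq_one hT h, polarLE_of_bothSigns hε hT h]
  · simp only [GCQCond, show Even 4 by decide, show ¬ Odd 4 by decide, false_and, true_and,
      or_false]
    refine ⟨not_imp_not.1 fun h => not_polarLE_t3_four (hε 1).ne_zero hn fun j hj =>
      (hε j).resolve_right fun hj1 => h ⟨j, hj, hj1⟩, ?_⟩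
    rintro ⟨j, hj, h⟩
    exact polarLE_t3_four_of_eq_neg_one hT (hε 1).ne_zero hj h

lemma not_polarLE_t7 (hε : ∀ j, IsSign (ε j)) (hn : 3 ≤ n) (h1 : ε 1 = -1) (h2 : ε 2 = -1)
    (h : ¬ BothSigns ε 4 n) :
    ¬ PolarLE (posTangentConeAt (eqSet 2 fun x : Vec n => t7.form ε x) 0) (coordCone n 0 2) := by
  obtain ⟨σ, hσ, htail⟩ := exists_isSign_forall_mul_tail_nonneg hε h
  have hσ2 : σ ^ 2 = 1 := by rcases hσ with rfl | rfl <;> norm_num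
  have hM : ∀ x ∈ eqSet 2 fun x : Vec n => t7.form ε x,
      (σ • coordL n 3 + coordL n 1 + coordL n 2) x ≤ 0 := by
    rintro x ⟨hx, hform⟩
    simp only [form, h1, h2] at hform
    simp only [add_apply, smul_apply, smul_eq_mul, coordL_apply]
    refine add_add_nonpos_of_cubic (hx 1 le_rfl one_le_two) (hx 2 one_le_two le_rfl)
      (hσ.mul (hε 3)) (htail x) (le_of_eq ?_)
    linear_combination σ * hform + σ * coord x 3 ^ 3 * hσ2
  refine not_polarLE_of_pos _ (fun d hd => apply_nonpos_of_mem_posTangentConeAt _ hM hd)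
    (setCoord_mem_coordCone (zero_mem_coordCone 0 2) (j := 3) (r := σ) (by omega) hn (by omega)) ?_
  simp (disch := omega) only [add_apply, smul_apply, smul_eq_mul, coordL_apply,
    coord_setCoord_ne, coord_setCoord_self, coord_zero]
  nlinarith

lemma polarLE_t7_iff (hε : ∀ j, IsSign (ε j)) (hT : t7.Admissible n) :
    PolarLE (posTangentConeAt (eqSet 2 fun x : Vec n => t7.form ε x) 0) (coordCone n 0 2) ↔
      t7.GCQCond n ε := by
  have hn : 4 ≤ n := hT
  refine ⟨not_imp_not.1 fun h => ?_, ?_⟩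
  · simp only [GCQCond, not_or] at h
    exact not_polarLE_t7 hε (by omega) ((hε 1).resolve_left h.2.1) ((hε 2).resolve_left h.2.2) h.1
  · rintro (h | h | h)
    · exact polarLE_of_bothSigns hε hT h
    · refine polarLE_eqSet_cubic (isBlowup ε hT) (a := 1) (u := 2) (c := ε 2) (c' := ε 3) (ε := ε)
        (by omega) (by simp) (by simp) (by omega) fun s d => ?_
      simp only [blow, h]
      ring
    · refine polarLE_eqSet_cubic (isBlowup ε hT) (a := 2) (u := 1) (c := ε 1) (c' := ε 3) (ε := ε)
        (by omega) (by simp) (by simp) (by omega) fun s d => ?_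
      simp only [blow, h]
      ring

lemma polarLE_iff_bothSigns (hε : ∀ j, IsSign (ε j)) (hT : T.Admissible n)
    (hdom : DominatedBySumSq T.numIneq fun d : Vec n => T.blow ε 0 d - tail ε T.tailStart d) :
    PolarLE (posTangentConeAt (eqSet T.numIneq fun x : Vec n => T.form ε x) 0)
      (coordCone n 0 T.numIneq) ↔ BothSigns ε T.tailStart n :=
  polarLE_eqSet_iff_bothSigns (isBlowup ε hT) hε T.numIneq_lt_tailStart hT.tailStart_le
    (fun _ => hasSquareTerm_blow) hdom

lemma polarLE_iff (hε : ∀ j, IsSign (ε j)) (hT : T.Admissible n) :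
    PolarLE (posTangentConeAt (eqSet T.numIneq fun x : Vec n => T.form ε x) 0)
      (coordCone n 0 T.numIneq) ↔ T.GCQCond n ε := by
  cases T with
  | t1 k =>
    refine polarLE_iff_bothSigns hε hT <|
      ((DominatedBySumSq.coord_mul_coord (p := 1) (i := 1) (j := 1) (by decide)
        (by decide)).const_mul (0 ^ (k - 2))).congr fun d => ?_
    rcases hT.1.eq_or_lt with rfl | hk
    · simp [blow, tailStart, sq]
    · simp [blow, tailStart, zero_pow (show k - 2 ≠ 0 by omega)]
  | t2 =>
    exact polarLE_iff_bothSigns hε hT <|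
      (DominatedBySumSq.coord_mul_coord (p := 1) (i := 1) (j := 1) (by decide) (by decide)).congr
        fun d => by simp only [blow, tailStart]; ring
  | t3 k => exact polarLE_t3_iff hε hT
  | t4 δ α =>
    exact polarLE_iff_bothSigns hε hT <|
      (DominatedBySumSq.binary_form (p := 2) (i := 1) (j := 2) (by decide) (by decide)
        (δ 1) (δ 2) α).congr fun d => by simp only [blow, tailStart]; ring
  | t5 =>
    exact polarLE_iff_bothSigns hε hT <|
      (DominatedBySumSq.binary_form (p := 2) (i := 1) (j := 2) (by decide) (by decide)
        0 (ε 1) (ε 2)).congr fun d => by simp only [blow, tailStart]; ring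
  | t6 =>
    exact polarLE_iff_bothSigns hε hT <|
      (DominatedBySumSq.binary_form (p := 2) (i := 1) (j := 2) (by decide) (by decide) 1 (ε 1 ^ 2)
        (2 * ε 1)).congr fun d => by simp only [blow, tailStart]; ring
  | t7 => exact polarLE_t7_iff hε hT
  | t8 δ α =>
    exact polarLE_iff_bothSigns hε hT <|
      (DominatedBySumSq.ternary_form (p := 3) (i := 1) (j := 2) (k := 3) (by decide) (by decide)
        (by decide) (δ 1) (δ 2) (δ 3) (α 1 2) (α 1 3) (α 2 3)).congr
        fun d => by simp only [blow, tailStart]; ring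

theorem classification (hε : ∀ j, IsSign (ε j)) (hT : T.Admissible n)
    {g : Vec n → Fin T.numIneq → ℝ} {h : Vec n → Fin 1 → ℝ}
    (hK : KGEquiv g h (coords 0 T.numIneq) (single fun x => T.form ε x)) :
    ¬ LICQ g h ∧ ¬ MFCQ g h ∧ ¬ ACQ g h ∧ (GCQ g h ↔ T.GCQCond n ε) := by
  rw [← polarLE_iff hε hT]
  refine (isBlowup ε hT).constraintQualifications_single hK T.numIneq_lt_tailStart
    hT.tailStart_le ((hasSquareTerm_blow le_rfl hT.tailStart_le 0 0 1).trans_ne ?_)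
  simpa [(isBlowup ε hT).apply_zero_zero] using (hε _).ne_zero

end MixedType

/-! ### Ternary quadratic forms on the negative octant -/

section Octant

variable {a b c : ℝ}

/-- The ternary form `-x² - y² - z² + a x y + b x z + c y z` is nonpositive on the octant
`x, y, z ≤ 0`. -/
def NonposOnOctant (a b c : ℝ) : Prop :=
  ∀ x y z : ℝ, x ≤ 0 → y ≤ 0 → z ≤ 0 →
    -x ^ 2 - y ^ 2 - z ^ 2 + a * (x * y) + b * (x * z) + c * (y * z) ≤ 0

lemma NonposOnOctant.swap_yz (h : NonposOnOctant a b c) : NonposOnOctant b a c :=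
  fun x y z hx hy hz => by linarith [h x z y hx hz hy]

lemma NonposOnOctant.swap_xy (h : NonposOnOctant a b c) : NonposOnOctant a c b :=
  fun x y z hx hy hz => by linarith [h y x z hy hx hz]

/-- The two alternatives of `IneqType.Dagger`, with `a`, `b` the coefficients of `x y`, `x z` and
`c` that of `y z`. -/
def OctantCond (a b c : ℝ) : Prop :=
  (a ≤ 0 ∧ b ≤ 0 ∧ c < 2) ∨
    (0 < a ∧ a < 2 ∧ 0 < b ∧ b < 2 ∧ c + a * b / 2 < 2 * √((1 - a ^ 2 / 4) * (1 - b ^ 2 / 4)))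

lemma octantCond_comm : OctantCond a b c ↔ OctantCond b a c := by
  have hsqrt : (1 - a ^ 2 / 4) * (1 - b ^ 2 / 4) = (1 - b ^ 2 / 4) * (1 - a ^ 2 / 4) :=
    mul_comm _ _
  simp only [OctantCond, hsqrt, mul_comm a b]
  tauto

lemma ternary_form_eq_neg_sq_sub_sq {u v : ℝ} (hu : u ^ 2 = 1 - a ^ 2 / 4)
    (hv : v ^ 2 = 1 - b ^ 2 / 4) (x y z : ℝ) :
    -x ^ 2 - y ^ 2 - z ^ 2 + a * (x * y) + b * (x * z) + c * (y * z) =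
      -(x - (a * y + b * z) / 2) ^ 2 - (u * y - v * z) ^ 2
        + (c + a * b / 2 - 2 * (u * v)) * (y * z) := by
  linear_combination y ^ 2 * hu + z ^ 2 * hv

lemma OctantCond.nonposOnOctant (h : OctantCond a b c) : NonposOnOctant a b c := by
  intro x y z hx hy hz
  have hyz := mul_nonneg_of_nonpos_of_nonpos hy hz
  rcases h with ⟨ha, hb, hc⟩ | ⟨ha, ha2, hb, hb2, hc⟩
  · have hxy := mul_nonneg_of_nonpos_of_nonpos hx hy
    have hxz := mul_nonneg_of_nonpos_of_nonpos hx hz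
    nlinarith [mul_nonpos_of_nonpos_of_nonneg ha hxy, mul_nonpos_of_nonpos_of_nonneg hb hxz,
      mul_nonneg (sub_nonneg.2 hc.le) hyz, sq_nonneg (y - z), sq_nonneg x]
  · have hu : 0 ≤ 1 - a ^ 2 / 4 := by nlinarith
    have hv : 0 ≤ 1 - b ^ 2 / 4 := by nlinarith
    rw [Real.sqrt_mul hu] at hc
    rw [ternary_form_eq_neg_sq_sub_sq (Real.sq_sqrt hu) (Real.sq_sqrt hv)]
    linarith [sq_nonneg (x - (a * y + b * z) / 2),
      sq_nonneg (√(1 - a ^ 2 / 4) * y - √(1 - b ^ 2 / 4) * z),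
      mul_nonneg (sub_nonneg.2 hc.le) hyz]

lemma NonposOnOctant.lt_two (h : NonposOnOctant a b c) (hc : c ^ 2 ≠ 4) : c < 2 := by
  refine lt_of_le_of_ne ?_ fun h2 => hc (by rw [h2]; norm_num)
  linarith [h 0 (-1) (-1) le_rfl (by norm_num) (by norm_num)]

/-- For `a, b > 0` both squares of `ternary_form_eq_neg_sq_sub_sq` vanish at a point of the
octant. -/
lemma NonposOnOctant.add_lt_two_mul_sqrt (h : NonposOnOctant a b c)
    (hdet : a ^ 2 + b ^ 2 + c ^ 2 + a * b * c ≠ 4) (ha : 0 < a) (ha2 : a < 2) (hb : 0 < b)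
    (hb2 : b < 2) : c + a * b / 2 < 2 * √((1 - a ^ 2 / 4) * (1 - b ^ 2 / 4)) := by
  have hP : 0 < 1 - a ^ 2 / 4 := by nlinarith
  have hQ : 0 < 1 - b ^ 2 / 4 := by nlinarith
  obtain ⟨u, hu, hu2, huP⟩ : ∃ u, 0 < u ∧ u ^ 2 = 1 - a ^ 2 / 4 ∧ √(1 - a ^ 2 / 4) = u :=
    ⟨_, Real.sqrt_pos.2 hP, Real.sq_sqrt hP.le, rfl⟩
  obtain ⟨v, hv, hv2, hvQ⟩ : ∃ v, 0 < v ∧ v ^ 2 = 1 - b ^ 2 / 4 ∧ √(1 - b ^ 2 / 4) = v :=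
    ⟨_, Real.sqrt_pos.2 hQ, Real.sq_sqrt hQ.le, rfl⟩
  rw [Real.sqrt_mul hP.le, huP, hvQ]
  have hle := h (-((a * v + b * u) / 2)) (-v) (-u)
    (neg_nonpos.2 (by positivity)) (neg_nonpos.2 hv.le) (neg_nonpos.2 hu.le)
  rw [ternary_form_eq_neg_sq_sub_sq hu2 hv2] at hle
  have hle' : c + a * b / 2 - 2 * (u * v) ≤ 0 :=
    nonpos_of_mul_nonpos_left (by linarith) (mul_pos hv hu)
  refine lt_of_le_of_ne (by linarith) fun heq => hdet ?_
  linear_combination (c + a * b / 2 + 2 * (u * v)) * heq + 4 * v ^ 2 * hu2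
    + 4 * (1 - a ^ 2 / 4) * hv2

lemma NonposOnOctant.octantCond (h : NonposOnOctant a b c) (ha : a ^ 2 ≠ 4) (hb : b ^ 2 ≠ 4)
    (hc : c ^ 2 ≠ 4) (hdet : a ^ 2 + b ^ 2 + c ^ 2 + a * b * c ≠ 4)
    (hab : a ≤ 0 ∧ b ≤ 0 ∨ 0 < a ∧ 0 < b) : OctantCond a b c := by
  rcases hab with ⟨ha0, hb0⟩ | ⟨ha0, hb0⟩
  · exact .inl ⟨ha0, hb0, h.lt_two hc⟩
  · have ha2 := h.swap_xy.swap_yz.swap_xy.lt_two ha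
    have hb2 := h.swap_xy.lt_two hb
    exact .inr ⟨ha0, ha2, hb0, hb2, h.add_lt_two_mul_sqrt hdet ha0 ha2 hb0 hb2⟩

theorem nonposOnOctant_iff (ha : a ^ 2 ≠ 4) (hb : b ^ 2 ≠ 4) (hc : c ^ 2 ≠ 4)
    (hdet : a ^ 2 + b ^ 2 + c ^ 2 + a * b * c ≠ 4) :
    NonposOnOctant a b c ↔ OctantCond a b c ∨ OctantCond a c b ∨ OctantCond b c a := by
  constructor
  · intro h
    have hsigns : (a ≤ 0 ∧ b ≤ 0 ∨ 0 < a ∧ 0 < b) ∨ (a ≤ 0 ∧ c ≤ 0 ∨ 0 < a ∧ 0 < c) ∨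
        (b ≤ 0 ∧ c ≤ 0 ∨ 0 < b ∧ 0 < c) := by
      have := le_or_gt a 0
      have := le_or_gt b 0
      have := le_or_gt c 0
      tauto
    rcases hsigns with hs | hs | hs
    · exact .inl (h.octantCond ha hb hc hdet hs)
    · exact .inr (.inl (h.swap_xy.octantCond ha hc hb (fun h0 => hdet (by linarith)) hs))
    · exact .inr (.inr (h.swap_yz.swap_xy.octantCond hb hc ha (fun h0 => hdet (by linarith)) hs))
  · rintro (h | h | h)
    exacts [h.nonposOnOctant, h.nonposOnOctant.swap_xy, h.nonposOnOctant.swap_xy.swap_yz]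

end Octant

lemma IneqType.dagger_iff_octantCond {α : ℕ → ℕ → ℝ} (hα : ∀ i j, α i j = α j i) :
    Dagger α ↔ OctantCond (α 1 2) (α 1 3) (α 2 3) ∨ OctantCond (α 1 2) (α 2 3) (α 1 3) ∨
      OctantCond (α 1 3) (α 2 3) (α 1 2) := by
  change (∃ i ∈ Finset.Icc 1 3, ∃ j ∈ Finset.Icc 1 3, ∃ k ∈ Finset.Icc 1 3, i ≠ j ∧ i ≠ k ∧
    j ≠ k ∧ OctantCond (α i j) (α i k) (α j k)) ↔ _
  constructor
  · rintro ⟨i, hi, j, hj, k, hk, hij, hik, hjk, h⟩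
    rw [Finset.mem_Icc] at hi hj hk
    obtain ⟨rfl, rfl, rfl⟩ | ⟨rfl, rfl, rfl⟩ | ⟨rfl, rfl, rfl⟩ | ⟨rfl, rfl, rfl⟩ |
        ⟨rfl, rfl, rfl⟩ | ⟨rfl, rfl, rfl⟩ :
        (i = 1 ∧ j = 2 ∧ k = 3) ∨ (i = 1 ∧ j = 3 ∧ k = 2) ∨ (i = 2 ∧ j = 1 ∧ k = 3) ∨
        (i = 2 ∧ j = 3 ∧ k = 1) ∨ (i = 3 ∧ j = 1 ∧ k = 2) ∨ (i = 3 ∧ j = 2 ∧ k = 1) := by omega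
    · exact .inl h
    · exact .inl (octantCond_comm.1 (by rwa [hα 3 2] at h))
    · exact .inr (.inl (by rwa [hα 2 1] at h))
    · exact .inr (.inl (octantCond_comm.1 (by rwa [hα 2 1, hα 3 1] at h)))
    · exact .inr (.inr (by rwa [hα 3 1, hα 3 2] at h))
    · exact .inr (.inr (octantCond_comm.1 (by rwa [hα 3 1, hα 3 2, hα 2 1] at h)))
  · rintro (h | h | h)
    · exact ⟨1, by simp, 2, by simp, 3, by simp, by simp, by simp, by simp, h⟩
    · exact ⟨2, by simp, 1, by simp, 3, by simp, by simp, by simp, by simp, by rwa [hα 2 1]⟩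
    · exact ⟨3, by simp, 1, by simp, 2, by simp, by simp, by simp, by simp,
        by rwa [hα 3 1, hα 3 2]⟩

lemma IneqType.nonposOnOctant_iff_dagger {δ : ℕ → ℝ} {α : ℕ → ℕ → ℝ}
    (hα : ∀ i j, α i j = α j i) (h1 : δ 1 = -1) (h2 : δ 2 = -1) (h3 : δ 3 = -1)
    (hS : StarStar δ α) : NonposOnOctant (α 1 2) (α 1 3) (α 2 3) ↔ Dagger α := by
  rw [dagger_iff_octantCond hα]
  refine nonposOnOctant_iff (fun h => hS.1 1 (by simp) 2 (by simp) (by simp) ?_)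
    (fun h => hS.1 1 (by simp) 3 (by simp) (by simp) ?_)
    (fun h => hS.1 2 (by simp) 3 (by simp) (by simp) ?_) (fun h => hS.2 ?_) <;>
  simp only [h1, h2, h3] <;> linarith

section QuadraticPart

variable {n l p a i j k : ℕ} {ε : ℕ → ℝ}

lemma IsSign.eq_neg_one_of_nonpos {e : ℝ} (he : IsSign e) (h : e ≤ 0) : e = -1 :=
  he.resolve_left fun h1 => by linarith

lemma allEq_iff_and_allEq_succ {s : ℝ} (h : a ≤ n) :
    AllEq ε a n s ↔ ε a = s ∧ AllEq ε (a + 1) n s := by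
  refine ⟨fun hε => ⟨hε a ⟨le_rfl, h⟩, fun j hj => hε j ⟨Nat.le_of_succ_le hj.1, hj.2⟩⟩,
    fun ⟨ha, hε⟩ j hj => ?_⟩
  rcases hj.1.eq_or_lt with rfl | hlt
  exacts [ha, hε j ⟨hlt, hj.2⟩]

lemma allEq_neg_one_of_forall_nonpos {Q : Vec n → ℝ} (hε : ∀ j, IsSign (ε j)) (hla : l < a)
    (hpa : p < a) (hQ : ∀ j, a ≤ j → Q (setCoord 0 j 1) = 0)
    (h : ∀ d ∈ coordCone n l p, Q d + tail ε a d ≤ 0) : AllEq ε a n (-1) := by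
  rintro j ⟨hj, hjn⟩
  have hunit := h _ (setCoord_mem_coordCone (zero_mem_coordCone l p) (j := j) (r := 1) (by omega)
    hjn (by omega))
  rw [hQ j hj, hasSquareTerm_tail ε (by omega) hj hjn, tail_zero, coord_zero] at hunit
  exact (hε j).eq_neg_one_of_nonpos (by linarith)

lemma forall_unary_add_tail_nonpos_iff {F : ℝ → ℝ} (hF : F 0 = 0) (hε : ∀ j, IsSign (ε j))
    (hli : l < i) (hia : i < a) (hpa : p < a) (hin : i ≤ n) :
    (∀ d ∈ coordCone n l p, F (coord d i) + tail ε a d ≤ 0) ↔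
      (∀ x, (i ≤ p → x ≤ 0) → F x ≤ 0) ∧ AllEq ε a n (-1) := by
  refine ⟨fun h => ⟨fun x hx => ?_, allEq_neg_one_of_forall_nonpos hε (hli.trans hia) hpa
    (fun j hj => ?_) h⟩, fun ⟨h, hall⟩ d hd => ?_⟩
  · have htest := h _ (setCoord_mem_coordCone (zero_mem_coordCone l p) hli hin hx)
    simpa (disch := omega) only [coord_setCoord_self, tail_setCoord_of_lt, tail_zero,
      add_zero] using htest
  · rw [coord_setCoord_ne _ (by omega), coord_zero, hF]
  · linarith [h (coord d i) (hd.2 i (by omega)), tail_nonpos hall d]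

lemma forall_binary_add_tail_nonpos_iff {F : ℝ → ℝ → ℝ} (hF : F 0 0 = 0)
    (hε : ∀ j, IsSign (ε j)) (hli : l < i) (hij : i < j) (hja : j < a) (hpa : p < a)
    (hjn : j ≤ n) :
    (∀ d ∈ coordCone n l p, F (coord d i) (coord d j) + tail ε a d ≤ 0) ↔
      (∀ x y, (i ≤ p → x ≤ 0) → (j ≤ p → y ≤ 0) → F x y ≤ 0) ∧ AllEq ε a n (-1) := by
  refine ⟨fun h => ⟨fun x y hx hy => ?_, allEq_neg_one_of_forall_nonpos hε (by omega) hpa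
    (fun m hm => ?_) h⟩, fun ⟨h, hall⟩ d hd => ?_⟩
  · have htest := h _ (setCoord_mem_coordCone (setCoord_mem_coordCone (zero_mem_coordCone l p)
      hli (by omega) hx) (by omega) hjn hy)
    simpa (disch := omega) only [coord_setCoord_self, coord_setCoord_ne, tail_setCoord_of_lt,
      tail_zero, add_zero] using htest
  · rw [coord_setCoord_ne _ (by omega), coord_setCoord_ne _ (by omega), coord_zero, coord_zero, hF]
  · linarith [h (coord d i) (coord d j) (hd.2 i (by omega)) (hd.2 j (by omega)),
      tail_nonpos hall d]

lemma forall_ternary_add_tail_nonpos_iff {F : ℝ → ℝ → ℝ → ℝ} (hF : F 0 0 0 = 0)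
    (hε : ∀ j, IsSign (ε j)) (hli : l < i) (hij : i < j) (hjk : j < k) (hka : k < a)
    (hpa : p < a) (hkn : k ≤ n) :
    (∀ d ∈ coordCone n l p, F (coord d i) (coord d j) (coord d k) + tail ε a d ≤ 0) ↔
      (∀ x y z, (i ≤ p → x ≤ 0) → (j ≤ p → y ≤ 0) → (k ≤ p → z ≤ 0) → F x y z ≤ 0) ∧
        AllEq ε a n (-1) := by
  refine ⟨fun h => ⟨fun x y z hx hy hz => ?_, allEq_neg_one_of_forall_nonpos hε (by omega) hpa
    (fun m hm => ?_) h⟩, fun ⟨h, hall⟩ d hd => ?_⟩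
  · have htest := h _ (setCoord_mem_coordCone (setCoord_mem_coordCone (setCoord_mem_coordCone
      (zero_mem_coordCone l p) hli (by omega) hx) (by omega) (by omega) hy) (by omega) hkn hz)
    simpa (disch := omega) only [coord_setCoord_self, coord_setCoord_ne, tail_setCoord_of_lt,
      tail_zero, add_zero] using htest
  · rw [coord_setCoord_ne _ (by omega), coord_setCoord_ne _ (by omega),
      coord_setCoord_ne _ (by omega), coord_zero, coord_zero, coord_zero, hF]
  · linarith [h (coord d i) (coord d j) (coord d k) (hd.2 i (by omega)) (hd.2 j (by omega))
      (hd.2 k (by omega)), tail_nonpos hall d]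

lemma forall_pow_add_tail_nonpos_iff (hε : ∀ j, IsSign (ε j)) (hli : l < i) (hpi : p ≤ i)
    (hin : i ≤ n) (hk : 2 ≤ k) :
    (∀ d ∈ coordCone n l p, ε i * 0 ^ (k - 2) * coord d i ^ k + tail ε (i + 1) d ≤ 0) ↔
      AllEq ε i n (-1) ∨ 3 ≤ k ∧ AllEq ε (i + 1) n (-1) := by
  rw [forall_unary_add_tail_nonpos_iff (F := fun x => ε i * 0 ^ (k - 2) * x ^ k)
    (by simp [zero_pow (show k ≠ 0 by omega)]) hε hli i.lt_succ_self (by omega) hin,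
    allEq_iff_and_allEq_succ hin]
  rcases hk.eq_or_lt with rfl | hk3
  · have hsign : (∀ x : ℝ, (i ≤ p → x ≤ 0) → ε i * 0 ^ (2 - 2) * x ^ 2 ≤ 0) ↔ ε i = -1 := by
      refine ⟨fun h => (hε i).eq_neg_one_of_nonpos (by simpa using h (-1) (by norm_num)),
        fun h x _ => ?_⟩
      rw [h]
      simpa using sq_nonneg x
    rw [hsign]
    exact ⟨.inl, fun h => h.resolve_right fun h3 => absurd h3.1 (by norm_num)⟩
  · have hzero : (0 : ℝ) ^ (k - 2) = 0 := zero_pow (by omega)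
    simp only [hzero, mul_zero, zero_mul, le_refl, implies_true, true_and,
      show 3 ≤ k from hk3]
    tauto

end QuadraticPart

/-! ### Inequality constraints only -/

namespace IneqType

/-- The number of the first coordinate in the sum of the `ε_j x_j²`. -/
def tailStart (q : ℕ) : IneqType → ℕ
  | t1 _ | t4 _ | t5 | t9 _ _ _ => q + 1
  | t2 => q + 2
  | t3 _ | t6 _ _ | t7 _ | t8 _ | t10 _ _ => q

variable {n q k : ℕ} {ε : ℕ → ℝ} {T : IneqType}

lemma le_tailStart (q : ℕ) (T : IneqType) : q ≤ T.tailStart q := by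
  cases T <;> simp [tailStart]

lemma Admissible.tailStart_le (hT : T.Admissible n q) : T.tailStart q ≤ n := by
  cases T <;> simp only [Admissible] at hT <;> simp only [tailStart] <;> omega

lemma forall_blow_t4_nonpos_iff (hε : ∀ j, IsSign (ε j)) (hT : (t4 k).Admissible n q) :
    (∀ d ∈ coordCone n (q - 2) (q - 1), (t4 k).blow q ε 0 d ≤ 0) ↔ (t4 k).ACQCond n q ε := by
  obtain ⟨hq, hk, hn⟩ := hT
  have hq : 2 ≤ q := hq
  have hzero : (0 : ℝ) ^ (k - 2) = 0 := zero_pow (by omega)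
  simp only [blow, hzero, mul_zero, zero_mul, zero_add]
  rw [forall_binary_add_tail_nonpos_iff (F := fun x y => x * y) (mul_zero 0) hε (by omega)
    (by omega) (by omega) (by omega) (by omega)]
  refine iff_of_false (fun h => ?_) id
  linarith [h.1 (-1) (-1) (by norm_num) (by norm_num)]

lemma forall_blow_t5_nonpos_iff (hε : ∀ j, IsSign (ε j)) (hT : t5.Admissible n q) :
    (∀ d ∈ coordCone n (q - 2) (q - 1), t5.blow q ε 0 d ≤ 0) ↔ t5.ACQCond n q ε := by
  obtain ⟨hq, hn⟩ := hT
  have hq : 2 ≤ q := hq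
  have hn : q + 1 ≤ n := hn
  simp only [blow, zero_mul, add_zero]
  rw [forall_unary_add_tail_nonpos_iff (F := fun x => ε (q - 1) * x ^ 2) (by simp) hε (by omega)
    (by omega) (by omega) (by omega)]
  refine and_congr_left fun _ => ⟨fun h => ?_, fun h x _ => ?_⟩
  · exact (hε _).eq_neg_one_of_nonpos (by simpa using h (-1) (by norm_num))
  · linarith [h, show ε (q - 1) * x ^ 2 = -x ^ 2 by rw [h]; ring, sq_nonneg x]

lemma forall_blow_t6_nonpos_iff {δ : ℕ → ℝ} {α : ℝ} (hε : ∀ j, IsSign (ε j))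
    (hT : (t6 δ α).Admissible n q) :
    (∀ d ∈ coordCone n (q - 3) (q - 1), (t6 δ α).blow q ε 0 d ≤ 0) ↔
      (t6 δ α).ACQCond n q ε := by
  obtain ⟨hq, hδ1, hδ2, hS, hn⟩ := hT
  have hq : 3 ≤ q := hq
  simp only [blow]
  rw [forall_binary_add_tail_nonpos_iff
    (F := fun x y => δ 1 * y ^ 2 + δ 2 * x ^ 2 + α * x * y) (by simp) hε (by omega)
    (by omega) (by omega) (by omega) (by omega)]
  simp only [ACQCond, ← and_assoc]
  refine and_congr_left fun _ => ⟨fun h => ?_, ?_⟩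
  · have h1 : δ 1 = -1 := hδ1.eq_neg_one_of_nonpos (by
      simpa using h 0 (-1) (by norm_num) (by norm_num))
    have h2 : δ 2 = -1 := hδ2.eq_neg_one_of_nonpos (by
      simpa using h (-1) 0 (by norm_num) (by norm_num))
    have hle := h (-1) (-1) (by norm_num) (by norm_num)
    refine ⟨⟨h1, h2⟩, lt_of_le_of_ne (by rw [h1, h2] at hle; linarith) fun h3 => hS ?_⟩
    rw [h1, h2, h3]
    norm_num
  · rintro ⟨⟨h1, h2⟩, hα⟩ x y hx hy
    have hxy := mul_nonneg_of_nonpos_of_nonpos (hx (by omega)) (hy (by omega))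
    rw [h1, h2]
    nlinarith [mul_nonneg (sub_nonneg.2 hα.le) hxy, sq_nonneg (x - y)]

lemma forall_blow_t7_nonpos_iff {ε' : ℝ} (hε : ∀ j, IsSign (ε j))
    (hT : (t7 ε').Admissible n q) :
    (∀ d ∈ coordCone n (q - 3) (q - 1), (t7 ε').blow q ε 0 d ≤ 0) ↔ (t7 ε').ACQCond n q ε := by
  obtain ⟨hq, -, hn⟩ := hT
  have hq : 3 ≤ q := hq
  simp only [blow, zero_mul, add_zero]
  rw [forall_binary_add_tail_nonpos_iff (F := fun x y => ε (q - 2) * (x + ε' * y) ^ 2) (by simp)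
    hε (by omega) (by omega) (by omega) (by omega) (by omega)]
  refine and_congr_left fun _ => ⟨fun h => ?_, fun h x y _ _ => ?_⟩
  · exact (hε _).eq_neg_one_of_nonpos (by simpa using h (-1) 0 (by norm_num) (by norm_num))
  · rw [h]
    linarith [sq_nonneg (x + ε' * y)]

lemma forall_blow_t8_nonpos_iff {ε' : ℝ} (hε : ∀ j, IsSign (ε j))
    (hT : (t8 ε').Admissible n q) :
    (∀ d ∈ coordCone n (q - 3) (q - 1), (t8 ε').blow q ε 0 d ≤ 0) ↔ (t8 ε').ACQCond n q ε := by
  obtain ⟨hq, hε', hn⟩ := hT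
  have hq : 3 ≤ q := hq
  simp only [blow, zero_mul, zero_add]
  rw [forall_binary_add_tail_nonpos_iff (F := fun x y => ε (q - 1) * y ^ 2 + ε' * x * y)
    (by simp) hε (by omega) (by omega) (by omega) (by omega) (by omega)]
  simp only [ACQCond, ← and_assoc]
  refine and_congr_left fun _ => ⟨fun h => ?_, ?_⟩
  · have hy : ε (q - 1) = -1 := (hε _).eq_neg_one_of_nonpos (by
      simpa using h 0 (-1) (by norm_num) (by norm_num))
    have hxy := h (-2) (-1) (by norm_num) (by norm_num)
    rw [hy] at hxy
    exact ⟨hy, hε'.resolve_left fun h1 => by rw [h1] at hxy; norm_num at hxy⟩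
  · rintro ⟨h1, h2⟩ x y hx hy
    rw [h1, h2]
    linarith [mul_nonneg_of_nonpos_of_nonpos (hx (by omega)) (hy (by omega)), sq_nonneg y]

lemma forall_blow_t9_nonpos_iff {ε01 ε02 ε12 : ℝ} (hε : ∀ j, IsSign (ε j))
    (hT : (t9 ε01 ε02 ε12).Admissible n q) :
    (∀ d ∈ coordCone n (q - 3) (q - 1), (t9 ε01 ε02 ε12).blow q ε 0 d ≤ 0) ↔
      (t9 ε01 ε02 ε12).ACQCond n q ε := by
  obtain ⟨hq, h01, -, -, hn⟩ := hT
  have hq : 3 ≤ q := hq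
  simp only [blow, zero_mul, zero_add]
  rw [forall_ternary_add_tail_nonpos_iff
    (F := fun x y z => ε01 * y * z + ε02 * x * z + ε12 * x * y) (by simp) hε (i := q - 2)
    (j := q - 1) (k := q) (by omega) (by omega) (by omega) (by omega) (by omega) (by omega)]
  refine iff_of_false (fun h => ?_) id
  have htest := h.1 0 (-1) (-ε01) (by norm_num) (by norm_num) (by omega)
  rcases h01 with rfl | rfl <;> norm_num at htest

lemma forall_blow_t10_nonpos_iff {δ : ℕ → ℝ} {α : ℕ → ℕ → ℝ} (hε : ∀ j, IsSign (ε j))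
    (hT : (t10 δ α).Admissible n q) :
    (∀ d ∈ coordCone n (q - 4) (q - 1), (t10 δ α).blow q ε 0 d ≤ 0) ↔
      (t10 δ α).ACQCond n q ε := by
  obtain ⟨hq, hδ, hα, hS, hn⟩ := hT
  have hq : 4 ≤ q := hq
  simp only [blow, zero_mul, add_zero]
  rw [forall_ternary_add_tail_nonpos_iff
    (F := fun x y z => δ 1 * x ^ 2 + δ 2 * y ^ 2 + δ 3 * z ^ 2 + α 1 2 * x * y + α 1 3 * x * z
      + α 2 3 * y * z) (by simp) hε (i := q - 3) (j := q - 2) (k := q - 1) (by omega) (by omega)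
    (by omega) (by omega) (by omega) (by omega), ACQCond]
  constructor
  · rintro ⟨h, hall⟩
    have h1 : δ 1 = -1 := (hδ 1 (by simp)).eq_neg_one_of_nonpos (by
      simpa using h (-1) 0 0 (by norm_num) (by norm_num) (by norm_num))
    have h2 : δ 2 = -1 := (hδ 2 (by simp)).eq_neg_one_of_nonpos (by
      simpa using h 0 (-1) 0 (by norm_num) (by norm_num) (by norm_num))
    have h3 : δ 3 = -1 := (hδ 3 (by simp)).eq_neg_one_of_nonpos (by
      simpa using h 0 0 (-1) (by norm_num) (by norm_num) (by norm_num))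
    refine ⟨h1, h2, h3, hall, (nonposOnOctant_iff_dagger hα h1 h2 h3 hS).1 fun x y z hx hy hz => ?_⟩
    have hle := h x y z (fun _ => hx) (fun _ => hy) (fun _ => hz)
    rw [h1, h2, h3] at hle
    linarith
  · rintro ⟨h1, h2, h3, hall, hdagger⟩
    refine ⟨fun x y z hx hy hz => ?_, hall⟩
    have hle := (nonposOnOctant_iff_dagger hα h1 h2 h3 hS).2 hdagger x y z (hx (by omega))
      (hy (by omega)) (hz (by omega))
    rw [h1, h2, h3]
    linarith

lemma forall_blow_nonpos_iff (hε : ∀ j, IsSign (ε j)) (hT : T.Admissible n q) :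
    (∀ d ∈ coordCone n (T.len q) (q - 1), T.blow q ε 0 d ≤ 0) ↔ T.ACQCond n q ε := by
  have hq := hT.1
  have hn := hT.tailStart_le
  cases T with
  | t1 k =>
    simp only [gap, tailStart] at hq hn
    exact forall_pow_add_tail_nonpos_iff hε (by simp only [len, gap]; omega) (by omega)
      (by omega) hT.2.1
  | t2 =>
    simp only [gap, tailStart] at hq hn
    simpa [blow, len, gap, ACQCond] using
      forall_unary_add_tail_nonpos_iff (n := n) (l := q - 1) (p := q - 1) (i := q) (a := q + 2)
        (F := fun _ => 0) rfl hε (by omega) (by omega) (by omega) (by omega)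
  | t3 k =>
    simp only [gap, tailStart] at hq hn
    have hpow := forall_pow_add_tail_nonpos_iff (l := q - 2) (p := q - 1) (i := q - 1) (n := n) hε
      (by omega) le_rfl (by omega) hT.2.1
    rwa [show q - 1 + 1 = q by omega] at hpow
  | t4 k => exact forall_blow_t4_nonpos_iff hε hT
  | t5 => exact forall_blow_t5_nonpos_iff hε hT
  | t6 δ α => exact forall_blow_t6_nonpos_iff hε hT
  | t7 ε' => exact forall_blow_t7_nonpos_iff hε hT
  | t8 ε' => exact forall_blow_t8_nonpos_iff hε hT
  | t9 ε01 ε02 ε12 => exact forall_blow_t9_nonpos_iff hε hT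
  | t10 δ α => exact forall_blow_t10_nonpos_iff hε hT

end IneqType

section IneqSetSigns

variable {n l p a : ℕ} {f : Vec n → ℝ} {H : ℝ → Vec n → ℝ} {ε : ℕ → ℝ}

lemma mul_sq_add_tail_succ (h : a ≤ n) (x : Vec n) :
    ε a * coord x a ^ 2 + tail ε (a + 1) x = tail ε a x := by
  rw [tail, tail, ← Finset.add_sum_Ioc_eq_sum_Icc h, ← Order.succ_eq_add_one,
    Finset.Icc_succ_left_eq_Ioc]

lemma posTangentConeAt_ineqSet_subset_coordCone :
    posTangentConeAt (ineqSet l p f) 0 ⊆ coordCone n 0 p := fun _ hd =>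
  ⟨fun j h1 h2 => by omega,
    fun j h1 h2 => coord_nonpos_of_mem_posTangentConeAt (fun x hx => hx.1 j h1 h2) hd⟩

lemma not_polarLE_ineqSet_of_dominated (hf : IsBlowup f H) (hlp : l ≤ p) (hpa : p < a)
    (han : a ≤ n) (hε : AllEq ε a n 1) (hdom : DominatedBySumSq p fun d => H 0 d - tail ε a d) :
    ¬ PolarLE (posTangentConeAt (ineqSet l p f) 0) (coordCone n l p) := by
  obtain ⟨c, hc⟩ := hdom
  refine not_polarLE_of_coord_sq_le (by omega) hpa han c posTangentConeAt_ineqSet_subset_coordCone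
    fun d hd => (coord_sq_le_tail hε d le_rfl han).trans ?_
  have hH : H 0 d ≤ 0 := hf.apply_nonpos_of_mem_posTangentConeAt
    (fun x hx => apply_nonpos_of_mem_ineqSet hlp hx) hd
  calc tail ε a d ≤ |H 0 d - tail ε a d| := by linarith [neg_le_abs (H 0 d - tail ε a d)]
    _ ≤ _ := hc d (posTangentConeAt_ineqSet_subset_coordCone hd)

lemma polarLE_ineqSet_of_not_allEq (hf : IsBlowup f H) (hlp : l ≤ p) (hε : ∀ j, IsSign (ε j))
    (hpa : p < a) (hsq : ∀ j, a ≤ j → j ≤ n → HasSquareTerm (H 0) j (ε j))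
    (h : ¬ AllEq ε a n 1) : PolarLE (posTangentConeAt (ineqSet l p f) 0) (coordCone n l p) := by
  obtain ⟨j, haj, hjn, hj⟩ := exists_eq_neg_one_of_not_allEq hε h
  exact polarLE_ineqSet hf hlp (by omega) hjn (hj ▸ hsq j haj hjn)

lemma polarLE_ineqSet_iff_not_allEq (hf : IsBlowup f H) (hlp : l ≤ p) (hε : ∀ j, IsSign (ε j))
    (hpa : p < a) (han : a ≤ n) (hsq : ∀ j, a ≤ j → j ≤ n → HasSquareTerm (H 0) j (ε j))
    (hdom : DominatedBySumSq p fun d => H 0 d - tail ε a d) :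
    PolarLE (posTangentConeAt (ineqSet l p f) 0) (coordCone n l p) ↔ ¬ AllEq ε a n 1 :=
  ⟨fun h hall => not_polarLE_ineqSet_of_dominated hf hlp hpa han hall hdom h,
    polarLE_ineqSet_of_not_allEq hf hlp hε hpa hsq⟩

lemma setCoord_neg_one_mem_posTangentConeAt_ineqSet (hf : IsBlowup f H) {j : ℕ} (hl : l < j)
    (hn : j ≤ n) (h : ∀ s > 0, H s (setCoord 0 j (-1)) ≤ 0) :
    setCoord 0 j (-1) ∈ posTangentConeAt (ineqSet l p f) 0 :=
  mem_posTangentConeAt_ineqSet hf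
    (setCoord_mem_coordCone (zero_mem_coordCone l p) hl hn fun _ => by norm_num)
    (eventually_mem_nhdsWithin.mono h)

lemma polarLE_ineqSet_cubic (hf : IsBlowup f H) {u w : ℕ} {c c' : ℝ} (hau : a ≠ u) (hla : l < a)
    (hap : a ≤ p) (hlu : l < u) (hup : u ≤ p) (hpw : p < w) (hwn : w ≤ n)
    (hH : ∀ s d, H s d = s * coord d w ^ 3 + coord d u * coord d w + c * coord d a * coord d w
      + c' * coord d a * coord d u + tail ε (w + 1) d) :
    PolarLE (posTangentConeAt (ineqSet l p f) 0) (coordCone n l p) := by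
  intro ℓ hℓ d hd
  have hfree : 0 ≤ ℓ (setCoord 0 w 1) := by
    refine map_setCoord_one_nonneg hℓ (by omega) hwn <|
      setCoord_neg_one_mem_posTangentConeAt_ineqSet hf (by omega) hwn fun s hs => ?_
    rw [hH]
    simp (disch := omega) only [coord_setCoord_self, coord_setCoord_ne, coord_zero,
      tail_setCoord_of_lt, tail_zero]
    linarith
  have hdir : 0 ≤ ℓ (setCoord 0 a 1) := by
    refine map_setCoord_one_nonneg hℓ (by omega) (by omega) <|
      setCoord_neg_one_mem_posTangentConeAt_ineqSet hf hla (by omega) fun s _ => ?_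
    rw [hH]
    simp (disch := omega) only [coord_setCoord_ne, coord_zero, tail_setCoord_of_lt, tail_zero]
    linarith
  have hplane := map_nonpos_of_coupled_ineqSet hf hlu hup hpw hwn
    (D := {d | d ∈ coordCone n l p ∧ coord d a = 0}) (fun d hd => hd.1)
    (fun d hd r => ⟨setCoord_mem_coordCone hd.1 (by omega) hwn (by omega), by
      rw [coord_setCoord_ne _ (by omega), hd.2]⟩)
    (fun d hd r hr => ⟨setCoord_mem_coordCone hd.1 hlu (by omega) fun _ => hr, by
      rw [coord_setCoord_ne _ hau, hd.2]⟩)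
    (T := tail ε (w + 1)) (tail_setCoord_of_lt ε w.lt_succ_self)
    (fun d hd => by rw [hH, hd.2]; ring) hℓ hfree (d := setCoord d a 0)
    ⟨setCoord_mem_coordCone hd hla (by omega) fun _ => le_rfl,
      coord_setCoord_self _ (by omega) (by omega) _⟩
  rw [map_setCoord ℓ _ (by omega) (by omega)] at hplane
  linarith [mul_nonpos_of_nonpos_of_nonneg (hd.2 a (by omega) hap) hdir]

end IneqSetSigns

namespace IneqType

variable {n q k : ℕ} {ε : ℕ → ℝ} {T : IneqType}

lemma hasSquareTerm_blow (hT : T.gap ≤ q) {j : ℕ} (hj : T.tailStart q ≤ j) (hn : j ≤ n) (s : ℝ) :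
    HasSquareTerm (fun x : Vec n => T.blow q ε s x) j (ε j) := fun x r => by
  cases T <;> simp only [tailStart, gap] at hj hT <;> simp only [blow] <;>
    simp (disch := omega) only [coord_setCoord_ne] <;>
    rw [hasSquareTerm_tail ε (by omega) hj hn] <;> ring

lemma Admissible.pred_lt_tailStart (hT : T.Admissible n q) : q - 1 < T.tailStart q := by
  have := hT.len_lt
  have := T.le_tailStart q
  omega

lemma polarLE_of_not_allEq (hε : ∀ j, IsSign (ε j)) (hT : T.Admissible n q)
    (h : ¬ AllEq ε (T.tailStart q) n 1) :
    PolarLE (posTangentConeAt (ineqSet (T.len q) (q - 1) fun x : Vec n => T.form q ε x) 0)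
      (coordCone n (T.len q) (q - 1)) :=
  polarLE_ineqSet_of_not_allEq (isBlowup ε hT) (Nat.le_sub_one_of_lt hT.len_lt) hε
    hT.pred_lt_tailStart (fun _ hj hn => hasSquareTerm_blow hT.1 hj hn 0) h

lemma polarLE_iff_not_allEq (hε : ∀ j, IsSign (ε j)) (hT : T.Admissible n q)
    (hdom : DominatedBySumSq (q - 1) fun d : Vec n => T.blow q ε 0 d - tail ε (T.tailStart q) d) :
    PolarLE (posTangentConeAt (ineqSet (T.len q) (q - 1) fun x : Vec n => T.form q ε x) 0)
      (coordCone n (T.len q) (q - 1)) ↔ ¬ AllEq ε (T.tailStart q) n 1 :=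
  polarLE_ineqSet_iff_not_allEq (isBlowup ε hT) (Nat.le_sub_one_of_lt hT.len_lt) hε
    hT.pred_lt_tailStart hT.tailStart_le (fun _ hj hn => hasSquareTerm_blow hT.1 hj hn 0) hdom

lemma polarLE_t1_two_iff (hε : ∀ j, IsSign (ε j)) (hT : (t1 2).Admissible n q) :
    PolarLE (posTangentConeAt (ineqSet (q - 1) (q - 1) fun x : Vec n => (t1 2).form q ε x) 0)
      (coordCone n (q - 1) (q - 1)) ↔ ¬ AllEq ε q n 1 := by
  obtain ⟨hq, -, -, hn⟩ := id hT
  have hq : 1 ≤ q := hq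
  have hblow : (fun d : Vec n => (t1 2).blow q ε 0 d) = tail ε q := funext fun d => by
    simp only [blow, Nat.sub_self, pow_zero, mul_one]
    exact mul_sq_add_tail_succ (by omega) d
  refine polarLE_ineqSet_iff_not_allEq (isBlowup ε hT) le_rfl hε (by omega) (by omega)
    (fun j hj hjn => ?_) (DominatedBySumSq.zero.congr fun d => ?_)
  · rw [hblow]
    exact hasSquareTerm_tail ε (by omega) hj hjn
  · rw [congrFun hblow d, sub_self]

lemma not_polarLE_t4 (hε : ∀ j, IsSign (ε j)) (hT : (t4 k).Admissible n q)
    (hall : AllEq ε (q + 1) n 1) (hsign : ε q ≠ (-1) ^ (k + 1)) :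
    ¬ PolarLE (posTangentConeAt (ineqSet (q - 2) (q - 1) fun x : Vec n => (t4 k).form q ε x) 0)
      (coordCone n (q - 2) (q - 1)) := by
  obtain ⟨hq, hk, hn⟩ := hT
  have hq : 2 ≤ q := hq
  refine not_polarLE_of_forall_mul_coord_nonpos (j := q) (σ := -1) (by omega) (by omega) (by omega)
    (by norm_num) fun x hx => ?_
  have hform := apply_nonpos_of_mem_ineqSet (by omega) hx
  simp only [form] at hform
  by_contra! hneg
  have hcross := mul_nonneg_of_nonpos_of_nonpos (hx.1 (q - 1) (by omega) le_rfl)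
    (show coord x q ≤ 0 by linarith)
  have hpow : 0 < ε q * coord x q ^ k := by
    rcases hk with rfl | rfl
    · rw [(hε q).resolve_left (fun h => hsign (by rw [h]; norm_num))]
      linarith [pow_pos hneg 3, show (-1 * coord x q) ^ 3 = -1 * coord x q ^ 3 by ring]
    · rw [(hε q).resolve_right (fun h => hsign (by rw [h]; norm_num))]
      linarith [pow_pos hneg 4, show (-1 * coord x q) ^ 4 = 1 * coord x q ^ 4 by ring]
  linarith [tail_nonneg hall x]

lemma polarLE_t4_of_eq (hT : (t4 k).Admissible n q) (hsign : ε q = (-1) ^ (k + 1)) :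
    PolarLE (posTangentConeAt (ineqSet (q - 2) (q - 1) fun x : Vec n => (t4 k).form q ε x) 0)
      (coordCone n (q - 2) (q - 1)) := by
  obtain ⟨hq, hk, hn⟩ := id hT
  have hq : 2 ≤ q := hq
  have hf := isBlowup (n := n) ε hT
  intro ℓ hℓ d hd
  refine map_nonpos_of_coupled_ineqSet hf (u := q - 1) (w := q) (D := coordCone n (q - 2) (q - 1))
    (T := tail ε (q + 1)) (by omega) le_rfl (by omega) (by omega) subset_rfl
    (fun d hd r => setCoord_mem_coordCone hd (by omega) (by omega) (by omega))
    (fun d hd r hr => setCoord_mem_coordCone hd (by omega) (by omega) fun _ => hr)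
    (tail_setCoord_of_lt ε q.lt_succ_self) (fun d _ => ?_) hℓ ?_ hd
  · simp only [blow, zero_pow (show k - 2 ≠ 0 by omega)]
    ring
  · refine map_setCoord_one_nonneg hℓ (by omega) (by omega) <|
      setCoord_neg_one_mem_posTangentConeAt_ineqSet hf (by omega) (by omega) fun s hs => ?_
    have hodd : (-1 : ℝ) ^ (k + 1) * (-1) ^ k = -1 := by
      rw [← pow_add, Odd.neg_one_pow ⟨k, by ring⟩]
    simp (disch := omega) only [blow, coord_setCoord_self, coord_setCoord_ne, coord_zero,
      tail_setCoord_of_lt, tail_zero, hsign, mul_right_comm _ (s ^ (k - 2)), hodd]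
    linarith [pow_pos hs (k - 2)]

lemma polarLE_t4_iff (hε : ∀ j, IsSign (ε j)) (hT : (t4 k).Admissible n q) :
    PolarLE (posTangentConeAt (ineqSet (q - 2) (q - 1) fun x : Vec n => (t4 k).form q ε x) 0)
      (coordCone n (q - 2) (q - 1)) ↔ (t4 k).GCQCond n q ε := by
  refine ⟨not_imp_not.1 fun h => ?_, ?_⟩
  · rw [GCQCond, not_or, not_not] at h
    exact not_polarLE_t4 hε hT h.1 h.2
  · rintro (h | h)
    exacts [polarLE_of_not_allEq hε hT h, polarLE_t4_of_eq hT h]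

variable {ε01 ε02 ε12 : ℝ}

lemma not_polarLE_t9 (hq : 3 ≤ q) (hn : q ≤ n) (h12 : IsSign ε12) (hall : AllEq ε (q + 1) n 1) :
    ¬ PolarLE (posTangentConeAt
        (ineqSet (q - 3) (q - 1) fun x : Vec n => (t9 (-1) (-1) ε12).form q ε x) 0)
      (coordCone n (q - 3) (q - 1)) := by
  have hM : ∀ x ∈ ineqSet (q - 3) (q - 1) fun x : Vec n => (t9 (-1) (-1) ε12).form q ε x,
      (coordL n q + coordL n (q - 2) + coordL n (q - 1)) x ≤ 0 := by
    intro x hx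
    have hform := apply_nonpos_of_mem_ineqSet (by omega) hx
    simp only [form] at hform
    simp only [add_apply, coordL_apply]
    exact add_add_nonpos_of_cubic (hx.1 _ (by omega) (by omega)) (hx.1 _ (by omega) (by omega))
      h12 (tail_nonneg hall x) (by linarith)
  refine not_polarLE_of_pos _ (fun d hd => apply_nonpos_of_mem_posTangentConeAt _ hM hd)
    (setCoord_mem_coordCone (zero_mem_coordCone _ _) (j := q) (r := 1) (by omega) hn (by omega)) ?_
  simp (disch := omega) only [add_apply, coordL_apply, coord_setCoord_ne, coord_setCoord_self,
    coord_zero]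
  norm_num

lemma polarLE_t9_iff (hε : ∀ j, IsSign (ε j)) (hT : (t9 ε01 ε02 ε12).Admissible n q) :
    PolarLE (posTangentConeAt
        (ineqSet (q - 3) (q - 1) fun x : Vec n => (t9 ε01 ε02 ε12).form q ε x) 0)
      (coordCone n (q - 3) (q - 1)) ↔ (t9 ε01 ε02 ε12).GCQCond n q ε := by
  obtain ⟨hq, h01, h02, h12, hn⟩ := id hT
  have hq : 3 ≤ q := hq
  refine ⟨not_imp_not.1 fun h => ?_, ?_⟩
  · simp only [GCQCond, not_or, not_not] at h
    rw [h01.resolve_left h.2.1, h02.resolve_left h.2.2]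
    exact not_polarLE_t9 hq (by omega) h12 h.1
  · rintro (h | rfl | rfl)
    · exact polarLE_of_not_allEq hε hT h
    · exact polarLE_ineqSet_cubic (isBlowup ε hT) (a := q - 2) (u := q - 1) (w := q) (c := ε02)
        (c' := ε12) (by omega) (by omega) (by omega) (by omega) (by omega) (by omega) (by omega)
        fun s d => by simp only [blow]; ring
    · exact polarLE_ineqSet_cubic (isBlowup ε hT) (a := q - 1) (u := q - 2) (w := q) (c := ε01)
        (c' := ε12) (by omega) (by omega) (by omega) (by omega) (by omega) (by omega) (by omega)
        fun s d => by simp only [blow]; ring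

lemma polarLE_t1_iff (hε : ∀ j, IsSign (ε j)) (hT : (t1 k).Admissible n q) :
    PolarLE (posTangentConeAt (ineqSet (q - 1) (q - 1) fun x : Vec n => (t1 k).form q ε x) 0)
      (coordCone n (q - 1) (q - 1)) ↔ (t1 k).GCQCond n q ε := by
  rcases hT.2.1.eq_or_lt with rfl | hk
  · rw [polarLE_t1_two_iff hε hT, GCQCond, allEq_iff_and_allEq_succ (by linarith [hT.2.2.2])]
    tauto
  · have hzero : (0 : ℝ) ^ (k - 2) = 0 := zero_pow (by omega)
    simp only [GCQCond, hk.ne', false_and, false_or]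
    exact polarLE_iff_not_allEq hε hT
      (DominatedBySumSq.zero.congr fun d => by simp [blow, tailStart, hzero])

lemma polarLE_iff (hε : ∀ j, IsSign (ε j)) (hT : T.Admissible n q) :
    PolarLE (posTangentConeAt (ineqSet (T.len q) (q - 1) fun x : Vec n => T.form q ε x) 0)
      (coordCone n (T.len q) (q - 1)) ↔ T.GCQCond n q ε := by
  have hgap := hT.1
  have hmem (i : ℕ) (h1 : 1 ≤ i := by omega) (hi : i < q := by omega) :
      i ∈ Finset.Icc 1 (q - 1) := Finset.mem_Icc.2 ⟨h1, by omega⟩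
  cases T <;> simp only [gap] at hgap
  case t1 k => exact polarLE_t1_iff hε hT
  case t4 k => exact polarLE_t4_iff hε hT
  case t9 ε01 ε02 ε12 => exact polarLE_t9_iff hε hT
  all_goals refine polarLE_iff_not_allEq hε hT ?_
  case t2 => exact DominatedBySumSq.zero.congr fun d => by simp [blow, tailStart]
  case t3 k =>
    rcases hT.2.1.eq_or_lt with rfl | hk
    · exact ((DominatedBySumSq.coord_mul_coord (hmem (q - 1)) (hmem (q - 1))).const_mul
        (ε (q - 1))).congr fun d => by simp only [blow, tailStart]; ring
    · have hzero : (0 : ℝ) ^ (k - 2) = 0 := zero_pow (by omega)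
      exact DominatedBySumSq.zero.congr fun d => by simp [blow, tailStart, hzero]
  case t5 =>
    exact ((DominatedBySumSq.coord_mul_coord (hmem (q - 1)) (hmem (q - 1))).const_mul
      (ε (q - 1))).congr fun d => by simp only [blow, tailStart]; ring
  case t6 δ α =>
    exact (DominatedBySumSq.binary_form (hmem (q - 2)) (hmem (q - 1)) (δ 2) (δ 1) α).congr
      fun d => by simp only [blow, tailStart]; ring
  case t7 ε' =>
    exact (DominatedBySumSq.binary_form (hmem (q - 2)) (hmem (q - 1)) (ε (q - 2))
      (ε (q - 2) * ε' ^ 2) (2 * ε (q - 2) * ε')).congr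
      fun d => by simp only [blow, tailStart]; ring
  case t8 ε' =>
    exact (DominatedBySumSq.binary_form (hmem (q - 2)) (hmem (q - 1)) 0 (ε (q - 1)) ε').congr
      fun d => by simp only [blow, tailStart]; ring
  case t10 δ α =>
    exact (DominatedBySumSq.ternary_form (hmem (q - 3)) (hmem (q - 2)) (hmem (q - 1)) (δ 1) (δ 2)
      (δ 3) (α 1 2) (α 1 3) (α 2 3)).congr fun d => by simp only [blow, tailStart]; ring

theorem classification {l₁ : ℕ} (hε : ∀ j, IsSign (ε j)) (hT : T.Admissible n q)
    (hl : l₁ ≤ (T.len q + 1) / 2) {g : Vec n → Fin q → ℝ} {h : Vec n → Fin 0 → ℝ}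
    (hK : KGEquiv g h (T.normalForm n q l₁ ε) noConstraint) :
    ¬ LICQ g h ∧ (MFCQ g h ↔ 0 < l₁) ∧ (0 < l₁ → ACQ g h ∧ GCQ g h) ∧
      (l₁ = 0 → (ACQ g h ↔ T.ACQCond n q ε) ∧ (GCQ g h ↔ T.GCQCond n q ε)) := by
  have hlen := hT.len_lt
  have hlast := coordCone_subset_posTangentConeAt_ineqSet_iff (isBlowup ε hT)
    (Nat.le_sub_one_of_lt hlen) (hT.pred_lt_tailStart.trans_le hT.tailStart_le) le_rfl (hε n)
    (hasSquareTerm_blow hT.1 hT.tailStart_le le_rfl 0)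
  rw [← polarLE_iff hε hT, ← forall_blow_nonpos_iff hε hT, ← hlast]
  exact constraintQualifications hT (by omega) hK

end IneqType

end CQ

end

theorem mainTheorem1 :
    -- LICQ holds exactly for the regular class (inactive inequality constraints being removed).
    (∀ (n q r : ℕ) (g : CQ.Vec n → Fin q → ℝ) (h : CQ.Vec n → Fin r → ℝ),
      CQ.SmoothGerm g → CQ.SmoothGerm h → (∀ i, g 0 i ≤ 0) → h 0 = 0 →
      (CQ.LICQ g h ↔ ∃ (s : ℕ) (e : Fin s ≃ CQ.Active g), s + r ≤ n ∧
        CQ.KGEquiv (fun x a => g x (e a).1) h (CQ.coords 0 s) (CQ.coords s r))) ∧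
    -- MFCQ fails whenever a singular equality constraint is present.
    (∀ (n q r : ℕ) (g : CQ.Vec n → Fin q → ℝ) (h : CQ.Vec n → Fin r → ℝ),
      ¬ LinearIndependent ℝ (CQ.diff h) → ¬ CQ.MFCQ g h) ∧
    -- Classes with one equality constraint and no inequality constraints.
    (∀ (n : ℕ) (ε : ℕ → ℝ) (T : CQ.EqType), (∀ j, CQ.IsSign (ε j)) → T.Admissible n →
      ∀ (g : CQ.Vec n → Fin 0 → ℝ) (h : CQ.Vec n → Fin 1 → ℝ),
        CQ.KGEquiv g h CQ.noConstraint (CQ.single fun x => T.form ε x) →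
        ¬ CQ.LICQ g h ∧ ¬ CQ.MFCQ g h ∧ ¬ CQ.ACQ g h ∧ (CQ.GCQ g h ↔ T.GCQCond n ε)) ∧
    -- Classes with inequality constraints only.
    (∀ (n q l₁ : ℕ) (ε : ℕ → ℝ) (T : CQ.IneqType), (∀ j, CQ.IsSign (ε j)) →
      T.Admissible n q → l₁ ≤ (T.len q + 1) / 2 →
      ∀ (g : CQ.Vec n → Fin q → ℝ) (h : CQ.Vec n → Fin 0 → ℝ),
        CQ.KGEquiv g h (T.normalForm n q l₁ ε) CQ.noConstraint →
        ¬ CQ.LICQ g h ∧ (CQ.MFCQ g h ↔ 0 < l₁) ∧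
        (0 < l₁ → CQ.ACQ g h ∧ CQ.GCQ g h) ∧
        (l₁ = 0 → (CQ.ACQ g h ↔ T.ACQCond n q ε) ∧ (CQ.GCQ g h ↔ T.GCQCond n q ε))) ∧
    -- Classes with one equality constraint and at least one inequality constraint.
    (∀ (n : ℕ) (ε : ℕ → ℝ) (T : CQ.MixedType), (∀ j, CQ.IsSign (ε j)) → T.Admissible n →
      ∀ (g : CQ.Vec n → Fin T.numIneq → ℝ) (h : CQ.Vec n → Fin 1 → ℝ),
        CQ.KGEquiv g h (CQ.coords 0 T.numIneq) (CQ.single fun x => T.form ε x) →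
        ¬ CQ.LICQ g h ∧ ¬ CQ.MFCQ g h ∧ ¬ CQ.ACQ g h ∧
        (CQ.GCQ g h ↔ T.GCQCond n ε)) :=
  ⟨fun _ _ _ _ _ hg hh _ h0 => CQ.licq_iff_regular hg hh h0,
    fun _ _ _ _ _ hd hM => hd hM.1,
    fun _ _ _ hε hT _ _ hK => CQ.EqType.classification hε hT hK,
    fun _ _ _ _ _ hε hT hl _ _ hK => CQ.IneqType.classification hε hT hl hK,
    fun _ _ _ hε hT _ _ hK => CQ.MixedType.classification hε hT hK⟩
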